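/- All graphs are finite; parallel edges and self-loops are allowed. An orientation of a graph $Z$ directs every edge. Its antisymmetric adjacency matrix $A$ has as entry $A_{v,w}$ the number of edges directed from $v$ to $w$ minus the number directed from $w$ to $v$. For a given ordering of the vertices, $\mathrm{Pf}(A)$ is expanded into one term $t(m)=\pm1$ for each perfect matching $m$ of $Z$ (matchings using different parallel edges are different): $t(m)$ is the sign, relative to the given ordering, of the ordering $a_1,b_1,a_2,b_2,\dots$ of the vertices, where $a_i\to b_i$ are the directed edges of $m$. The graph $Z$ is Pfaffian if it has an orientation for which all the terms have the same sign. (If the number of vertices is odd, then $\mathrm{Pf}(A)=0$ and there are no terms.) Suppose that $Z$ is embedded in a closed surface so that all faces are disks, i.e. the surface is obtained from polygons by gluing their sides in pairs, and $Z$ is formed by the glued sides and corners. The embedding is locally bipartite if every face has an even number of sides (an edge both of whose sides lie on the face counts twice). The curvature of an orientation at a face with an even number of sides is $1$ if an odd number of its sides point in the direction of a walk around the face, and $-1$ otherwise; this does not depend on the direction of the walk. An orientation is flat if its curvature is $1$ at every face. **Theorem.** Let $Z$ be a connected graph embedded in the projective plane (the connected closed surface of Euler characteristic $1$) so that all faces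 are disks with an even number of sides, and suppose that $Z$ is not bipartite. Then $Z$ is Pfaffian. More precisely: 1. If $Z$ has an even number of vertices, then $Z$ has a flat orientation. 2. For every flat orientation of $Z$, all the terms of $\mathrm{Pf}(A)$ have the same sign, and hence the number of perfect matchings of $Z$ equals $|\mathrm{Pf}(A)|$, for every ordering of the vertices. -/

import Mathlib

/-! ### Finite multigraphs, orientations, perfect matchings -/

/-- A multigraph (parallel edges and self-loops allowed) with vertex set `V` and set of darts `D`.
A dart is an edge together with one of its two directions; `src d` is the vertex at which the dart
starts and `rev d` is the same edge in the opposite direction. -/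
structure Multigraph (V D : Type*) where
  src : D → V
  rev : Equiv.Perm D
  rev_rev : ∀ d, rev (rev d) = d
  rev_ne : ∀ d, rev d ≠ d

namespace Multigraph

variable {V D : Type*}

/-- The vertex at which a dart ends. -/
def tgt (Z : Multigraph V D) (d : D) : V := Z.src (Z.rev d)

/-- The edges of `Z`: unordered pairs `{d, rev d}` of opposite darts. -/
def Edge (Z : Multigraph V D) : Type _ :=
  MulAction.orbitRel.Quotient (Subgroup.zpowers Z.rev) D

/-- `Z` is non-empty and any two vertices are joined by a walk. -/
def Connected (Z : Multigraph V D) : Prop :=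
  Nonempty V ∧
    ∀ v w : V, Relation.ReflTransGen (fun x y => ∃ d, Z.src d = x ∧ Z.tgt d = y) v w

/-- The vertices can be coloured black and white so that every edge joins opposite colours. -/
def IsBipartite (Z : Multigraph V D) : Prop :=
  ∃ c : V → Bool, ∀ d, c (Z.src d) ≠ c (Z.tgt d)

/-- An orientation of `Z`: exactly one of the two darts of every edge is chosen. The edge points
in the direction of the chosen dart. -/
structure Orientation (Z : Multigraph V D) where
  darts : Set D
  mem_iff : ∀ d, d ∈ darts ↔ Z.rev d ∉ darts

/-- A perfect matching of `Z`, as the set of the darts of its edges: every vertex is the start of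
exactly one dart in `m`. In particular `m` contains no self-loop, and parallel edges give different
matchings. -/
def IsPerfectMatching (Z : Multigraph V D) (m : Set D) : Prop :=
  (∀ d ∈ m, Z.rev d ∈ m) ∧ ∀ v : V, ∃! d, d ∈ m ∧ Z.src d = v

/-- The number of perfect matchings of `Z`. -/
noncomputable def numPerfectMatchings (Z : Multigraph V D) : ℕ :=
  {m : Set D | Z.IsPerfectMatching m}.ncard

/-- The antisymmetric adjacency matrix of an oriented graph: the entry at `(v, w)` is the number of
edges that point from `v` to `w` minus the number of edges that point from `w` to `v`. -/
noncomputable def adjMatrix (Z : Multigraph V D) (o : Z.Orientation) : Matrix V V ℤ :=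
  Matrix.of fun v w =>
    ({d | d ∈ o.darts ∧ Z.src d = v ∧ Z.tgt d = w}.ncard : ℤ)
      - ({d | d ∈ o.darts ∧ Z.src d = w ∧ Z.tgt d = v}.ncard : ℤ)

end Multigraph

/-! ### Pfaffians -/

/-- The position `2 i` among `0, …, 2 k - 1`. -/
def evenPos {k : ℕ} (i : Fin k) : Fin (2 * k) := ⟨2 * i.1, by omega⟩

/-- The position `2 i + 1` among `0, …, 2 k - 1`. -/
def oddPos {k : ℕ} (i : Fin k) : Fin (2 * k) := ⟨2 * i.1 + 1, by omega⟩

/-- The Pfaffian of an antisymmetric `2 k × 2 k` matrix `A`: the sum over all partitions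
`{i₁, j₁}, …, {i_k, j_k}` of the rows into pairs (normalized by `i_r < j_r` and `i₁ < ⋯ < i_k`) of
`A i₁ j₁ ⋯ A i_k j_k` times the sign of the permutation `i₁, j₁, …, i_k, j_k`. -/
def pfaffian {R : Type*} [CommRing R] {k : ℕ} (A : Matrix (Fin (2 * k)) (Fin (2 * k)) R) : R :=
  ∑ σ ∈ Finset.univ.filter (fun σ : Equiv.Perm (Fin (2 * k)) =>
      (∀ i : Fin k, σ (evenPos i) < σ (oddPos i)) ∧
        ∀ i j : Fin k, i < j → σ (evenPos i) < σ (evenPos j)),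
    ((Equiv.Perm.sign σ : ℤ) : R) * ∏ i : Fin k, A (σ (evenPos i)) (σ (oddPos i))

namespace Multigraph

variable {V D : Type*}

/-- The Pfaffian of the oriented graph `(Z, o)`, with respect to an ordering of the vertices. -/
noncomputable def pf (Z : Multigraph V D) (o : Z.Orientation) {k : ℕ} (ord : Fin (2 * k) ≃ V) : ℤ :=
  pfaffian ((Z.adjMatrix o).submatrix ord ord)

/-- `ℓ` lists all the vertices as `a₁, b₁, a₂, b₂, …, a_k, b_k`, where `a_i → b_i` are the edges of
the matching `m`, directed by the orientation `o`. -/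
def Lists (Z : Multigraph V D) (o : Z.Orientation) (m : Set D) {k : ℕ}
    (ℓ : Fin (2 * k) ≃ V) : Prop :=
  ∀ i : Fin k, ∃ d ∈ m ∩ o.darts, Z.src d = ℓ (evenPos i) ∧ Z.tgt d = ℓ (oddPos i)

/-- The term of the perfect matching `m` in the expansion of the Pfaffian of `(Z, o)` is `s = ±1`:
the listing `a₁, b₁, …, a_k, b_k` of the vertices along the directed edges of `m` (in any order of
the edges) differs from the given ordering of the vertices by a permutation of sign `s`. -/
def HasTerm (Z : Multigraph V D) (o : Z.Orientation) {k : ℕ} (ord : Fin (2 * k) ≃ V)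
    (m : Set D) (s : ℤˣ) : Prop :=
  (∃ ℓ : Fin (2 * k) ≃ V, Z.Lists o m ℓ) ∧
    ∀ ℓ : Fin (2 * k) ≃ V, Z.Lists o m ℓ → Equiv.Perm.sign (ℓ.trans ord.symm) = s

/-- All the terms of the Pfaffian of `(Z, o)` have the same sign. (If the number of vertices is odd,
there are no perfect matchings, hence no terms, and this holds trivially.) -/
def IsPfaffianOrientation (Z : Multigraph V D) (o : Z.Orientation) : Prop :=
  ∀ (k : ℕ) (ord : Fin (2 * k) ≃ V),
    ∃ s : ℤˣ, ∀ m : Set D, Z.IsPerfectMatching m → Z.HasTerm o ord m s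

/-- `Z` is Pfaffian: it has an orientation for which all terms of the Pfaffian have the same sign. -/
def IsPfaffian (Z : Multigraph V D) : Prop :=
  ∃ o : Z.Orientation, Z.IsPfaffianOrientation o

end Multigraph

/-! ### Graphs embedded in closed surfaces with disks as faces -/

/-- An embedding of `Z` in a closed surface all of whose faces are disks, given by the flags of the
resulting cell structure.

Each face is a polygon, and each side of a polygon has two halves; `Φ` is the set of all these
half-sides (flags). A flag `φ` belongs to a vertex, an edge and a face; `dart φ` is its edge,
directed away from its vertex.
* `τ₀ φ` is the other half of the same side of the same polygon;
* `τ₁ φ` is the half-side next to `φ` around the corner of the same polygon, at the same vertex;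
* `τ₂ φ` is the half-side that is glued to `φ`, so that it lies across the edge.

The sides of the polygons are thus glued in pairs, and the surface is the result of the gluing. Each
dart has two flags, one on each side of it (`dart_eq_iff`), and each vertex of `Z` is one vertex of
the glued surface: the flags at a vertex are exactly one orbit of `τ₁` and `τ₂` (`src_eq_iff`).
An isolated vertex cannot occur, since no face around it would be a polygon. -/
structure CellEmbedding {V D : Type*} (Z : Multigraph V D) (Φ : Type*) where
  τ₀ : Equiv.Perm Φ
  τ₁ : Equiv.Perm Φ
  τ₂ : Equiv.Perm Φ
  τ₀_τ₀ : ∀ φ, τ₀ (τ₀ φ) = φ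
  τ₁_τ₁ : ∀ φ, τ₁ (τ₁ φ) = φ
  τ₂_τ₂ : ∀ φ, τ₂ (τ₂ φ) = φ
  τ₀_ne : ∀ φ, τ₀ φ ≠ φ
  τ₁_ne : ∀ φ, τ₁ φ ≠ φ
  τ₂_ne : ∀ φ, τ₂ φ ≠ φ
  τ₀_τ₂ : ∀ φ, τ₀ (τ₂ φ) = τ₂ (τ₀ φ)
  dart : Φ → D
  dart_surjective : Function.Surjective dart
  dart_eq_iff : ∀ φ ψ, dart φ = dart ψ ↔ ψ = φ ∨ ψ = τ₂ φ
  dart_τ₀ : ∀ φ, dart (τ₀ φ) = Z.rev (dart φ)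
  src_surjective : Function.Surjective Z.src
  src_eq_iff : ∀ φ ψ, Z.src (dart φ) = Z.src (dart ψ) ↔
    ∃ g ∈ Subgroup.closure ({τ₁, τ₂} : Set (Equiv.Perm Φ)), g φ = ψ

namespace CellEmbedding

variable {V D Φ : Type*} {Z : Multigraph V D}

/-- The faces: orbits of `τ₀` and `τ₁`. -/
def Face (M : CellEmbedding Z Φ) : Type _ :=
  MulAction.orbitRel.Quotient (Subgroup.closure ({M.τ₀, M.τ₁} : Set (Equiv.Perm Φ))) Φ

/-- The Euler characteristic of the surface: vertices minus edges plus faces. -/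
noncomputable def eulerChar (M : CellEmbedding Z Φ) : ℤ :=
  (Nat.card V : ℤ) - (Nat.card Z.Edge : ℤ) + (Nat.card M.Face : ℤ)

/-- The surface is the projective plane, which among all closed surfaces is the connected one with
Euler characteristic `1`. -/
def IsProjectivePlane (M : CellEmbedding Z Φ) : Prop :=
  MulAction.IsPretransitive
      (Subgroup.closure ({M.τ₀, M.τ₁, M.τ₂} : Set (Equiv.Perm Φ))) Φ ∧
    M.eulerChar = 1

/-- One step of the walk around the boundary of a face: from a flag `φ` go along its edge to the
other end, then turn the corner to the next side of the same face. -/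
def next (M : CellEmbedding Z Φ) : Equiv.Perm Φ := M.τ₁ * M.τ₀

/-- The sides of the face at `φ`, each one represented by its half that comes first if one walks
around the face in the direction that starts at `φ` (the walk from `τ₀ φ` has the opposite
direction). An edge both of whose sides lie on the face contributes two sides. -/
def sides (M : CellEmbedding Z Φ) (φ : Φ) : Set Φ := {ψ | M.next.SameCycle φ ψ}

/-- Every face has an even number of sides. (All faces are disks by construction.) -/
def LocallyBipartite (M : CellEmbedding Z Φ) : Prop :=
  ∀ φ, Even (M.sides φ).ncard

open Classical in
/-- The curvature of an orientation at the face of `φ`: it is `1` if an odd number of sides point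
in the direction of the walk around the face that starts at `φ`, and `-1` otherwise. For a
face with an even number of sides it does not depend on the direction. -/
noncomputable def curvature (M : CellEmbedding Z Φ) (o : Z.Orientation) (φ : Φ) : ℤ :=
  if Odd {ψ | ψ ∈ M.sides φ ∧ M.dart ψ ∈ o.darts}.ncard then 1 else -1

/-- An orientation is flat if its curvature is `1` at all faces. -/
def IsFlat (M : CellEmbedding Z Φ) (o : Z.Orientation) : Prop :=
  ∀ φ, M.curvature o φ = 1

end CellEmbedding

/-! The proof works on the orientation double cover, whose darts are the flags, with rotation `rot`,
reversal `flip` and face permutation `next`. Doubling the Euler characteristic 1 gives 2, and the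
cover is connected because an odd Euler characteristic excludes an orientation (`not_orientable`,
`cover_connected`); so it behaves as a sphere. There cycles modulo two are boundaries and cocycles
are coboundaries, by a dimension count (`exists_face_function`, `exists_vertex_function`). Since all
faces are even, the cover has a bipartite colouring `c`. Since `Z` is not bipartite, the deck
transformation `τ₂` exchanges the colours, so every vertex of `Z` has exactly one lift of each
colour (`exists_cover_colouring`).

Equal signs. Given two perfect matchings, a colouring `β` of the vertices alternates along the edges
of both. Lifting each vertex `v` to its lift of colour `β v` lifts both matchings, and the edges in
which they differ become disjoint circuits on the sphere, which bound a set of faces. This is where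
Kasteleyn's planar argument applies. Instead of counting inside discs, `sign_boundary_walk` takes
signs in an identity between permutations: turning around faces, reversing interior edges, turning
around vertices, walking along the boundary. Flatness is the sign of the first of these. The result,
`sign_matchings`, is exactly the factor that `sign_pairing` needs for the permutation between two
listings to be even.

Existence. On the cover, flatness is a solvable linear system modulo two. Making a solution
invariant under `τ₂` leaves one obstruction in `ZMod 2`, and if it is nonzero, counting faces and
edges shows that the number of vertices is odd (`exists_isFlat`).

Counting. Expanding every matrix entry over darts turns the Pfaffian into a sum with one term `±1`
for each perfect matching (`abs_pf_eq`). -/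

/-! ### Signs and cycle sums of permutations -/

/-- The sign `(-1) ^ a` for `a` modulo two. -/
def zsign (a : ZMod 2) : ℤˣ := if a = 0 then 1 else -1

@[simp] theorem zsign_zero : zsign 0 = 1 := rfl

@[simp] theorem zsign_one : zsign 1 = -1 := rfl

theorem zsign_add (a b : ZMod 2) : zsign (a + b) = zsign a * zsign b := by
  revert a b; decide

theorem zsign_mul_self (a : ZMod 2) : zsign a * zsign a = 1 := by
  revert a; decide

theorem zsign_injective : Function.Injective zsign := by
  intro a b; revert a b; decide

theorem zsign_natCast (n : ℕ) : zsign n = (-1) ^ n := by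
  induction n with
  | zero => simp
  | succ n ih => rw [Nat.cast_succ, zsign_add, ih, pow_succ]; rfl

theorem zsign_sum {ι : Type*} (s : Finset ι) (f : ι → ZMod 2) :
    zsign (∑ i ∈ s, f i) = ∏ i ∈ s, zsign (f i) := by
  classical
  induction s using Finset.induction_on with
  | empty => simp
  | insert a s ha ih => rw [Finset.sum_insert ha, Finset.prod_insert ha, zsign_add, ih]

theorem ZMod.two_eq_zero_or_one (a : ZMod 2) : a = 0 ∨ a = 1 := by
  revert a; decide

theorem ZMod.two_add_one_eq_of_ne {a b : ZMod 2} (h : a ≠ b) : a = b + 1 := by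
  revert a b; decide

theorem ZMod.two_add_eq_zero_iff {a b : ZMod 2} : a + b = 0 ↔ b = a := by
  revert a b; decide

theorem ZMod.two_add_self (a : ZMod 2) : a + a = 0 := by
  revert a; decide

section restr

variable {X : Type*}

open Classical in
/-- The permutation that agrees with `f` on the invariant set `p` and fixes everything else. -/
noncomputable def restr (f : Equiv.Perm X) (p : X → Prop) (h : ∀ a, p (f a) ↔ p a) :
    Equiv.Perm X :=
  Equiv.Perm.ofSubtype (f.subtypePerm h)

theorem restr_of {f : Equiv.Perm X} {p : X → Prop} {h : ∀ a, p (f a) ↔ p a} {a : X} (ha : p a) :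
    restr f p h a = f a := by
  classical
  rw [restr, Equiv.Perm.ofSubtype_apply_of_mem _ ha]; rfl

theorem restr_of_not {f : Equiv.Perm X} {p : X → Prop} {h : ∀ a, p (f a) ↔ p a} {a : X}
    (ha : ¬ p a) : restr f p h a = a := by
  classical
  rw [restr, Equiv.Perm.ofSubtype_apply_of_not_mem _ ha]

theorem restr_sameCycle {f : Equiv.Perm X} {p : X → Prop} {h : ∀ a, p (f a) ↔ p a} {a b : X}
    (ha : p a) : (restr f p h).SameCycle a b ↔ f.SameCycle a b := by
  have key : ∀ n : ℤ, ((restr f p h) ^ n) a = (f ^ n) a ∧ p ((f ^ n) a) := by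
    intro n
    induction n using Int.induction_on with
    | zero => simpa using ha
    | succ n ih =>
      rw [add_comm, zpow_add, zpow_add, zpow_one, zpow_one, Equiv.Perm.mul_apply,
        Equiv.Perm.mul_apply, ih.1, restr_of ih.2]
      exact ⟨rfl, (h _).2 ih.2⟩
    | pred n ih =>
      rw [sub_eq_neg_add, zpow_add, zpow_add, zpow_neg_one, zpow_neg_one, Equiv.Perm.mul_apply,
        Equiv.Perm.mul_apply, ih.1]
      have h2 : p (f⁻¹ ((f ^ (-(n : ℤ))) a)) := by
        rw [← h]; simpa using ih.2
      refine ⟨?_, h2⟩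
      rw [Equiv.Perm.inv_eq_iff_eq, restr_of h2]; simp
  constructor
  · rintro ⟨n, hn⟩; exact ⟨n, by rw [← (key n).1, hn]⟩
  · rintro ⟨n, hn⟩; exact ⟨n, by rw [(key n).1, hn]⟩

end restr

section cycleSum

variable {X : Type*} [Fintype X]

open Classical in
/-- The sum of `o` over the cycle of `f` at `a`. -/
noncomputable def cycleSum (f : Equiv.Perm X) (o : X → ZMod 2) (a : X) : ZMod 2 :=
  ∑ b ∈ Finset.univ.filter (fun b => f.SameCycle a b), o b

theorem cycleSum_congr {f : Equiv.Perm X} {o o' : X → ZMod 2} {a : X}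
    (h : ∀ b, f.SameCycle a b → o b = o' b) : cycleSum f o a = cycleSum f o' a := by
  classical
  exact Finset.sum_congr rfl fun b hb => h b (by simpa using hb)

theorem cycleSum_add (f : Equiv.Perm X) (o o' : X → ZMod 2) (a : X) :
    cycleSum f (fun b => o b + o' b) a = cycleSum f o a + cycleSum f o' a :=
  Finset.sum_add_distrib

theorem cycleSum_eq_of_sameCycle_iff {f g : Equiv.Perm X} {o : X → ZMod 2} {a : X}
    (h : ∀ b, f.SameCycle a b ↔ g.SameCycle a b) : cycleSum f o a = cycleSum g o a := by
  classical
  unfold cycleSum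
  congr 1
  ext b
  simp [h]

theorem cycleSum_eq_single {f : Equiv.Perm X} {o : X → ZMod 2} {a : X} (r : X)
    (hr : f.SameCycle a r) (h : ∀ b, f.SameCycle a b → b ≠ r → o b = 0) :
    cycleSum f o a = o r := by
  classical
  refine Finset.sum_eq_single r (fun b hb => h b (by simpa using hb)) ?_
  intro h; exact absurd (by simpa using hr) h

theorem apply_eq_of_sameCycle {β : Type*} {f : Equiv.Perm X} {s : X → β} (hs : ∀ a, s (f a) = s a)
    {a b : X} (h : f.SameCycle a b) : s b = s a := by
  obtain ⟨n, rfl⟩ := h.exists_nat_pow_eq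
  induction n with
  | zero => rfl
  | succ n ih =>
    rw [pow_succ', Equiv.Perm.mul_apply, hs]
    exact ih (Equiv.Perm.sameCycle_pow_right.2 (Equiv.Perm.SameCycle.refl _ _))

theorem cycleSum_mul_left {f : Equiv.Perm X} {s o : X → ZMod 2} (hs : ∀ a, s (f a) = s a) (a : X) :
    cycleSum f (fun b => s b * o b) a = s a * cycleSum f o a := by
  classical
  rw [cycleSum, cycleSum, Finset.mul_sum]
  refine Finset.sum_congr rfl fun b hb => ?_
  rw [apply_eq_of_sameCycle hs (by simpa using hb)]

variable [DecidableEq X]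

/-- If `o` sums to one over every cycle, then the number of cycles has the parity of the total
sum of `o`, which determines the sign. -/
theorem sign_eq_zsign_sum (f : Equiv.Perm X) (o : X → ZMod 2) (h : ∀ a, cycleSum f o a = 1) :
    Equiv.Perm.sign f = zsign (∑ a, (o a + 1)) := by
  have hfix : ∀ a, f a = a → o a = 1 := by
    intro a ha
    rw [← h a, cycleSum_eq_single a (Equiv.Perm.SameCycle.refl _ _)]
    intro b hb hne
    exact absurd (hb.eq_of_left ha).symm hne
  have hsupp : f.support = f.cycleFactorsFinset.biUnion Equiv.Perm.support := by
    ext a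
    simp only [Finset.mem_biUnion]
    constructor
    · intro ha
      exact ⟨f.cycleOf a, Equiv.Perm.cycleOf_mem_cycleFactorsFinset_iff.2 ha,
        Equiv.Perm.mem_support_cycleOf_iff.2 ⟨Equiv.Perm.SameCycle.refl _ _, ha⟩⟩
    · rintro ⟨c, hc, hac⟩
      exact Equiv.Perm.mem_cycleFactorsFinset_support_le hc hac
  have hsum : ∑ a, (o a + 1) = ∑ a ∈ f.support, (o a + 1) := by
    symm
    refine Finset.sum_subset (Finset.subset_univ _) fun a _ ha => ?_
    rw [hfix a (by simpa using ha)]; rfl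
  -- A cycle of length `n` has sign `-(-1) ^ n`, and `o + 1` sums to `1 + n` over it.
  rw [hsum, hsupp, Finset.sum_biUnion, zsign_sum, Equiv.Perm.sign_of_cycleType',
    Equiv.Perm.cycleType_def, Multiset.map_map]
  · refine Finset.prod_congr rfl fun c hc => ?_
    obtain ⟨a, ha⟩ : c.support.Nonempty := by
      rw [Finset.nonempty_iff_ne_empty, Ne, Equiv.Perm.support_eq_empty_iff]
      exact (Equiv.Perm.mem_cycleFactorsFinset_iff.1 hc).1.ne_one
    have hca := Equiv.Perm.cycle_is_cycleOf ha hc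
    have haf : a ∈ f.support := Equiv.Perm.mem_cycleFactorsFinset_support_le hc ha
    have : ∑ b ∈ c.support, o b = 1 := by
      rw [← h a, cycleSum]
      refine Finset.sum_congr ?_ fun _ _ => rfl
      ext b
      simp only [Finset.mem_filter, Finset.mem_univ, true_and]
      rw [hca, Equiv.Perm.mem_support_cycleOf_iff]
      exact ⟨fun h => h.1, fun h => ⟨h, haf⟩⟩
    rw [Finset.sum_add_distrib, this, Finset.sum_const, nsmul_eq_mul, mul_one, zsign_add,
      zsign_natCast]
    simp
  · intro c hc d hd hcd
    exact (Equiv.Perm.cycleFactorsFinset_pairwise_disjoint f hc hd hcd).disjoint_support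

/-- The sign of the restriction of `f` to the invariant set where `s = 1`. -/
theorem sign_restr (f : Equiv.Perm X) (s o : X → ZMod 2) (hs : ∀ a, s (f a) = 1 ↔ s a = 1)
    (h : ∀ a, s a = 1 → cycleSum f o a = 1) :
    Equiv.Perm.sign (restr f (fun a => s a = 1) hs) = zsign (∑ a, s a * (o a + 1)) := by
  have hs' : ∀ a, s (f a) = s a := by
    intro a
    have := hs a
    revert this
    generalize s (f a) = x, s a = y
    revert x y; decide
  rw [sign_eq_zsign_sum _ (fun a => s a * (o a + 1) + 1)]
  · congr 1
    refine Finset.sum_congr rfl fun a _ => ?_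
    rw [add_assoc, ZMod.two_add_self, add_zero]
  · intro a
    rcases ZMod.two_eq_zero_or_one (s a) with h0 | h1
    · rw [cycleSum_eq_single a (Equiv.Perm.SameCycle.refl _ _), h0]; · simp
      intro b hb hne
      refine absurd (hb.eq_of_left ?_).symm hne
      exact restr_of_not (by simp [h0])
    · refine ((cycleSum_eq_of_sameCycle_iff fun b =>
        restr_sameCycle (p := fun a => s a = 1) h1).trans ?_).trans (h a h1)
      refine cycleSum_congr fun b hb => ?_
      rw [apply_eq_of_sameCycle hs' hb, h1, one_mul, add_assoc, ZMod.two_add_self, add_zero]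

/-- The sign of an involution, with a two-colouring of its 2-cycles. -/
theorem sign_involution (f : Equiv.Perm X) (hff : ∀ a, f (f a) = a) (u c : X → ZMod 2)
    (hu : ∀ a, f a ≠ a ↔ u a = 1) (hc : ∀ a, u a = 1 → c (f a) = c a + 1) :
    Equiv.Perm.sign f = zsign (∑ a, u a * c a) := by
  have huf : ∀ a, u (f a) = u a := by
    intro a
    have : u (f a) = 1 ↔ u a = 1 := by
      rw [← hu, ← hu, hff]; exact ne_comm
    revert this
    generalize u (f a) = x, u a = y
    revert x y; decide
  have hcyc : ∀ a b, f.SameCycle a b → b = a ∨ b = f a := by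
    intro a b hab
    obtain ⟨n, rfl⟩ := hab.exists_nat_pow_eq
    clear hab
    induction n with
    | zero => left; rfl
    | succ n ih =>
      rw [pow_succ', Equiv.Perm.mul_apply]
      rcases ih with h | h <;> rw [h]
      · right; rfl
      · left; exact hff a
  have hfa : ∀ a, f.SameCycle a (f a) := fun a => ⟨1, by simp⟩
  rw [sign_eq_zsign_sum f (fun a => u a * c a + 1)]
  · congr 1
    refine Finset.sum_congr rfl fun a _ => ?_
    rw [add_assoc, ZMod.two_add_self, add_zero]
  · intro a
    rcases ZMod.two_eq_zero_or_one (u a) with h0 | h1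
    · have hfix : f a = a := by by_contra h; rw [(hu a).1 h] at h0; exact one_ne_zero h0
      rw [cycleSum_eq_single a (Equiv.Perm.SameCycle.refl _ _), h0]; · simp
      intro b hb hne
      exact absurd (hb.eq_of_left hfix).symm hne
    · rcases ZMod.two_eq_zero_or_one (c a) with hc0 | hc1
      · rw [cycleSum_eq_single a (Equiv.Perm.SameCycle.refl _ _), h1, hc0]; · simp
        intro b hb hne
        rcases hcyc a b hb with rfl | rfl
        · exact absurd rfl hne
        · rw [huf, h1, hc a h1, hc0]; decide
      · rw [cycleSum_eq_single (f a) (hfa a), huf, h1, hc a h1, hc1]; · decide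
        intro b hb hne
        rcases hcyc a b hb with rfl | rfl
        · rw [h1, hc1]; decide
        · exact absurd rfl hne

/-- The sign of a permutation that exchanges the two colours on the set where `u = 1`. -/
theorem sign_restr_swap (f : Equiv.Perm X) (u c : X → ZMod 2) (hu : ∀ a, u (f a) = 1 ↔ u a = 1)
    (hc : ∀ a, u a = 1 → c (f a) = c a + 1)
    (h2 : ∀ a, (u ((f * f) a) = 1 ∧ c ((f * f) a) = 1) ↔ (u a = 1 ∧ c a = 1)) :
    Equiv.Perm.sign (restr f (fun a => u a = 1) hu)
      = zsign (∑ a, u a * c a)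
        * Equiv.Perm.sign (restr (f * f) (fun a => u a = 1 ∧ c a = 1) h2) := by
  classical
  have hu' : ∀ a, u (f.symm a) = 1 ↔ u a = 1 := fun a => by rw [← hu, Equiv.apply_symm_apply]
  have hc' : ∀ a, u a = 1 → c (f.symm a) = c a + 1 := by
    intro a ha
    have := hc (f.symm a) ((hu' a).2 ha)
    rw [Equiv.apply_symm_apply] at this
    rw [this, add_assoc, ZMod.two_add_self, add_zero]
  have h10 : ¬ ((1 : ZMod 2) = 0) := by decide
  -- The involution pairs every element of colour 0 with its image. On the set `u = 1` it agrees
  -- with `f` on colour 0, and on colour 1 it takes `f (f a)` back to `f a`; so `f` is this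
  -- involution after the square of `f` on colour 1.
  let g : X → X := fun a => if u a = 1 then (if c a = 0 then f a else f.symm a) else a
  have hg : ∀ a, g (g a) = a := by
    intro a
    by_cases h1 : u a = 1
    · rcases ZMod.two_eq_zero_or_one (c a) with h0 | h0
      · have : c (f a) = 1 := by rw [hc a h1, h0, zero_add]
        simp [g, h1, h0, (hu a).2 h1, this]
      · have : c (f.symm a) = 0 := by rw [hc' a h1, h0]; rfl
        simp [g, h1, h0, (hu' a).2 h1, this]
    · simp [g, h1]
  let ι : Equiv.Perm X := ⟨g, g, hg, hg⟩
  have hι : Equiv.Perm.sign ι = zsign (∑ a, u a * c a) := by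
    refine sign_involution ι hg u c ?_ ?_
    · intro a
      by_cases h1 : u a = 1
      · simp only [h1, iff_true]
        rcases ZMod.two_eq_zero_or_one (c a) with h0 | h0
        · change g a ≠ a
          simp only [g, h1, h0, if_true]
          intro h
          have := hc a h1
          rw [h, h0] at this
          exact absurd this (by decide)
        · change g a ≠ a
          simp only [g, h1, h0, if_true, h10, if_false]
          intro h
          have := hc' a h1
          rw [h, h0] at this
          exact absurd this (by decide)
      · simp [ι, g, h1]
    · intro a h1
      change c (g a) = _
      rcases ZMod.two_eq_zero_or_one (c a) with h0 | h0
      · simp only [g, h1, h0, if_true]; rw [hc a h1, h0]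
      · simp only [g, h1, h0, if_true, h10, if_false]; rw [hc' a h1, h0]
  rw [← hι, ← Equiv.Perm.sign_mul]
  congr 1
  ext a
  rw [Equiv.Perm.mul_apply]
  by_cases h1 : u a = 1
  · rw [restr_of (p := fun a => u a = 1) h1]
    rcases ZMod.two_eq_zero_or_one (c a) with h0 | h0
    · rw [restr_of_not (by simp [h0])]
      simp [ι, g, h1, h0]
    · rw [restr_of ⟨h1, h0⟩]
      have : c (f (f a)) = 1 := by
        rw [hc _ ((hu a).2 h1), hc a h1, h0]; decide
      change f a = g (f (f a))
      simp [g, this, (hu _).2 ((hu a).2 h1)]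
  · rw [restr_of_not (p := fun a => u a = 1) h1, restr_of_not (by simp [h1])]
    simp [ι, g, h1]

/-- Replacing some cycles of a permutation by their inverses does not change the sign. -/
theorem sign_mul_restr_inv_sq (f : Equiv.Perm X) (p : X → Prop) (h : ∀ a, p (f⁻¹ a) ↔ p a) :
    Equiv.Perm.sign (f * (restr f⁻¹ p h * restr f⁻¹ p h)) = Equiv.Perm.sign f := by
  rw [Equiv.Perm.sign_mul, Equiv.Perm.sign_mul, Int.units_mul_self, mul_one]

end cycleSum

/-! ### Pairs of fixed-point-free involutions -/

/-- A fixed-point-free involution admits a two-colouring that it flips. -/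
theorem exists_flip_of_involution {Q : Type*} (f : Q → Q) (hf : ∀ q, f (f q) = q)
    (hne : ∀ q, f q ≠ q) : ∃ b : Q → ZMod 2, ∀ q, b (f q) = b q + 1 := by
  classical
  -- The smaller element of every pair, for an arbitrary well-order, gets the colour 1.
  refine ⟨fun q => if WellOrderingRel q (f q) then 1 else 0, fun q => ?_⟩
  rcases trichotomous_of (WellOrderingRel (α := Q)) q (f q) with h | h | h
  · simp only [hf, h, if_true, if_neg (asymm_of WellOrderingRel h)]; rfl
  · exact absurd h.symm (hne q)
  · simp only [hf, h, if_true, if_neg (asymm_of WellOrderingRel h)]; rfl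

section dihedral

variable {X : Type*} (τ τ' : Equiv.Perm X) (h1 : ∀ a, τ (τ a) = a) (h2 : ∀ a, τ' (τ' a) = a)
  (n1 : ∀ a, τ a ≠ a) (n2 : ∀ a, τ' a ≠ a)

include h1 h2 in
theorem zpow_mul_apply_reflection (n : ℤ) (a : X) :
    ((τ * τ') ^ n) (τ a) = τ (((τ * τ') ^ (-n)) a) := by
  have e1 : τ⁻¹ = τ := by ext a; rw [Equiv.Perm.inv_eq_iff_eq, h1]
  have e2 : τ'⁻¹ = τ' := by ext a; rw [Equiv.Perm.inv_eq_iff_eq, h2]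
  have e3 : τ * (τ * τ')⁻¹ * τ⁻¹ = τ * τ' := by
    rw [mul_inv_rev, e1, e2]
    ext a; simp [h1]
  have : (τ * τ') ^ n = τ * (τ * τ') ^ (-n) * τ⁻¹ := by
    rw [zpow_neg, ← inv_zpow, ← conj_zpow, e3]
  rw [this, e1]
  simp [h1]

include h1 h2 n1 n2 in
-- If a rotation took `a` to `τ a`, then half of that rotation would take `a` to a fixed point of
-- `τ` (even exponent) or of `τ'` (odd exponent).
theorem not_sameCycle_reflection (a : X) : ¬ (τ * τ').SameCycle a (τ a) := by
  rintro ⟨n, hn⟩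
  obtain ⟨k, rfl | rfl⟩ := Int.even_or_odd' n
  · refine n1 (((τ * τ') ^ k) a) ?_
    have := zpow_mul_apply_reflection τ τ' h1 h2 (-k) a
    rw [neg_neg] at this
    rw [← this, ← hn, ← Equiv.Perm.mul_apply, ← zpow_add]
    congr 2; ring
  · refine n2 (((τ * τ') ^ k) a) ?_
    have := zpow_mul_apply_reflection τ τ' h1 h2 (-k) a
    rw [neg_neg, ← hn, ← Equiv.Perm.mul_apply, ← zpow_add,
      show -k + (2 * k + 1) = 1 + k by ring, zpow_add, zpow_one, Equiv.Perm.mul_apply,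
      Equiv.Perm.mul_apply] at this
    exact τ.injective this

include h1 h2 n1 n2 in
/-- Two fixed-point-free involutions have a common two-colouring. -/
theorem exists_common_flip :
    ∃ b : X → ZMod 2, (∀ a, b (τ a) = b a + 1) ∧ ∀ a, b (τ' a) = b a + 1 := by
  -- `τ` acts on the cycles of the rotation `τ * τ'` without fixed points, so these cycles can be
  -- two-coloured. Being constant on cycles, the colouring is flipped by `τ'` as well.
  let S := Equiv.Perm.SameCycle.setoid (τ * τ')
  have hcompat : ∀ a b, (τ * τ').SameCycle a b → (τ * τ').SameCycle (τ a) (τ b) := by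
    rintro a b ⟨n, rfl⟩
    exact ⟨-n, by rw [zpow_mul_apply_reflection τ τ' h1 h2, neg_neg]⟩
  let f : Quotient S → Quotient S := Quotient.map τ hcompat
  obtain ⟨b, hb⟩ := exists_flip_of_involution f
    (by rintro ⟨a⟩; exact congrArg (Quotient.mk S) (h1 a))
    (by
      rintro ⟨a⟩ h
      exact not_sameCycle_reflection τ τ' h1 h2 n1 n2 a
        (Equiv.Perm.SameCycle.symm (Quotient.exact (s := S) h)))
  have hτ : ∀ a, b (Quotient.mk S (τ a)) = b (Quotient.mk S a) + 1 := fun a => hb (Quotient.mk S a)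
  refine ⟨fun a => b (Quotient.mk S a), hτ, fun a => ?_⟩
  have : Quotient.mk S (τ (τ' a)) = Quotient.mk S a :=
    Quotient.sound (s := S) (Equiv.Perm.SameCycle.symm ⟨1, by simp⟩)
  have h := hτ (τ' a)
  rw [this] at h
  change b (Quotient.mk S (τ' a)) = b (Quotient.mk S a) + 1
  rw [h, add_assoc, ZMod.two_add_self, add_zero]

include h1 h2 in
-- The rotations have index at most two in the dihedral group, with `τ` representing the other
-- coset.
theorem sameCycle_or_of_mem_closure {g : Equiv.Perm X} (hg : g ∈ Subgroup.closure {τ, τ'}) (a : X) :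
    (τ * τ').SameCycle a (g a) ∨ (τ * τ').SameCycle a (τ (g a)) := by
  have hgen : ∀ r : Equiv.Perm X, (∀ b, r (r b) = b) →
      (∀ b, ((τ * τ').SameCycle a b ∨ (τ * τ').SameCycle a (τ b)) →
        ((τ * τ').SameCycle a (r b) ∨ (τ * τ').SameCycle a (τ (r b)))) →
      ∀ b, ((τ * τ').SameCycle a b ∨ (τ * τ').SameCycle a (τ b)) ↔
        ((τ * τ').SameCycle a (r b) ∨ (τ * τ').SameCycle a (τ (r b))) := by
    intro r hr h b
    refine ⟨h b, fun hb => ?_⟩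
    have := h (r b) hb
    rwa [hr] at this
  have key : ∀ b, ((τ * τ').SameCycle a b ∨ (τ * τ').SameCycle a (τ b)) ↔
      ((τ * τ').SameCycle a (g b) ∨ (τ * τ').SameCycle a (τ (g b))) := by
    induction hg using Subgroup.closure_induction with
    | mem r hr =>
      rcases hr with rfl | hr
      · refine hgen r h1 fun b hb => ?_
        rw [h1]; exact hb.symm
      · rw [Set.mem_singleton_iff] at hr
        subst hr
        refine hgen r h2 fun b hb => ?_
        rcases hb with hb | hb
        · right
          exact Equiv.Perm.sameCycle_apply_right.2 hb
        · left
          rw [← Equiv.Perm.sameCycle_apply_right, Equiv.Perm.mul_apply, h2]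
          exact hb
    | one => intro b; rfl
    | mul r r' _ _ hr hr' => intro b; rw [hr' b, hr]; rfl
    | inv r _ hr => intro b; rw [hr (r⁻¹ b)]; simp
  exact (key a).1 (Or.inl (Equiv.Perm.SameCycle.refl _ _))

variable {Y : Type*} (π : X → Y)
  (hπ : ∀ a b, π a = π b ↔ ∃ g ∈ Subgroup.closure ({τ, τ'} : Set (Equiv.Perm X)), g a = b)
  (b : X → ZMod 2) (hb1 : ∀ a, b (τ a) = b a + 1) (hb2 : ∀ a, b (τ' a) = b a + 1)

include hπ in
theorem proj_apply_left (a : X) : π (τ a) = π a :=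
  ((hπ _ _).2 ⟨τ, Subgroup.subset_closure (by simp), rfl⟩).symm

include hπ in
theorem proj_apply_right (a : X) : π (τ' a) = π a :=
  ((hπ _ _).2 ⟨τ', Subgroup.subset_closure (by simp), rfl⟩).symm

variable [Fintype X]

include h1 h2 hπ hb1 hb2 in
-- Each dihedral orbit splits into two rotation cycles, told apart by the common colouring `b`. This
-- describes the vertices and the faces of the double cover.
theorem sameCycle_mul_iff (a a' : X) :
    (τ * τ').SameCycle a a' ↔ π a = π a' ∧ b a = b a' := by
  have hb : ∀ a, b ((τ * τ') a) = b a := by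
    intro a
    rw [Equiv.Perm.mul_apply, hb1, hb2, add_assoc, ZMod.two_add_self, add_zero]
  constructor
  · intro h
    refine ⟨(apply_eq_of_sameCycle (f := τ * τ') (fun a => ?_) h).symm,
      (apply_eq_of_sameCycle hb h).symm⟩
    rw [Equiv.Perm.mul_apply, proj_apply_left τ τ' π hπ, proj_apply_right τ τ' π hπ]
  · rintro ⟨h, h'⟩
    obtain ⟨g, hg, rfl⟩ := (hπ _ _).1 h
    rcases sameCycle_or_of_mem_closure τ τ' h1 h2 hg a with h3 | h3
    · exact h3
    · have := apply_eq_of_sameCycle hb h3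
      rw [hb1, ← h'] at this
      simp at this

include h1 h2 n1 n2 hπ in
/-- The number of rotation cycles is twice the number of dihedral orbits. -/
theorem card_cycles_mul (hsurj : Function.Surjective π) :
    Nat.card (Quotient (Equiv.Perm.SameCycle.setoid (τ * τ'))) = 2 * Nat.card Y := by
  obtain ⟨b, hb1, hb2⟩ := exists_common_flip τ τ' h1 h2 n1 n2
  have key := sameCycle_mul_iff τ τ' h1 h2 π hπ b hb1 hb2
  let F : Quotient (Equiv.Perm.SameCycle.setoid (τ * τ')) → ZMod 2 × Y :=
    Quotient.lift (fun a => (b a, π a)) fun a a' h => by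
      have := (key a a').1 h
      simp [this.1, this.2]
  have hF : Function.Bijective F := by
    constructor
    · rintro ⟨a⟩ ⟨a'⟩ h
      have h' : (b a, π a) = (b a', π a') := h
      rw [Prod.mk.injEq] at h'
      exact Quotient.sound (s := Equiv.Perm.SameCycle.setoid (τ * τ')) ((key a a').2 ⟨h'.2, h'.1⟩)
    · rintro ⟨i, y⟩
      obtain ⟨a, rfl⟩ := hsurj y
      by_cases h : b a = i
      · exact ⟨Quotient.mk _ a, Prod.ext h rfl⟩
      · refine ⟨Quotient.mk _ (τ a), Prod.ext ?_ (proj_apply_left τ τ' π hπ a)⟩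
        change b (τ a) = i
        rw [hb1]
        exact (ZMod.two_add_one_eq_of_ne (Ne.symm h)).symm
  rw [Nat.card_congr (Equiv.ofBijective F hF), Nat.card_prod, Nat.card_zmod]

end dihedral

/-! ### Homology modulo two of a rotation system on the sphere -/

section sphere

variable {X : Type*} [Fintype X]

theorem sum_eq_zero_of_involution (f : X → X) (hf : ∀ a, f (f a) = a) (hne : ∀ a, f a ≠ a)
    (g : X → ZMod 2) (hg : ∀ a, g (f a) = g a) : ∑ a, g a = 0 := by
  classical
  refine Finset.sum_involution (fun a _ => f a) (fun a _ => ?_) (fun a _ _ => hne a)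
    (fun _ _ => Finset.mem_univ _) (fun a _ => hf a)
  rw [hg, ZMod.two_add_self]

theorem sum_eq_zero_of_cycleSum {f : Equiv.Perm X} {o : X → ZMod 2} (h : ∀ a, cycleSum f o a = 0) :
    ∑ a, o a = 0 := by
  classical
  refine Finset.sum_cancels_of_partition_cancels (Equiv.Perm.SameCycle.setoid f) fun a _ => ?_
  rw [← h a, cycleSum]
  refine Finset.sum_congr ?_ fun _ _ => rfl
  ext b
  simp only [Finset.mem_filter, Finset.mem_univ, true_and]
  exact Equiv.Perm.sameCycle_comm

/-- The functions that are invariant under a permutation. -/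
def invFun (f : Equiv.Perm X) : Submodule (ZMod 2) (X → ZMod 2) where
  carrier := {c | ∀ a, c (f a) = c a}
  add_mem' := by intro c d hc hd a; simp only [Pi.add_apply]; rw [hc, hd]
  zero_mem' := fun _ => rfl
  smul_mem' := by intro r c hc a; simp only [Pi.smul_apply]; rw [hc]

omit [Fintype X] in
theorem mem_invFun {f : Equiv.Perm X} {c : X → ZMod 2} : c ∈ invFun f ↔ ∀ a, c (f a) = c a :=
  Iff.rfl

theorem finrank_invFun (f : Equiv.Perm X) :
    Module.finrank (ZMod 2) (invFun f) = Nat.card (Quotient (Equiv.Perm.SameCycle.setoid f)) := by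
  classical
  let S := Equiv.Perm.SameCycle.setoid f
  have hf : ∀ a, Quotient.mk S (f a) = Quotient.mk S a := fun a =>
    Quotient.sound (s := S) (Equiv.Perm.SameCycle.symm ⟨1, by simp⟩)
  let L : (Quotient S → ZMod 2) →ₗ[ZMod 2] invFun f :=
    { toFun := fun q => ⟨fun a => q (Quotient.mk S a), fun a => congrArg q (hf a)⟩
      map_add' := fun _ _ => rfl
      map_smul' := fun _ _ => rfl }
  have hL : Function.Bijective L := by
    constructor
    · intro q q' h
      ext ⟨a⟩
      exact congrFun (congrArg Subtype.val h) a
    · rintro ⟨c, hc⟩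
      exact ⟨Quotient.lift c fun a b h => (apply_eq_of_sameCycle hc h).symm, rfl⟩
  rw [← (LinearEquiv.ofBijective L hL).finrank_eq, Module.finrank_fintype_fun_eq_card,
    Nat.card_eq_fintype_card]

/-- The standard bilinear form on functions. -/
noncomputable def dotForm (X : Type*) [Fintype X] : LinearMap.BilinForm (ZMod 2) (X → ZMod 2) :=
  dotProductBilin (ZMod 2) (ZMod 2)

theorem dotForm_apply (x y : X → ZMod 2) : dotForm X x y = ∑ a, x a * y a := rfl

theorem dotForm_isRefl : (dotForm X).IsRefl := by
  intro x y h
  rw [dotForm_apply] at h ⊢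
  rw [← h]
  exact Finset.sum_congr rfl fun a _ => mul_comm _ _

theorem dotForm_nondegenerate : (dotForm X).Nondegenerate := by
  classical
  constructor
  · intro x h
    ext a
    simpa [dotForm_apply, Pi.single_apply] using h (Pi.single a 1)
  · intro x h
    ext a
    simpa [dotForm_apply, Pi.single_apply] using h (Pi.single a 1)

/-- The indicators of the cycles of `f` span the invariant functions. Conditions on vertex or face
sums thereby become orthogonality. -/
theorem mem_orthogonal_invFun {f : Equiv.Perm X} {x : X → ZMod 2} :
    x ∈ (dotForm X).orthogonal (invFun f) ↔ ∀ a, cycleSum f x a = 0 := by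
  classical
  rw [LinearMap.BilinForm.mem_orthogonal_iff]
  constructor
  · intro h a
    have := h (fun b => if f.SameCycle a b then 1 else 0) (fun b => by
      simp [Equiv.Perm.sameCycle_apply_right])
    simp only [dotForm_apply, ite_mul, one_mul, zero_mul, ← Finset.sum_filter] at this
    rw [← this, cycleSum]
  · intro h c hc
    rw [dotForm_apply]
    exact sum_eq_zero_of_cycleSum (f := f) fun a => by rw [cycleSum_mul_left hc, h, mul_zero]

variable (σ α : Equiv.Perm X) (hα : ∀ a, α (α a) = a) (hαne : ∀ a, α a ≠ a)

/-- The sum of a function and its translate. -/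
def coboundary (α : Equiv.Perm X) : (X → ZMod 2) →ₗ[ZMod 2] (X → ZMod 2) where
  toFun c a := c a + c (α a)
  map_add' c d := by ext a; simp only [Pi.add_apply]; ring
  map_smul' r c := by ext a; simp only [Pi.smul_apply, smul_eq_mul, RingHom.id_apply]; ring

omit [Fintype X] in
theorem coboundary_apply (c : X → ZMod 2) (a : X) : coboundary α c a = c a + c (α a) := rfl

omit [Fintype X] in
theorem ker_coboundary : LinearMap.ker (coboundary α) = invFun α := by
  ext c
  rw [LinearMap.mem_ker, mem_invFun, funext_iff]
  refine forall_congr' fun a => ?_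
  rw [coboundary_apply, Pi.zero_apply, ZMod.two_add_eq_zero_iff]

include hα hαne in
theorem two_mul_finrank_invFun_involution :
    2 * Module.finrank (ZMod 2) (invFun α) = Fintype.card X
      ∧ (dotForm X).orthogonal (invFun α) = invFun α := by
  have h1 := LinearMap.finrank_range_add_finrank_ker (coboundary α)
  rw [ker_coboundary, Module.finrank_fintype_fun_eq_card] at h1
  have h2 : LinearMap.range (coboundary α) ≤ invFun α := by
    rintro _ ⟨c, rfl⟩ a
    rw [coboundary_apply, coboundary_apply, hα, add_comm]
  have h3 : invFun α ≤ (dotForm X).orthogonal (invFun α) := by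
    intro x hx
    rw [LinearMap.BilinForm.mem_orthogonal_iff]
    intro y hy
    change dotForm X y x = 0
    rw [dotForm_apply]
    refine sum_eq_zero_of_involution α hα hαne _ fun a => ?_
    rw [hx, hy]
  -- The coboundary maps into its own kernel, which bounds the dimension of `invFun α` below by half
  -- of the whole; isotropy bounds it above by half.
  have h4 := Submodule.finrank_mono h2
  have h5 := Submodule.finrank_mono h3
  have h6 := LinearMap.BilinForm.finrank_orthogonal (B := dotForm X) dotForm_nondegenerate
    (invFun α)
  rw [Module.finrank_fintype_fun_eq_card] at h6
  have h7 : 2 * Module.finrank (ZMod 2) (invFun α) = Fintype.card X := by omega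
  refine ⟨h7, (Submodule.eq_of_le_of_finrank_eq h3 ?_).symm⟩
  omega

variable (hconn : ∀ c : X → ZMod 2, (∀ a, c (σ a) = c a) → (∀ a, c (α a) = c a) →
  ∀ a b, c a = c b)

omit [Fintype X] in
include hconn in
theorem finrank_invFun_inf [Nonempty X] :
    Module.finrank (ZMod 2) (invFun σ ⊓ invFun α : Submodule (ZMod 2) (X → ZMod 2)) = 1 := by
  obtain ⟨a₀⟩ := ‹Nonempty X›
  have hone : (1 : X → ZMod 2) ∈ invFun σ ⊓ invFun α := ⟨fun _ => rfl, fun _ => rfl⟩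
  refine (finrank_eq_one_iff_of_nonzero' (⟨1, hone⟩ : ↥(invFun σ ⊓ invFun α)) ?_).2 ?_
  · intro h
    have := congrFun (congrArg Subtype.val h) a₀
    exact one_ne_zero this
  · rintro ⟨c, hc⟩
    refine ⟨c a₀, Subtype.ext (funext fun a => ?_)⟩
    change c a₀ * 1 = c a
    rw [mul_one, hconn c hc.1 hc.2 a₀ a]

variable (hcard : 2 * (Nat.card (Quotient (Equiv.Perm.SameCycle.setoid σ))
  + Nat.card (Quotient (Equiv.Perm.SameCycle.setoid (σ * α)))) = Fintype.card X + 4)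

include hα hαne hconn hcard in
/-- On the sphere every cycle modulo two is a boundary. -/
theorem exists_face_function [Nonempty X] (x : X → ZMod 2) (hx : ∀ a, x (α a) = x a)
    (hsum : ∀ a, cycleSum σ x a = 0) :
    ∃ s : X → ZMod 2, (∀ a, s (σ (α a)) = s a) ∧ ∀ a, x a = s a + s (α a) := by
  have hconn' : ∀ c : X → ZMod 2, (∀ a, c ((σ * α) a) = c a) → (∀ a, c (α a) = c a) →
      ∀ a b, c a = c b := by
    intro c h1 h2
    refine hconn c (fun a => ?_) h2
    have := h1 (α a)
    rwa [Equiv.Perm.mul_apply, hα, h2] at this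
  obtain ⟨hE, hperp⟩ := two_mul_finrank_invFun_involution α hα hαne
  have h0 := finrank_invFun_inf σ α hconn
  have h2 := finrank_invFun_inf (σ * α) α hconn'
  have hsup := Submodule.finrank_sup_add_finrank_inf_eq (invFun σ) (invFun α)
  have horth := LinearMap.BilinForm.finrank_orthogonal (B := dotForm X) dotForm_nondegenerate
    (invFun σ ⊔ invFun α)
  have hdle := Submodule.finrank_le (invFun σ ⊔ invFun α)
  rw [Module.finrank_fintype_fun_eq_card] at horth hdle
  have hrk := LinearMap.finrank_range_add_finrank_ker
    ((coboundary α).domRestrict (invFun (σ * α)))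
  rw [LinearMap.range_domRestrict, LinearMap.ker_domRestrict, ker_coboundary] at hrk
  have hker : Module.finrank (ZMod 2)
      (Submodule.comap (invFun (σ * α)).subtype (invFun α)) = 1 := by
    rw [← h2, ← Submodule.map_comap_subtype]
    exact (Submodule.finrank_map_subtype_eq _ _).symm
  rw [hker] at hrk
  rw [finrank_invFun] at hsup hrk
  have hle : (invFun (σ * α)).map (coboundary α)
      ≤ (dotForm X).orthogonal (invFun σ ⊔ invFun α) := by
    rintro _ ⟨s, hs, rfl⟩
    rw [LinearMap.BilinForm.mem_orthogonal_iff]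
    intro y hy
    obtain ⟨c, hc, e, he, rfl⟩ := Submodule.mem_sup.1 hy
    have hs' : ∀ a, s (α a) = s (σ a) := by
      intro a
      have := hs (α a)
      rw [Equiv.Perm.mul_apply, hα] at this
      exact this.symm
    change dotForm X (c + e) _ = 0
    rw [map_add, LinearMap.add_apply, dotForm_apply, dotForm_apply]
    have e1 : ∑ a, c a * coboundary α s a = 0 := by
      have : ∑ a, c a * s (α a) = ∑ a, c a * s a := by
        rw [← Equiv.sum_comp σ (fun a => c a * s a)]
        exact Finset.sum_congr rfl fun a _ => by rw [hs', hc]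
      simp only [coboundary_apply, mul_add, Finset.sum_add_distrib, this, ZMod.two_add_self]
    have e2 : ∑ a, e a * coboundary α s a = 0 := by
      refine sum_eq_zero_of_involution α hα hαne _ fun a => ?_
      rw [he, coboundary_apply, coboundary_apply, hα, add_comm (s (α a))]
    rw [e1, e2, add_zero]
  have hmem : x ∈ (invFun (σ * α)).map (coboundary α) := by
    -- With `V`, `E`, `F` the numbers of cycles of `σ`, `α`, `σ * α`, the image has dimension `F -
    -- 1` and the orthogonal complement `2E - (V + E - 1)`. They agree since `V - E + F = 2`, which
    -- is `hcard`.
    rw [Submodule.eq_of_le_of_finrank_eq hle (by omega), LinearMap.BilinForm.mem_orthogonal_iff]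
    intro y hy
    obtain ⟨c, hc, e, he, rfl⟩ := Submodule.mem_sup.1 hy
    change dotForm X (c + e) x = 0
    rw [map_add, LinearMap.add_apply]
    have e1 := (LinearMap.BilinForm.mem_orthogonal_iff.1
      (mem_orthogonal_invFun.2 hsum)) c hc
    have e2 : x ∈ (dotForm X).orthogonal (invFun α) := by rw [hperp]; exact hx
    have e3 := (LinearMap.BilinForm.mem_orthogonal_iff.1 e2) e he
    rw [e1, e3, add_zero]
  obtain ⟨s, hs, rfl⟩ := hmem
  exact ⟨s, hs, fun a => rfl⟩

include hα hαne hconn hcard in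
/-- On the sphere every cocycle modulo two is a coboundary. -/
theorem exists_vertex_function [Nonempty X] (x : X → ZMod 2) (hx : ∀ a, x (α a) = x a)
    (hsum : ∀ a, cycleSum (σ * α) x a = 0) :
    ∃ c : X → ZMod 2, (∀ a, c (σ a) = c a) ∧ ∀ a, x a = c a + c (α a) := by
  -- Duality: with `σ * α` as rotation, the faces are the old vertices.
  have hσ : σ * α * α = σ := by ext a; simp [hα]
  obtain ⟨c, hc, hxc⟩ := exists_face_function (σ * α) α hα hαne
    (by
      intro c h1 h2
      refine hconn c (fun a => ?_) h2
      have := h1 (α a)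
      rwa [Equiv.Perm.mul_apply, hα, h2] at this)
    (by rw [hσ, add_comm (Nat.card _)]; exact hcard) x hx hsum
  exact ⟨c, fun a => by simpa [hα] using hc a, hxc⟩

include hα hαne hconn in
/-- Prescribed face sums of total zero are attained by a function of the edges. -/
theorem exists_edge_function (t : X → ZMod 2) (ht : ∑ a, t a = 0) :
    ∃ e : X → ZMod 2, (∀ a, e (α a) = e a) ∧
      ∀ a, cycleSum (σ * α) e a = cycleSum (σ * α) t a := by
  obtain ⟨-, hperp⟩ := two_mul_finrank_invFun_involution α hα hαne
  -- By double orthogonality it suffices that `t` is orthogonal to every function constant on both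
  -- edges and faces. By connectedness these are the constants.
  have hmem : t ∈ invFun α ⊔ (dotForm X).orthogonal (invFun (σ * α)) := by
    rw [← LinearMap.BilinForm.orthogonal_orthogonal dotForm_nondegenerate dotForm_isRefl
      (invFun α ⊔ _), LinearMap.BilinForm.mem_orthogonal_iff]
    intro y hy
    have h1 : y ∈ invFun α := by
      rw [← hperp]
      exact LinearMap.BilinForm.orthogonal_le le_sup_left hy
    have h2 : y ∈ invFun (σ * α) := by
      rw [← LinearMap.BilinForm.orthogonal_orthogonal dotForm_nondegenerate dotForm_isRefl
        (invFun (σ * α))]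
      exact LinearMap.BilinForm.orthogonal_le le_sup_right hy
    have h3 : ∀ a b, y a = y b := by
      refine hconn y (fun a => ?_) h1
      have := h2 (α a)
      rwa [Equiv.Perm.mul_apply, hα, h1] at this
    change dotForm X y t = 0
    rw [dotForm_apply]
    rcases isEmpty_or_nonempty X with h | ⟨⟨a₀⟩⟩
    · simp
    · rw [Finset.sum_congr rfl fun a _ => by rw [h3 a a₀], ← Finset.mul_sum, ht, mul_zero]
  obtain ⟨e, he, w, hw, rfl⟩ := Submodule.mem_sup.1 hmem
  refine ⟨e, he, fun a => ?_⟩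
  have := cycleSum_add (σ * α) e w a
  rw [mem_orthogonal_invFun.1 hw, add_zero] at this
  exact this.symm

end sphere

/-! ### Counting cells -/

section count

variable {X Y : Type*}

theorem card_eq_two_mul_of_involution (f : X → X) (hf : ∀ a, f (f a) = a) (hne : ∀ a, f a ≠ a)
    (π : X → Y) (hπ : ∀ a b, π a = π b ↔ b = a ∨ b = f a) (hsurj : Function.Surjective π) :
    Nat.card X = 2 * Nat.card Y := by
  obtain ⟨b, hb⟩ := exists_flip_of_involution f hf hne
  have hF : Function.Bijective (fun a => (b a, π a) : X → ZMod 2 × Y) := by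
    constructor
    · intro a a' h
      rw [Prod.mk.injEq] at h
      rcases (hπ a a').1 h.2 with h' | h'
      · exact h'.symm
      · rw [h', hb] at h
        simp at h
    · rintro ⟨i, y⟩
      obtain ⟨a, rfl⟩ := hsurj y
      by_cases h : b a = i
      · exact ⟨a, Prod.ext h rfl⟩
      · refine ⟨f a, Prod.ext ?_ ((hπ _ _).2 (Or.inr rfl)).symm⟩
        change b (f a) = i
        rw [hb]
        exact (ZMod.two_add_one_eq_of_ne (Ne.symm h)).symm
  rw [Nat.card_congr (Equiv.ofBijective _ hF), Nat.card_prod, Nat.card_zmod]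

/-- A function that picks one flag of the colour `1` from every dihedral orbit. -/
theorem exists_transversal [Fintype X] (τ τ' : Equiv.Perm X) (h1 : ∀ a, τ (τ a) = a)
    (h2 : ∀ a, τ' (τ' a) = a) (π : X → Y)
    (hπ : ∀ a b, π a = π b ↔ ∃ g ∈ Subgroup.closure ({τ, τ'} : Set (Equiv.Perm X)), g a = b)
    (hsurj : Function.Surjective π)
    (b : X → ZMod 2) (hb1 : ∀ a, b (τ a) = b a + 1) (hb2 : ∀ a, b (τ' a) = b a + 1) :
    ∃ o : X → ZMod 2, (∀ a, b a = 1 → cycleSum (τ * τ') o a = 1) ∧ (∀ a, b a * o a = o a) ∧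
      ∑ a, o a = (Nat.card Y : ZMod 2) := by
  classical
  have hr : ∀ y, ∃ a, π a = y ∧ b a = 1 := by
    intro y
    obtain ⟨a, rfl⟩ := hsurj y
    rcases ZMod.two_eq_zero_or_one (b a) with h | h
    · exact ⟨τ a, proj_apply_left τ τ' π hπ a, by rw [hb1, h, zero_add]⟩
    · exact ⟨a, rfl, h⟩
  choose r hr1 hr2 using hr
  have hrinj : Function.Injective r := fun y y' h => by rw [← hr1 y, h, hr1]
  have : Finite Y := Finite.of_injective r hrinj
  have := Fintype.ofFinite Y
  refine ⟨fun a => if r (π a) = a then 1 else 0, fun a ha => ?_, fun a => ?_, ?_⟩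
  · rw [cycleSum_eq_single (r (π a))]
    · simp [hr1]
    · rw [sameCycle_mul_iff τ τ' h1 h2 π hπ b hb1 hb2]
      exact ⟨(hr1 _).symm, by rw [ha, hr2]⟩
    · intro a' h hne
      rw [sameCycle_mul_iff τ τ' h1 h2 π hπ b hb1 hb2] at h
      rw [if_neg]
      rw [← h.1]
      exact hne.symm
  · by_cases h : r (π a) = a
    · have := hr2 (π a)
      rw [h] at this
      simp [h, this]
    · simp [h]
  · rw [← Finset.sum_filter, Finset.sum_const, nsmul_eq_mul, mul_one, Nat.card_eq_fintype_card,
      ← Finset.card_univ, ← Finset.card_image_of_injective Finset.univ hrinj]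
    congr 2
    ext a
    simp only [Finset.mem_filter, Finset.mem_univ, true_and, Finset.mem_image]
    constructor
    · intro h; exact ⟨_, h⟩
    · rintro ⟨y, rfl⟩; rw [hr1]

theorem orbitRel_mk_eq_iff (G : Subgroup (Equiv.Perm X)) (a b : X) :
    (Quotient.mk'' a : MulAction.orbitRel.Quotient G X) = Quotient.mk'' b ↔
      ∃ g ∈ G, g a = b := by
  rw [Quotient.eq'', MulAction.orbitRel_apply, MulAction.mem_orbit_iff]
  constructor
  · rintro ⟨g, hg⟩
    refine ⟨(g : Equiv.Perm X)⁻¹, G.inv_mem g.2, ?_⟩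
    rw [Equiv.Perm.inv_eq_iff_eq]
    exact hg.symm
  · rintro ⟨g, hg, rfl⟩
    refine ⟨⟨g⁻¹, G.inv_mem hg⟩, ?_⟩
    change g⁻¹ (g a) = a
    simp

end count

theorem Multigraph.card_dart {V D : Type*} (Z : Multigraph V D) :
    Nat.card D = 2 * Nat.card Z.Edge := by
  change Nat.card D = 2 * Nat.card (MulAction.orbitRel.Quotient (Subgroup.zpowers Z.rev) D)
  refine card_eq_two_mul_of_involution Z.rev Z.rev_rev Z.rev_ne Quotient.mk'' ?_
    Quotient.mk''_surjective
  intro a b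
  rw [orbitRel_mk_eq_iff]
  constructor
  · rintro ⟨g, ⟨n, rfl⟩, rfl⟩
    have hsq : Z.rev ^ (2 : ℤ) = 1 := by
      ext d
      simp [zpow_ofNat, pow_two, Z.rev_rev]
    obtain ⟨k, rfl | rfl⟩ := Int.even_or_odd' n
    · left; simp [zpow_mul, hsq]
    · right; simp [zpow_add, zpow_mul, hsq]
  · rintro (rfl | rfl)
    · exact ⟨1, Subgroup.one_mem _, rfl⟩
    · exact ⟨Z.rev, Subgroup.mem_zpowers _, rfl⟩

/-! ### The orientation double cover of the projective plane. -/

namespace CellEmbedding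

variable {V D Φ : Type*} {Z : Multigraph V D} (M : CellEmbedding Z Φ)

theorem dart_τ₂ (φ : Φ) : M.dart (M.τ₂ φ) = M.dart φ :=
  ((M.dart_eq_iff _ _).2 (Or.inr rfl)).symm

include M in
theorem card_flag : Nat.card Φ = 2 * Nat.card D :=
  card_eq_two_mul_of_involution M.τ₂ M.τ₂_τ₂ M.τ₂_ne M.dart M.dart_eq_iff M.dart_surjective

include M in
theorem finite_flag [Finite D] : Finite Φ := by
  obtain ⟨b, hb⟩ := exists_flip_of_involution M.τ₂ M.τ₂_τ₂ M.τ₂_ne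
  refine Finite.of_injective (fun φ => (b φ, M.dart φ) : Φ → ZMod 2 × D) fun φ ψ h => ?_
  rw [Prod.mk.injEq] at h
  rcases (M.dart_eq_iff φ ψ).1 h.2 with h' | h'
  · exact h'.symm
  · rw [h', hb] at h
    simp at h

/-- The rotation around the vertices of the orientation double cover, whose darts are the flags. -/
def rot : Equiv.Perm Φ := M.τ₁ * M.τ₂

/-- The reversal of the darts of the orientation double cover. -/
def flip : Equiv.Perm Φ := M.τ₀ * M.τ₂

theorem flip_apply (φ : Φ) : M.flip φ = M.τ₀ (M.τ₂ φ) := rfl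

theorem rot_apply (φ : Φ) : M.rot φ = M.τ₁ (M.τ₂ φ) := rfl

theorem next_apply (φ : Φ) : M.next φ = M.τ₁ (M.τ₀ φ) := rfl

theorem rot_mul_flip : M.rot * M.flip = M.next := by
  ext φ
  rw [Equiv.Perm.mul_apply, flip_apply, rot_apply, next_apply, ← M.τ₀_τ₂, M.τ₂_τ₂]

theorem rot_flip (φ : Φ) : M.rot (M.flip φ) = M.next φ := by
  rw [← M.rot_mul_flip, Equiv.Perm.mul_apply]

theorem flip_flip (φ : Φ) : M.flip (M.flip φ) = φ := by
  rw [flip_apply, flip_apply, ← M.τ₀_τ₂, M.τ₂_τ₂, M.τ₀_τ₀]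

theorem dart_flip (φ : Φ) : M.dart (M.flip φ) = Z.rev (M.dart φ) := by
  rw [flip_apply, M.dart_τ₀, dart_τ₂]

theorem flip_ne (φ : Φ) : M.flip φ ≠ φ := fun h => by
  have := M.dart_flip φ
  rw [h] at this
  exact Z.rev_ne _ this.symm

/-- The vertex of a flag. -/
def vert (φ : Φ) : V := Z.src (M.dart φ)

theorem vert_surjective : Function.Surjective M.vert :=
  M.src_surjective.comp M.dart_surjective

theorem vert_eq_iff (φ ψ : Φ) : M.vert φ = M.vert ψ ↔
    ∃ g ∈ Subgroup.closure ({M.τ₁, M.τ₂} : Set (Equiv.Perm Φ)), g φ = ψ := M.src_eq_iff φ ψ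

/-- The face of a flag. -/
def face (φ : Φ) : M.Face := Quotient.mk'' φ

theorem face_surjective : Function.Surjective M.face := Quotient.mk''_surjective

theorem face_eq_iff (φ ψ : Φ) : M.face φ = M.face ψ ↔
    ∃ g ∈ Subgroup.closure ({M.τ₁, M.τ₀} : Set (Equiv.Perm Φ)), g φ = ψ := by
  rw [Set.pair_comm]
  exact orbitRel_mk_eq_iff _ _ _

/-- The edge of a flag. -/
def edge (φ : Φ) :
    MulAction.orbitRel.Quotient (Subgroup.closure ({M.τ₀, M.τ₂} : Set (Equiv.Perm Φ))) Φ :=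
  Quotient.mk'' φ

theorem eq_of_forall_eq {β : Type*} (htrans : MulAction.IsPretransitive
      (Subgroup.closure ({M.τ₀, M.τ₁, M.τ₂} : Set (Equiv.Perm Φ))) Φ) (f : Φ → β)
    (h0 : ∀ φ, f (M.τ₀ φ) = f φ) (h1 : ∀ φ, f (M.τ₁ φ) = f φ) (h2 : ∀ φ, f (M.τ₂ φ) = f φ)
    (φ ψ : Φ) : f φ = f ψ := by
  obtain ⟨⟨g, hg⟩, rfl⟩ := htrans.exists_smul_eq φ ψ
  change f φ = f (g φ)
  have key : ∀ φ, f (g φ) = f φ := by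
    induction hg using Subgroup.closure_induction with
    | mem r hr =>
      simp only [Set.mem_insert_iff, Set.mem_singleton_iff] at hr
      rcases hr with rfl | rfl | rfl
      · exact h0
      · exact h1
      · exact h2
    | one => intro φ; rfl
    | mul r r' _ _ hr hr' => intro φ; rw [Equiv.Perm.mul_apply, hr, hr']
    | inv r _ hr => intro φ; rw [← hr (r⁻¹ φ)]; simp
  exact (key φ).symm

variable [Fintype Φ]

omit [Fintype Φ] in
theorem card_vert_add_card_face (hχ : M.eulerChar = 1) :
    Nat.card V + Nat.card M.Face = Nat.card Z.Edge + 1 := by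
  unfold eulerChar at hχ
  omega

/-- Both numbers are a quarter of the number of flags. `not_orientable` needs edges as orbits of
flags. -/
theorem card_edge :
    Nat.card (MulAction.orbitRel.Quotient
      (Subgroup.closure ({M.τ₀, M.τ₂} : Set (Equiv.Perm Φ))) Φ) = Nat.card Z.Edge := by
  have h1 := card_cycles_mul M.τ₀ M.τ₂ M.τ₀_τ₀ M.τ₂_τ₂ M.τ₀_ne M.τ₂_ne M.edge
    (orbitRel_mk_eq_iff _) Quotient.mk''_surjective
  have h2 := (two_mul_finrank_invFun_involution M.flip M.flip_flip M.flip_ne).1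
  rw [finrank_invFun, flip, h1, ← Nat.card_eq_fintype_card, M.card_flag, Z.card_dart] at h2
  omega

/-- The cover has twice as many vertices, edges and faces, so its Euler characteristic is 2. This is
the hypothesis `hcard` of the results on the sphere. -/
theorem card_cycles (hχ : M.eulerChar = 1) :
    2 * (Nat.card (Quotient (Equiv.Perm.SameCycle.setoid M.rot))
      + Nat.card (Quotient (Equiv.Perm.SameCycle.setoid (M.rot * M.flip))))
        = Fintype.card Φ + 4 := by
  have h1 := card_cycles_mul M.τ₁ M.τ₂ M.τ₁_τ₁ M.τ₂_τ₂ M.τ₁_ne M.τ₂_ne M.vert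
    M.vert_eq_iff M.vert_surjective
  have h2 := card_cycles_mul M.τ₁ M.τ₀ M.τ₁_τ₁ M.τ₀_τ₀ M.τ₁_ne M.τ₀_ne M.face
    M.face_eq_iff M.face_surjective
  have h3 := M.card_vert_add_card_face hχ
  have h4 := M.card_flag
  have h5 := Z.card_dart
  rw [Nat.card_eq_fintype_card] at h4
  rw [rot_mul_flip, rot, next, h1, h2]
  omega

/-- A surface with an orientation has even Euler characteristic. -/
theorem not_orientable (hχ : M.eulerChar = 1) (b : Φ → ZMod 2) (h0 : ∀ φ, b (M.τ₀ φ) = b φ + 1)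
    (h1 : ∀ φ, b (M.τ₁ φ) = b φ + 1) (h2 : ∀ φ, b (M.τ₂ φ) = b φ + 1) : False := by
  classical
  obtain ⟨o₁, ho₁, hs₁, ht₁⟩ := exists_transversal M.τ₁ M.τ₂ M.τ₁_τ₁ M.τ₂_τ₂ M.vert
    M.vert_eq_iff M.vert_surjective b h1 h2
  obtain ⟨o₂, ho₂, hs₂, ht₂⟩ := exists_transversal M.τ₁ M.τ₀ M.τ₁_τ₁ M.τ₀_τ₀ M.face
    M.face_eq_iff M.face_surjective b h1 h0
  obtain ⟨o₃, ho₃, hs₃, ht₃⟩ := exists_transversal M.τ₀ M.τ₂ M.τ₀_τ₀ M.τ₂_τ₂ M.edge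
    (orbitRel_mk_eq_iff _) Quotient.mk''_surjective b h0 h2
  have hinv : ∀ φ : Φ, b φ + 1 + 1 = b φ := fun φ => by
    rw [add_assoc, ZMod.two_add_self, add_zero]
  have e1 : ∀ φ, b (M.rot φ) = b φ := fun φ => by rw [rot_apply, h1, h2, hinv]
  have e2 : ∀ φ, b (M.next φ) = b φ := fun φ => by rw [next_apply, h1, h0, hinv]
  have e3 : ∀ φ, b (M.flip φ) = b φ := fun φ => by rw [flip_apply, h0, h2, hinv]
  have hs : ∑ φ, b φ = 0 := sum_eq_zero_of_involution M.flip M.flip_flip M.flip_ne b e3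
  have s1 := sign_restr M.rot b o₁ (fun a => by rw [e1]) ho₁
  have s2 := sign_restr M.next b o₂ (fun a => by rw [e2]) ho₂
  have s3 := sign_restr M.flip b o₃ (fun a => by rw [e3]) ho₃
  -- The flags with `b = 1` are the darts of the oriented surface, even in number. The signs of
  -- `rot`, `flip` and `next` on them are therefore the parities of the numbers of vertices, edges
  -- and faces, and multiplicativity gives `V + E ≡ F`, against `V + F = E + 1`.
  have hmul : restr M.rot (fun a => b a = 1) (fun a => by rw [e1])
      * restr M.flip (fun a => b a = 1) (fun a => by rw [e3])
      = restr M.next (fun a => b a = 1) (fun a => by rw [e2]) := by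
    ext φ
    rw [Equiv.Perm.mul_apply]
    by_cases h : b φ = 1
    · rw [restr_of (p := fun a => b a = 1) h, restr_of (p := fun a => b a = 1) h, restr_of
        (p := fun a => b a = 1) (by rw [e3]; exact h), rot_flip]
    · rw [restr_of_not (p := fun a => b a = 1) h, restr_of_not (p := fun a => b a = 1) h,
        restr_of_not (p := fun a => b a = 1) h]
  have hsgn := congrArg Equiv.Perm.sign hmul
  rw [Equiv.Perm.sign_mul, s1, s2, s3, ← zsign_add] at hsgn
  have hsum := zsign_injective hsgn
  simp only [mul_add, mul_one, Finset.sum_add_distrib, hs₁, hs₂, hs₃, hs, add_zero, ht₁, ht₂,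
    ht₃, M.card_edge] at hsum
  have hχ' := congrArg (Nat.cast : ℕ → ZMod 2) (M.card_vert_add_card_face hχ)
  push_cast at hχ'
  rw [← hsum] at hχ'
  generalize (Nat.card V : ZMod 2) = x, (Nat.card Z.Edge : ZMod 2) = y at hχ'
  revert x y; decide

/-- The orientation double cover of the projective plane is connected. -/
theorem cover_connected (hproj : M.IsProjectivePlane) (c : Φ → ZMod 2)
    (hσ : ∀ φ, c (M.rot φ) = c φ) (hα : ∀ φ, c (M.flip φ) = c φ) (φ ψ : Φ) : c φ = c ψ := by
  have t1 : ∀ φ, c (M.τ₁ φ) = c (M.τ₂ φ) := fun φ => by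
    rw [← hσ (M.τ₂ φ), rot_apply, M.τ₂_τ₂]
  have t0 : ∀ φ, c (M.τ₀ φ) = c (M.τ₂ φ) := fun φ => by
    rw [← hα (M.τ₂ φ), flip_apply, M.τ₂_τ₂]
  -- The sum of `c` and its deck translate is constant. If it is 0, then `c` lives on the connected
  -- surface itself; if it is 1, then `c` orients the surface.
  have hconst := M.eq_of_forall_eq hproj.1 (fun φ => c φ + c (M.τ₂ φ))
    (fun φ => by rw [t0, ← M.τ₀_τ₂, t0, M.τ₂_τ₂, add_comm])
    (fun φ => by
      have : c (M.τ₂ (M.τ₁ φ)) = c φ := by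
        rw [← hσ (M.τ₂ (M.τ₁ φ)), rot_apply, M.τ₂_τ₂, M.τ₁_τ₁]
      rw [t1, this, add_comm])
    (fun φ => by rw [M.τ₂_τ₂, add_comm])
  rcases ZMod.two_eq_zero_or_one (c φ + c (M.τ₂ φ)) with h | h
  · have t2 : ∀ ψ, c (M.τ₂ ψ) = c ψ := fun ψ =>
      ZMod.two_add_eq_zero_iff.1 ((hconst ψ φ).trans h)
    exact M.eq_of_forall_eq hproj.1 c (fun φ => by rw [t0, t2]) (fun φ => by rw [t1, t2]) t2 φ ψ
  · have t2 : ∀ ψ, c (M.τ₂ ψ) = c ψ + 1 := fun ψ => by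
      rw [← (hconst ψ φ).trans h, ← add_assoc, ZMod.two_add_self, zero_add]
    exact (M.not_orientable hproj.2 c (fun φ => by rw [t0, t2]) (fun φ => by rw [t1, t2])
      t2).elim

/-- The bipartite colouring of the orientation double cover: on a locally but not globally
bipartite projective graph it is exchanged by the deck transformation. -/
theorem exists_cover_colouring [Nonempty Φ] (hproj : M.IsProjectivePlane)
    (hloc : M.LocallyBipartite) (hglob : ¬ Z.IsBipartite) :
    ∃ c : Φ → ZMod 2, (∀ φ, c (M.τ₀ φ) = c φ) ∧ (∀ φ, c (M.τ₁ φ) = c φ + 1) ∧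
      ∀ φ, c (M.τ₂ φ) = c φ + 1 := by
  classical
  obtain ⟨c, hσ, hα⟩ := exists_vertex_function M.rot M.flip M.flip_flip M.flip_ne
    (M.cover_connected hproj) (M.card_cycles hproj.2) (fun _ => 1) (fun _ => rfl) (fun φ => by
      have := hloc φ
      rw [rot_mul_flip, cycleSum, Finset.sum_const, nsmul_eq_mul, mul_one,
        ZMod.natCast_eq_zero_iff_even]
      rw [sides, Set.ncard_eq_toFinset_card'] at this
      convert this using 2
      ext; simp)
  have t1 : ∀ φ, c (M.τ₁ φ) = c (M.τ₂ φ) := fun φ => by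
    rw [← hσ (M.τ₂ φ), rot_apply, M.τ₂_τ₂]
  have hα' : ∀ φ, c (M.flip φ) = c φ + 1 := fun φ => by
    rw [hα φ, ← add_assoc, ZMod.two_add_self, zero_add]
  have t0 : ∀ φ, c (M.τ₀ φ) = c (M.τ₂ φ) + 1 := fun φ => by
    rw [← hα' (M.τ₂ φ), flip_apply, M.τ₂_τ₂]
  have hconst := M.eq_of_forall_eq hproj.1 (fun φ => c φ + c (M.τ₂ φ))
    (fun φ => by
      rw [t0, ← M.τ₀_τ₂, t0, M.τ₂_τ₂]
      generalize c φ = x, c (M.τ₂ φ) = y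
      revert x y; decide)
    (fun φ => by
      have : c (M.τ₂ (M.τ₁ φ)) = c φ := by
        rw [← hσ (M.τ₂ (M.τ₁ φ)), rot_apply, M.τ₂_τ₂, M.τ₁_τ₁]
      rw [t1, this, add_comm])
    (fun φ => by rw [M.τ₂_τ₂, add_comm])
  obtain ⟨φ₀⟩ := ‹Nonempty Φ›
  rcases ZMod.two_eq_zero_or_one (c φ₀ + c (M.τ₂ φ₀)) with h | h
  -- A colouring invariant under the deck transformation descends to `V` and makes `Z` bipartite.
  · exfalso
    have t2 : ∀ ψ, c (M.τ₂ ψ) = c ψ := fun ψ =>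
      ZMod.two_add_eq_zero_iff.1 ((hconst ψ φ₀).trans h)
    have hdesc : ∀ φ ψ, M.vert φ = M.vert ψ → c φ = c ψ := by
      intro φ ψ h
      obtain ⟨g, hg, rfl⟩ := (M.vert_eq_iff _ _).1 h
      rcases sameCycle_or_of_mem_closure M.τ₁ M.τ₂ M.τ₁_τ₁ M.τ₂_τ₂ hg φ with h3 | h3
      · exact (apply_eq_of_sameCycle hσ h3).symm
      · rw [← apply_eq_of_sameCycle hσ h3, t1, t2]
    choose r hr using M.vert_surjective
    refine hglob ⟨fun v => decide (c (r v) = 0), fun d => ?_⟩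
    obtain ⟨φ, rfl⟩ := M.dart_surjective d
    have e1 : c (r (Z.src (M.dart φ))) = c φ := hdesc _ _ (hr _)
    have e2 : c (r (Z.tgt (M.dart φ))) = c φ + 1 := by
      rw [← hα']
      refine hdesc _ _ ((hr _).trans ?_)
      rw [vert, dart_flip]; rfl
    beta_reduce
    rw [e1, e2]
    generalize c φ = x
    revert x; decide
  · have t2 : ∀ ψ, c (M.τ₂ ψ) = c ψ + 1 := fun ψ => by
      rw [← (hconst ψ φ₀).trans h, ← add_assoc, ZMod.two_add_self, zero_add]
    exact ⟨c, fun φ => by rw [t0, t2, add_assoc, ZMod.two_add_self, add_zero],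
      fun φ => by rw [t1, t2], t2⟩

end CellEmbedding

/-! ### The sign of the walk along the boundary of a set of faces -/

section boundary

variable {X : Type*} [Fintype X]

/-- `f` permutes the set `g = 1` and exchanges its two colour classes, which are thus equally large.
-/
theorem sum_eq_zero_of_colour_flip (f : Equiv.Perm X) (g c : X → ZMod 2)
    (hg : ∀ a, g (f a) = g a) (hc : ∀ a, g a = 1 → c (f a) = c a + 1) : ∑ a, g a = 0 := by
  have h1 : ∀ a, g a = g a * c a + g (f a) * c (f a) := by
    intro a
    rcases ZMod.two_eq_zero_or_one (g a) with h | h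
    · rw [hg, h]; simp
    · rw [hg, h, hc a h, one_mul, one_mul, ← add_assoc, ZMod.two_add_self, zero_add]
  rw [Finset.sum_congr rfl fun a _ => h1 a, Finset.sum_add_distrib,
    Equiv.sum_comp f (fun a => g a * c a), ZMod.two_add_self]

variable {σ α δ : Equiv.Perm X} {x s : X → ZMod 2}

omit [Fintype X] in
theorem face_function_rot (hα : ∀ a, α (α a) = a) (hs : ∀ a, s (σ (α a)) = s a)
    (hx : ∀ a, x a = s a + s (α a)) (a : X) : s (σ a) = s a + x a := by
  have := hs (α a)
  rw [hα] at this
  rw [this, hx, ← add_assoc, ZMod.two_add_self, zero_add]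

/-- If exactly two edges at a vertex belong to the boundary of a set of faces, then this set lies
on different sides of them. -/
theorem face_function_partner (hsσ : ∀ a, s (σ a) = s a + x a)
    (huniq : ∀ a b, x a = 1 → x b = 1 → σ.SameCycle a b → b = a ∨ b = δ a)
    (a : X) (ha : x a = 1) : s (δ a) = s a + 1 := by
  by_contra hne
  have heq : s (δ a) = s a := by
    revert hne
    generalize s (δ a) = u, s a = v
    revert u v; decide
  have hcyc : σ.SameCycle (σ a) a := Equiv.Perm.sameCycle_apply_left.2 (Equiv.Perm.SameCycle.refl _ _)
  obtain ⟨n, hn⟩ := hcyc.exists_nat_pow_eq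
  -- Around the vertex, `s` changes only after `a` and `δ a`. If both had the value `s a`, neither
  -- could occur while the value is `s a + 1`, so the rotation would never return to `a`.
  have key : ∀ n : ℕ, s ((σ ^ n) (σ a)) = s a + 1 := by
    intro n
    induction n with
    | zero => rw [pow_zero, Equiv.Perm.one_apply, hsσ, ha]
    | succ n ih =>
      rw [pow_succ', Equiv.Perm.mul_apply, hsσ, ih]
      rcases ZMod.two_eq_zero_or_one (x ((σ ^ n) (σ a))) with h | h
      · rw [h, add_zero]
      · exfalso
        have hsc : σ.SameCycle a ((σ ^ n) (σ a)) := by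
          rw [Equiv.Perm.sameCycle_pow_right, Equiv.Perm.sameCycle_apply_right]
        rcases huniq a _ ha h hsc with h' | h'
        · rw [h'] at ih; simp at ih
        · rw [h', heq] at ih; simp at ih
  have := key n
  rw [hn] at this
  simp at this

variable [DecidableEq X] {c o r y : X → ZMod 2}

/-- The algebraic form of Kasteleyn's lemma. Here `s` is a set of faces and `x` its boundary, `δ`
exchanges the two boundary darts at a vertex, `r` is a perfect matching, and `y` marks the boundary
vertices. On `s = 1`, face turning `σ * α` times the reversal of the interior edges equals sector
turning `σ * δ` times the boundary walk `δ * α`. Flatness gives the sign of the face turning, the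
colours that of the reversal, and the matching that of the sector turning; the sign of the walk is
what remains. -/
theorem sign_boundary_walk (hα : ∀ a, α (α a) = a) (hδ0 : ∀ a, x a = 0 → δ a = a)
    (hδδ : ∀ a, δ (δ a) = a)
    (hδ : ∀ a, x (δ a) = x a)
    (hδcyc : ∀ a, σ.SameCycle a (δ a))
    (huniq : ∀ a b, x a = 1 → x b = 1 → σ.SameCycle a b → b = a ∨ b = δ a)
    (hcσ : ∀ a, c (σ a) = c a) (hcα : ∀ a, c (α a) = c a + 1)
    (hs : ∀ a, s (σ (α a)) = s a) (hx : ∀ a, x a = s a + s (α a))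
    (ho : ∀ a, o (α a) = o a + 1) (hflat : ∀ a, cycleSum (σ * α) o a = 1)
    (hr : ∀ a, cycleSum σ r a = 1) (hrα : ∀ a, r (α a) = r a)
    (hyσ : ∀ a, y (σ a) = y a) (hy0 : ∀ a, y a = 0 → x a = 0)
    (hy1 : ∀ a, y a = 1 → ∃ b, σ.SameCycle a b ∧ x b = 1) (hry : ∀ a, r a = 1 → y (α a) = y a)
    (h2 : ∀ a, (s ((δ * α * (δ * α)) a) * x ((δ * α * (δ * α)) a) = 1
      ∧ c ((δ * α * (δ * α)) a) = 1) ↔ (s a * x a = 1 ∧ c a = 1)) :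
    Equiv.Perm.sign (restr (δ * α * (δ * α)) (fun a => s a * x a = 1 ∧ c a = 1) h2)
      = zsign (∑ a, (1 + c a) * (x a * o a)) := by
  have h10 : ¬ ((0 : ZMod 2) = 1) := by decide
  have hsσ := face_function_rot hα hs hx
  have hsδ := face_function_partner hsσ huniq
  have hxα : ∀ a, x (α a) = x a := fun a => by rw [hx, hx, hα, add_comm]
  have hsα : ∀ a, s (α a) = s a + x a := fun a => by
    rw [hx, ← add_assoc, ZMod.two_add_self, zero_add]
  have hαne : ∀ a, α a ≠ a := fun a h => by
    have := hcα a
    rw [h] at this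
    simp at this
  have hcδ : ∀ a, c (δ a) = c a := fun a => apply_eq_of_sameCycle hcσ (hδcyc a)
  have hsδ' : ∀ a, s (δ a) = s a + x a := by
    intro a
    rcases ZMod.two_eq_zero_or_one (x a) with h | h
    · rw [hδ0 a h, h, add_zero]
    · rw [hsδ a h, h]
  have hsκ : ∀ a, s ((δ * α) a) = s a := fun a => by
    rw [Equiv.Perm.mul_apply, hsδ', hsα, hxα, add_assoc, ZMod.two_add_self, add_zero]
  have hxκ : ∀ a, x ((δ * α) a) = x a := fun a => by
    rw [Equiv.Perm.mul_apply, hδ, hxα]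
  have hcκ : ∀ a, c ((δ * α) a) = c a + 1 := fun a => by
    rw [Equiv.Perm.mul_apply, hcδ, hcα]
  have hsσδ : ∀ a, s ((σ * δ) a) = s a := fun a => by
    rw [Equiv.Perm.mul_apply, hsσ, hδ, hsδ', add_assoc, ZMod.two_add_self, add_zero]
  have hsnext : ∀ a, s ((σ * α) a) = s a := hs
  have hcnext : ∀ a, c ((σ * α) a) = c a + 1 := fun a => by
    rw [Equiv.Perm.mul_apply, hcσ, hcα]
  have hα_inv : ∀ a, s (α a) * (1 + x (α a)) = s a * (1 + x a) := fun a => by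
    rw [hxα, hsα]
    generalize s a = u, x a = v
    revert u v; decide
  have g1 := sign_restr (σ * α) s o (fun a => by rw [hsnext]) (fun a _ => hflat a)
  have g2 : Equiv.Perm.sign (restr α (fun a => s a * (1 + x a) = 1) (fun a => by rw [hα_inv]))
      = zsign (∑ a, s a * (1 + x a) * c a) := by
    refine sign_involution _ (fun a => ?_) (fun a => s a * (1 + x a)) c (fun a => ?_)
      (fun a ha => ?_)
    · by_cases h : s a * (1 + x a) = 1
      · rw [restr_of (p := fun a => s a * (1 + x a) = 1) h,
          restr_of (p := fun a => s a * (1 + x a) = 1) (by rw [hα_inv]; exact h), hα]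
      · rw [restr_of_not (p := fun a => s a * (1 + x a) = 1) h,
          restr_of_not (p := fun a => s a * (1 + x a) = 1) h]
    · by_cases h : s a * (1 + x a) = 1
      · rw [restr_of (p := fun a => s a * (1 + x a) = 1) h]
        exact ⟨fun _ => h, fun _ => hαne a⟩
      · rw [restr_of_not (p := fun a => s a * (1 + x a) = 1) h]
        exact ⟨fun h' => absurd rfl h', fun h' => absurd h' h⟩
    · rw [restr_of (p := fun a => s a * (1 + x a) = 1) ha, hcα]
  -- A cycle of `σ * δ` in `s = 1` is a sector at a boundary vertex, with exactly one boundary dart,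
  -- or a full interior vertex, where `r` sums to one. There are evenly many of the former since the
  -- boundary circuits alternate in colour, and evenly many of the latter since `r` matches interior
  -- vertices with each other.
  have g3 : Equiv.Perm.sign (restr (σ * δ) (fun a => s a = 1) (fun a => by rw [hsσδ])) = 1 := by
    rw [sign_restr (σ * δ) s (fun a => x a + r a * (1 + y a))]
    · have e1 : ∑ a, s a * x a = 0 :=
        sum_eq_zero_of_colour_flip (δ * α) _ c (fun a => by rw [hsκ, hxκ]) (fun a _ => hcκ a)
      have e2 : ∑ a, s a * (r a * (1 + y a)) = 0 := by
        refine sum_eq_zero_of_colour_flip α _ c (fun a => ?_) (fun a _ => hcα a)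
        rw [hrα]
        rcases ZMod.two_eq_zero_or_one (r a) with h | h
        · rw [h]; simp
        · rw [hry a h]
          rcases ZMod.two_eq_zero_or_one (y a) with h' | h'
          · rw [hsα, hy0 a h', add_zero]
          · rw [h', ZMod.two_add_self]; simp
      have e3 : ∑ a, s a = 0 :=
        sum_eq_zero_of_colour_flip (σ * α) _ c hsnext (fun a _ => hcnext a)
      simp only [mul_add (s _), mul_one, Finset.sum_add_distrib]
      rw [e1, e2, e3]; rfl
    · intro a ha
      have hsub : ∀ b, (σ * δ).SameCycle a b → σ.SameCycle a b := by
        intro b hab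
        obtain ⟨n, rfl⟩ := hab.exists_nat_pow_eq
        clear hab
        induction n with
        | zero => exact Equiv.Perm.SameCycle.refl _ _
        | succ n ih =>
          rw [pow_succ', Equiv.Perm.mul_apply, Equiv.Perm.mul_apply,
            Equiv.Perm.sameCycle_apply_right]
          exact ih.trans (hδcyc _)
      have hfree : (∀ b, (σ * δ).SameCycle a b → x b = 0) →
          ∀ b, (σ * δ).SameCycle a b ↔ σ.SameCycle a b := by
        intro h b
        refine ⟨hsub b, fun hab => ?_⟩
        obtain ⟨n, rfl⟩ := hab.exists_nat_pow_eq
        clear hab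
        induction n with
        | zero => exact Equiv.Perm.SameCycle.refl _ _
        | succ n ih =>
          have := Equiv.Perm.sameCycle_apply_right.2 ih
          rwa [Equiv.Perm.mul_apply, hδ0 _ (h _ ih), ← Equiv.Perm.mul_apply, ← pow_succ'] at this
      rcases ZMod.two_eq_zero_or_one (y a) with hya | hya
      · have hyb : ∀ b, σ.SameCycle a b → y b = 0 := fun b hab =>
          (apply_eq_of_sameCycle hyσ hab).trans hya
        rw [cycleSum_eq_of_sameCycle_iff (hfree fun b hab => hy0 b (hyb b (hsub b hab)))]
        refine Eq.trans ?_ (hr a)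
        refine cycleSum_congr fun b hab => ?_
        rw [hyb b hab, hy0 b (hyb b hab), zero_add, add_zero, mul_one]
      · have hyb : ∀ b, σ.SameCycle a b → y b = 1 := fun b hab =>
          (apply_eq_of_sameCycle hyσ hab).trans hya
        obtain ⟨b, hab, hxb⟩ : ∃ b, (σ * δ).SameCycle a b ∧ x b = 1 := by
          by_contra! hno
          have hno' : ∀ b, (σ * δ).SameCycle a b → x b = 0 := fun b hab =>
            (ZMod.two_eq_zero_or_one (x b)).resolve_right (hno b hab)
          obtain ⟨b, hab, hxb⟩ := hy1 a hya
          exact hno b ((hfree hno' b).2 hab) hxb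
        have hyb' : ∀ b, (σ * δ).SameCycle a b → 1 + y b = 0 := fun b hab => by
          rw [hyb b (hsub b hab)]; rfl
        rw [cycleSum_eq_single b hab, hxb, hyb' b hab, mul_zero, add_zero]
        intro b' hab' hne
        rw [hyb' b' hab', mul_zero, add_zero]
        refine (ZMod.two_eq_zero_or_one (x b')).resolve_right fun hxb' => ?_
        rcases huniq b b' hxb hxb' ((hsub b hab).symm.trans (hsub b' hab')) with h | h
        · exact hne h
        · have e1 := apply_eq_of_sameCycle hsσδ hab
          have e2 := apply_eq_of_sameCycle hsσδ hab'
          rw [h, hsδ b hxb, e1] at e2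
          simp at e2
  have huκ : ∀ a, s ((δ * α) a) * x ((δ * α) a) = s a * x a := fun a => by rw [hsκ, hxκ]
  have g4 := sign_restr_swap (δ * α) (fun a => s a * x a) c (fun a => by rw [huκ])
    (fun a _ => hcκ a) h2
  -- On interior darts both sides are `σ`, on boundary darts both are `σ * α`.
  have hmul : restr (σ * α) (fun a => s a = 1) (fun a => by rw [hsnext])
      * restr α (fun a => s a * (1 + x a) = 1) (fun a => by rw [hα_inv])
      = restr (σ * δ) (fun a => s a = 1) (fun a => by rw [hsσδ])
      * restr (δ * α) (fun a => s a * x a = 1) (fun a => by rw [huκ]) := by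
    ext a
    rw [Equiv.Perm.mul_apply, Equiv.Perm.mul_apply]
    rcases ZMod.two_eq_zero_or_one (s a) with h | h
    · have hsa : ¬ s a = 1 := by rw [h]; exact h10
      rw [restr_of_not (p := fun a => s a * (1 + x a) = 1) (by simp [h]),
        restr_of_not (p := fun a => s a * x a = 1) (by simp [h]),
        restr_of_not (p := fun a => s a = 1) hsa, restr_of_not (p := fun a => s a = 1) hsa]
    · rcases ZMod.two_eq_zero_or_one (x a) with hxa | hxa
      · rw [restr_of (p := fun a => s a * (1 + x a) = 1) (by simp [h, hxa]),
          restr_of_not (p := fun a => s a * x a = 1) (by simp [hxa]),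
          restr_of (p := fun a => s a = 1) (by rw [hsα, h, hxa]; rfl),
          restr_of (p := fun a => s a = 1) h, Equiv.Perm.mul_apply, Equiv.Perm.mul_apply, hα,
          hδ0 a hxa]
      · rw [restr_of_not (p := fun a => s a * (1 + x a) = 1)
            (by rw [hxa, ZMod.two_add_self, mul_zero]; exact h10),
          restr_of (p := fun a => s a * x a = 1) (by simp [h, hxa]),
          restr_of (p := fun a => s a = 1) h,
          restr_of (p := fun a => s a = 1) (by rw [hsκ]; exact h), Equiv.Perm.mul_apply,
          Equiv.Perm.mul_apply, Equiv.Perm.mul_apply, hδδ]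
  have hsgn := congrArg Equiv.Perm.sign hmul
  rw [Equiv.Perm.sign_mul, Equiv.Perm.sign_mul, g1, g2, g3, g4, one_mul] at hsgn
  have hsgn' := congrArg (fun u => zsign (∑ a, s a * x a * c a) * u) hsgn
  beta_reduce at hsgn'
  rw [← mul_assoc (zsign _) (zsign _) (Equiv.Perm.sign _), zsign_mul_self, one_mul, ← zsign_add,
    ← zsign_add] at hsgn'
  rw [← hsgn']
  congr 1
  have e3 : ∑ a, s a = 0 :=
    sum_eq_zero_of_colour_flip (σ * α) _ c hsnext (fun a _ => hcnext a)
  -- `α` flips both `o` and `c`, so the colour-1 half of the sum moves to colour 0, where `s a + s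
  -- (α a)` becomes `x a`.
  have e4 : ∑ a, s a * c a * (o a + c a) = ∑ a, s (α a) * (1 + c a) * (o a + c a) := by
    rw [← Equiv.sum_comp α]
    refine Finset.sum_congr rfl fun a _ => ?_
    rw [hcα, ho, add_comm 1 (c a)]
    congr 1
    generalize o a = u, c a = v
    revert u v; decide
  calc ∑ a, s a * x a * c a + (∑ a, s a * (o a + 1) + ∑ a, s a * (1 + x a) * c a)
      = ∑ a, s a + (∑ a, s a * (1 + c a) * (o a + c a) + ∑ a, s a * c a * (o a + c a)) := by
        rw [← Finset.sum_add_distrib, ← Finset.sum_add_distrib, ← Finset.sum_add_distrib,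
          ← Finset.sum_add_distrib]
        refine Finset.sum_congr rfl fun a _ => ?_
        generalize s a = u, x a = v, c a = w, o a = z
        revert u v w z; decide
    _ = ∑ a, (1 + c a) * (x a * o a) := by
        rw [e3, zero_add, e4, ← Finset.sum_add_distrib]
        refine Finset.sum_congr rfl fun a _ => ?_
        rw [hx]
        generalize s a = u, s (α a) = v, c a = w, o a = z
        revert u v w z; decide

end boundary

/-! ### Signs of bijections between pairings -/

section pairing

variable {V : Type*} [Fintype V] [DecidableEq V] {μ μ' π : Equiv.Perm V} {β T T' : V → ZMod 2}

/-- `π` is determined by its restriction `A` to colour 0: on colour 1 it is `μ' A μ = (μ' A μ') (μ'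
μ)`. The conjugate permutations `A` and `μ' A μ'` have equal signs, which cancel. -/
theorem sign_of_colour_preserving (hμ' : ∀ v, μ' (μ' v) = v)
    (hβ : ∀ v, β (μ v) = β v + 1) (hβ' : ∀ v, β (μ' v) = β v + 1)
    (hπ : ∀ v, π (μ v) = μ' (π v)) (hπβ : ∀ v, β (π v) = β v)
    (h : ∀ v, β ((μ' * μ) v) = 1 ↔ β v = 1) :
    Equiv.Perm.sign π = Equiv.Perm.sign (restr (μ' * μ) (fun v => β v = 1) h) := by
  let A := restr π (fun v => β v = 0) (fun v => by rw [hπβ])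
  have hA0 : ∀ v, β v = 0 → A v = π v := fun v hv => restr_of (p := fun v => β v = 0) hv
  have hA1 : ∀ v, β v = 1 → A v = v := fun v hv =>
    restr_of_not (p := fun v => β v = 0) (by simp [hv])
  have hdec : π = A * (μ' * A * μ') * restr (μ' * μ) (fun v => β v = 1) h := by
    ext v
    rw [Equiv.Perm.mul_apply, Equiv.Perm.mul_apply, Equiv.Perm.mul_apply, Equiv.Perm.mul_apply]
    rcases ZMod.two_eq_zero_or_one (β v) with h0 | h1
    · have e1 : β (μ' v) = 1 := by rw [hβ', h0, zero_add]
      rw [restr_of_not (p := fun v => β v = 1) (by simp [h0]),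
        hA1 _ e1, hμ', hA0 _ h0]
    · have e1 : β (μ v) = 0 := by rw [hβ, h1]; rfl
      have e2 : β (μ' (π (μ v))) = 1 := by rw [hβ', hπβ, e1, zero_add]
      rw [restr_of (p := fun v => β v = 1) h1, Equiv.Perm.mul_apply, hμ',
        hA0 _ e1, hA1 _ e2, hπ, hμ']
  have hsgn := congrArg Equiv.Perm.sign hdec
  rw [Equiv.Perm.sign_mul, Equiv.Perm.sign_mul, Equiv.Perm.sign_mul, Equiv.Perm.sign_mul] at hsgn
  rw [hsgn]
  generalize Equiv.Perm.sign A = a, Equiv.Perm.sign μ' = b, Equiv.Perm.sign (restr (μ' * μ) (fun v => β v = 1) h) = c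
  revert a b c; decide

/-- The permutation that exchanges the two ends of every pair on which `T` and `β` disagree. -/
theorem exists_pair_flip (hμ : ∀ v, μ (μ v) = v) (hβ : ∀ v, β (μ v) = β v + 1)
    (hT : ∀ v, T (μ v) = T v + 1) :
    ∃ F : Equiv.Perm V, (∀ v, F (F v) = v) ∧ (∀ v, F (μ v) = μ (F v)) ∧ (∀ v, β (F v) = T v) ∧
      (∀ v, T (F v) = β v) ∧ Equiv.Perm.sign F = zsign (∑ v, (1 + β v) * T v) := by
  have hne : ∀ v, μ v ≠ v := fun v h => by
    have := hT v
    rw [h] at this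
    simp at this
  have hu : ∀ v, T (μ v) + β (μ v) = T v + β v := fun v => by
    rw [hT, hβ]
    generalize T v = x, β v = y
    revert x y; decide
  let F := restr μ (fun v => T v + β v = 1) (fun v => by rw [hu])
  have hF : ∀ v, (T v + β v = 1 ∧ F v = μ v) ∨ (T v + β v = 0 ∧ F v = v) := by
    intro v
    rcases ZMod.two_eq_zero_or_one (T v + β v) with h | h
    · exact Or.inr ⟨h, restr_of_not (p := fun v => T v + β v = 1) (by simp [h])⟩
    · exact Or.inl ⟨h, restr_of (p := fun v => T v + β v = 1) h⟩
  have hFF : ∀ v, F (F v) = v := by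
    intro v
    rcases hF v with ⟨h, e⟩ | ⟨h, e⟩
    · rw [e]
      rcases hF (μ v) with ⟨h', e'⟩ | ⟨h', e'⟩
      · rw [e', hμ]
      · rw [hu, h] at h'; exact absurd h' (by decide)
    · rw [e, e]
  refine ⟨F, hFF, fun v => ?_, fun v => ?_, fun v => ?_, ?_⟩
  · rcases hF v with ⟨h, e⟩ | ⟨h, e⟩ <;> rcases hF (μ v) with ⟨h', e'⟩ | ⟨h', e'⟩
    · rw [e, e']
    · rw [hu, h] at h'; exact absurd h' (by decide)
    · rw [hu, h] at h'; exact absurd h' (by decide)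
    · rw [e, e']
  · rcases hF v with ⟨h, e⟩ | ⟨h, e⟩ <;> rw [e]
    · rw [hβ]; revert h; generalize T v = x, β v = y; revert x y; decide
    · exact ZMod.two_add_eq_zero_iff.1 h
  · rcases hF v with ⟨h, e⟩ | ⟨h, e⟩ <;> rw [e]
    · rw [hT]; revert h; generalize T v = x, β v = y; revert x y; decide
    · exact (ZMod.two_add_eq_zero_iff.1 h).symm
  · rw [sign_involution F hFF (fun v => T v + β v) (fun v => 1 + β v)]
    · congr 1
      refine Finset.sum_congr rfl fun v _ => ?_
      generalize T v = x, β v = y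
      revert x y; decide
    · intro v
      rcases hF v with ⟨h, e⟩ | ⟨h, e⟩
      · rw [e]; exact ⟨fun _ => h, fun _ => hne v⟩
      · rw [e, h]; exact ⟨fun h => absurd rfl h, fun h => absurd h (by decide)⟩
    · intro v hv
      rcases hF v with ⟨h, e⟩ | ⟨h, e⟩
      · rw [e, hβ, add_assoc]
      · rw [h] at hv; exact absurd hv (by decide)

/-- The sign of a bijection that carries the directed pairs of `μ` to those of `μ'`, where `T` and
`T'` mark the tails of the pairs. -/
theorem sign_pairing (hμ : ∀ v, μ (μ v) = v) (hμ' : ∀ v, μ' (μ' v) = v)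
    (hβ : ∀ v, β (μ v) = β v + 1) (hβ' : ∀ v, β (μ' v) = β v + 1)
    (hT : ∀ v, T (μ v) = T v + 1) (hT' : ∀ v, T' (μ' v) = T' v + 1)
    (hπ : ∀ v, π (μ v) = μ' (π v)) (hπT : ∀ v, T' (π v) = T v)
    (h : ∀ v, β ((μ' * μ) v) = 1 ↔ β v = 1) :
    Equiv.Perm.sign π = zsign (∑ v, (1 + β v) * (T v + T' v))
      * Equiv.Perm.sign (restr (μ' * μ) (fun v => β v = 1) h) := by
  obtain ⟨F, hFF, hFμ, hβF, hTF, hF⟩ := exists_pair_flip hμ hβ hT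
  obtain ⟨F', hFF', hFμ', hβF', hTF', hF'⟩ := exists_pair_flip hμ' hβ' hT'
  rw [← sign_of_colour_preserving (π := F' * π * F) hμ' hβ hβ'
    (fun v => by simp only [Equiv.Perm.mul_apply]; rw [hFμ, hπ, hFμ'])
    (fun v => by simp only [Equiv.Perm.mul_apply]; rw [hβF', hπT, hTF]) h]
  simp only [mul_add (1 + β _), Finset.sum_add_distrib]
  rw [zsign_add, Equiv.Perm.sign_mul, Equiv.Perm.sign_mul, hF, hF',
    mul_comm _ (zsign (∑ v, (1 + β v) * T v)), ← mul_assoc,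
    mul_comm (zsign (∑ v, (1 + β v) * T v)), mul_assoc (zsign (∑ v, (1 + β v) * T' v)),
    zsign_mul_self, mul_one, ← mul_assoc, zsign_mul_self, one_mul]

/-- Two listings of the same pairs differ in sign by the number of pairs with exchanged tail. Taking
`β = T'` makes the rotation factor trivial. -/
theorem sign_pairing_self (hμ : ∀ v, μ (μ v) = v) (hT : ∀ v, T (μ v) = T v + 1)
    (hT' : ∀ v, T' (μ v) = T' v + 1) (hπ : ∀ v, π (μ v) = μ (π v)) (hπT : ∀ v, T' (π v) = T v) :
    Equiv.Perm.sign π = zsign (∑ v, (1 + T' v) * T v) := by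
  have hsq : ∀ v, (μ * μ) v = v := hμ
  rw [sign_pairing (β := T') hμ hμ hT' hT' hT hT' hπ hπT (fun v => by rw [hsq])]
  have : restr (μ * μ) (fun v => T' v = 1) (fun v => by rw [hsq]) = 1 := by
    ext v
    by_cases h : T' v = 1
    · rw [restr_of (p := fun v => T' v = 1) h, hsq]; rfl
    · rw [restr_of_not (p := fun v => T' v = 1) h]; rfl
  rw [this, Equiv.Perm.sign_one, mul_one]
  congr 1
  refine Finset.sum_congr rfl fun v _ => ?_
  generalize T v = x, T' v = y
  revert x y; decide

end pairing

/-! ### Perfect matchings as involutions of the vertices. -/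

namespace Multigraph

variable {V D : Type*} {Z : Multigraph V D}

theorem src_rev (d : D) : Z.src (Z.rev d) = Z.tgt d := rfl

theorem tgt_rev (d : D) : Z.tgt (Z.rev d) = Z.src d := by rw [tgt, Z.rev_rev]

namespace IsPerfectMatching

variable {m : Set D} (hm : Z.IsPerfectMatching m)

/-- The dart of a perfect matching that starts at a given vertex. -/
noncomputable def dartAt (v : V) : D := (hm.2 v).choose

theorem dartAt_mem (v : V) : hm.dartAt v ∈ m := (hm.2 v).choose_spec.1.1

theorem src_dartAt (v : V) : Z.src (hm.dartAt v) = v := (hm.2 v).choose_spec.1.2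

theorem dartAt_src {d : D} (hd : d ∈ m) : hm.dartAt (Z.src d) = d :=
  ((hm.2 (Z.src d)).choose_spec.2 d ⟨hd, rfl⟩).symm

theorem mem_iff {d : D} : d ∈ m ↔ hm.dartAt (Z.src d) = d :=
  ⟨hm.dartAt_src, fun h => h ▸ hm.dartAt_mem _⟩

theorem dartAt_tgt (v : V) : hm.dartAt (Z.tgt (hm.dartAt v)) = Z.rev (hm.dartAt v) :=
  hm.dartAt_src (hm.1 _ (hm.dartAt_mem v))

include hm in
theorem rev_mem_iff {d : D} : Z.rev d ∈ m ↔ d ∈ m :=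
  ⟨fun h => by simpa [Z.rev_rev] using hm.1 _ h, hm.1 d⟩

theorem tgt_tgt (v : V) : Z.tgt (hm.dartAt (Z.tgt (hm.dartAt v))) = v := by
  rw [hm.dartAt_tgt, tgt_rev, hm.src_dartAt]

/-- The involution of the vertices that exchanges the ends of the edges of a perfect matching. -/
noncomputable def mate : Equiv.Perm V :=
  ⟨fun v => Z.tgt (hm.dartAt v), fun v => Z.tgt (hm.dartAt v), hm.tgt_tgt, hm.tgt_tgt⟩

theorem mate_apply (v : V) : hm.mate v = Z.tgt (hm.dartAt v) := rfl

theorem mate_mate (v : V) : hm.mate (hm.mate v) = v := hm.tgt_tgt v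

theorem dartAt_mate (v : V) : hm.dartAt (hm.mate v) = Z.rev (hm.dartAt v) := hm.dartAt_tgt v

theorem mate_ne (v : V) : hm.mate v ≠ v := fun h => by
  have := hm.dartAt_mate v
  rw [h] at this
  exact Z.rev_ne _ this.symm

end IsPerfectMatching

open Classical in
/-- The indicator of the darts of an orientation. -/
noncomputable def Orientation.ind (o : Z.Orientation) (d : D) : ZMod 2 := if d ∈ o.darts then 1 else 0

theorem Orientation.ind_eq_one_iff (o : Z.Orientation) (d : D) : o.ind d = 1 ↔ d ∈ o.darts := by
  by_cases h : d ∈ o.darts <;> simp [ind, h]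

theorem Orientation.ind_rev (o : Z.Orientation) (d : D) : o.ind (Z.rev d) = o.ind d + 1 := by
  by_cases h : d ∈ o.darts
  · simp [ind, h, (o.mem_iff d).1 h]; rfl
  · have : Z.rev d ∈ o.darts := by by_contra h'; exact h ((o.mem_iff d).2 h')
    simp [ind, h, this]

/-- The indicator of the tails of the edges of a matching. -/
noncomputable def IsPerfectMatching.tail {m : Set D} (hm : Z.IsPerfectMatching m)
    (o : Z.Orientation) (v : V) : ZMod 2 := o.ind (hm.dartAt v)

theorem IsPerfectMatching.tail_mate {m : Set D} (hm : Z.IsPerfectMatching m)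
    (o : Z.Orientation) (v : V) : hm.tail o (hm.mate v) = hm.tail o v + 1 := by
  rw [tail, dartAt_mate, Orientation.ind_rev, tail]

end Multigraph

/-! ### Flat orientations and pairs of perfect matchings -/

namespace CellEmbedding

variable {V D Φ : Type*} {Z : Multigraph V D} (M : CellEmbedding Z Φ) [Fintype Φ]

theorem cycleSum_next_of_isFlat {o : Z.Orientation} (ho : M.IsFlat o) (φ : Φ) :
    cycleSum M.next (fun ψ => o.ind (M.dart ψ)) φ = 1 := by
  classical
  have h := ho φ
  unfold curvature at h
  have hodd : Odd {ψ | ψ ∈ M.sides φ ∧ M.dart ψ ∈ o.darts}.ncard := by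
    by_contra h'
    rw [if_neg h'] at h
    exact absurd h (by decide)
  rw [← ZMod.natCast_eq_one_iff_odd, Set.ncard_eq_toFinset_card'] at hodd
  rw [← hodd, cycleSum]
  simp only [Multigraph.Orientation.ind]
  rw [← Finset.sum_filter, Finset.sum_const, nsmul_eq_mul, mul_one, Finset.filter_filter]
  congr 2
  ext ψ
  simp only [Finset.mem_filter, Finset.mem_univ, true_and, Set.mem_toFinset]
  exact Iff.rfl

theorem isFlat_of_cycleSum_next {o : Z.Orientation}
    (h : ∀ φ, cycleSum M.next (fun ψ => o.ind (M.dart ψ)) φ = 1) : M.IsFlat o := by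
  classical
  intro φ
  have h := h φ
  unfold curvature
  rw [if_pos]
  rw [← ZMod.natCast_eq_one_iff_odd, Set.ncard_eq_toFinset_card', ← h, cycleSum]
  simp only [Multigraph.Orientation.ind]
  rw [← Finset.sum_filter, Finset.sum_const, nsmul_eq_mul, mul_one, Finset.filter_filter]
  congr 2
  ext ψ
  simp only [Finset.mem_filter, Finset.mem_univ, true_and, Set.mem_toFinset]
  exact Iff.rfl

variable {c : Φ → ZMod 2} (hc0 : ∀ φ, c (M.τ₀ φ) = c φ) (hc1 : ∀ φ, c (M.τ₁ φ) = c φ + 1)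
  (hc2 : ∀ φ, c (M.τ₂ φ) = c φ + 1)

include hc1 hc2 in
-- A vertex of the cover is a vertex of `Z` together with a colour. In the same way, by
-- `eq_of_dart_eq` and `exists_flag`, a flag is a dart together with a colour.
theorem sameCycle_rot_iff (φ ψ : Φ) :
    M.rot.SameCycle φ ψ ↔ M.vert φ = M.vert ψ ∧ c φ = c ψ :=
  sameCycle_mul_iff M.τ₁ M.τ₂ M.τ₁_τ₁ M.τ₂_τ₂ M.vert M.vert_eq_iff c hc1 hc2 φ ψ

omit [Fintype Φ] in
include hc2 in
theorem eq_of_dart_eq {φ ψ : Φ} (h : M.dart φ = M.dart ψ) (hc : c φ = c ψ) : φ = ψ := by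
  rcases (M.dart_eq_iff φ ψ).1 h with h' | h'
  · exact h'.symm
  · rw [h', hc2] at hc
    simp at hc

omit [Fintype Φ] in
include hc2 in
theorem exists_flag (d : D) (i : ZMod 2) : ∃ φ, M.dart φ = d ∧ c φ = i := by
  obtain ⟨φ, rfl⟩ := M.dart_surjective d
  by_cases h : c φ = i
  · exact ⟨φ, rfl, h⟩
  · refine ⟨M.τ₂ φ, M.dart_τ₂ φ, ?_⟩
    rw [hc2]
    exact (ZMod.two_add_one_eq_of_ne (Ne.symm h)).symm

omit [Fintype Φ] in
theorem vert_flip (φ : Φ) : M.vert (M.flip φ) = Z.tgt (M.dart φ) := by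
  rw [vert, dart_flip]; rfl

/-- The indicator of the flags on the edges of a perfect matching. -/
noncomputable def matchInd {m : Set D} (_ : Z.IsPerfectMatching m) (φ : Φ) : ZMod 2 :=
  open Classical in if M.dart φ ∈ m then 1 else 0

section matchInd

variable {m : Set D} (hm : Z.IsPerfectMatching m)

omit [Fintype Φ] in
theorem matchInd_eq_one_iff (φ : Φ) : M.matchInd hm φ = 1 ↔ hm.dartAt (M.vert φ) = M.dart φ := by
  rw [vert, ← hm.mem_iff]
  by_cases h : M.dart φ ∈ m <;> simp [matchInd, h]

omit [Fintype Φ] in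
theorem matchInd_flip (φ : Φ) : M.matchInd hm (M.flip φ) = M.matchInd hm φ := by
  have : M.dart (M.flip φ) ∈ m ↔ M.dart φ ∈ m := by rw [dart_flip, hm.rev_mem_iff]
  unfold matchInd
  by_cases h : M.dart φ ∈ m
  · rw [if_pos h, if_pos (this.2 h)]
  · rw [if_neg h, if_neg (fun h' => h (this.1 h'))]

omit [Fintype Φ] in
theorem vert_flip_of_matchInd {φ : Φ} (h : M.matchInd hm φ = 1) :
    M.vert (M.flip φ) = hm.mate (M.vert φ) := by
  rw [vert_flip, hm.mate_apply, (M.matchInd_eq_one_iff hm φ).1 h]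

include hc1 hc2 in
theorem cycleSum_matchInd (φ : Φ) : cycleSum M.rot (M.matchInd hm) φ = 1 := by
  obtain ⟨ψ, hψ, hcψ⟩ := M.exists_flag hc2 (hm.dartAt (M.vert φ)) (c φ)
  have hv : M.vert ψ = M.vert φ := by rw [vert, hψ, hm.src_dartAt]
  rw [cycleSum_eq_single ψ]
  · rw [matchInd_eq_one_iff, hψ, hv]
  · rw [M.sameCycle_rot_iff hc1 hc2]
    exact ⟨hv.symm, hcψ.symm⟩
  · intro ψ' h hne
    rw [M.sameCycle_rot_iff hc1 hc2] at h
    refine (ZMod.two_eq_zero_or_one _).resolve_right fun h1 => hne ?_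
    rw [matchInd_eq_one_iff, ← h.1, ← hψ] at h1
    exact M.eq_of_dart_eq hc2 h1.symm (by rw [← h.2, hcψ])

variable [Fintype V]

include hc2 in
/-- A sum over the matching darts of one colour is a sum over the vertices. -/
theorem sum_matchInd (i : ZMod 2) (f : V → ZMod 2) (o : Z.Orientation) :
    ∑ φ, (if c φ = i then f (M.vert φ) * (M.matchInd hm φ * o.ind (M.dart φ)) else 0)
      = ∑ v, f v * hm.tail o v := by
  choose e he1 he2 using fun v => M.exists_flag hc2 (hm.dartAt v) i
  have hev : ∀ v, M.vert (e v) = v := fun v => by rw [vert, he1, hm.src_dartAt]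
  symm
  refine Finset.sum_of_injOn e (fun v _ v' _ h => by rw [← hev v, h, hev])
    (fun _ _ => Finset.mem_univ _) ?_ ?_
  · intro φ _ hφ
    by_cases h : c φ = i
    · rw [if_pos h]
      rcases ZMod.two_eq_zero_or_one (M.matchInd hm φ) with h0 | h1
      · rw [h0, zero_mul, mul_zero]
      · refine absurd ⟨M.vert φ, Finset.mem_coe.2 (Finset.mem_univ _), ?_⟩ hφ
        rw [matchInd_eq_one_iff] at h1
        exact M.eq_of_dart_eq hc2 (by rw [he1, h1]) (by rw [he2, h])
    · rw [if_neg h]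
  · intro v _
    have : M.matchInd hm (e v) = 1 := by rw [matchInd_eq_one_iff, hev, he1]
    rw [if_pos (he2 v), hev, this, one_mul, he1]; rfl

end matchInd

variable [Fintype V] [DecidableEq V]

include hc0 hc1 hc2 in
/-- For a flat orientation the sign of the permutation that compares two perfect matchings is
determined by the directions of their edges. -/
theorem sign_matchings [Nonempty Φ] (hproj : M.IsProjectivePlane) {o : Z.Orientation}
    (ho : M.IsFlat o) {m m' : Set D}
    (hm : Z.IsPerfectMatching m) (hm' : Z.IsPerfectMatching m') {β : V → ZMod 2}
    (hβ : ∀ v, β (hm.mate v) = β v + 1) (hβ' : ∀ v, β (hm'.mate v) = β v + 1)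
    (h : ∀ v, β ((hm'.mate * hm.mate) v) = 1 ↔ β v = 1) :
    Equiv.Perm.sign (restr (hm'.mate * hm.mate) (fun v => β v = 1) h)
      = zsign (∑ v, (1 + β v) * (hm.tail o v + hm'.tail o v)) := by
  classical
  have hcσ : ∀ φ, c (M.rot φ) = c φ := fun φ => by
    rw [rot_apply, hc1, hc2, add_assoc, ZMod.two_add_self, add_zero]
  have hcα : ∀ φ, c (M.flip φ) = c φ + 1 := fun φ => by rw [flip_apply, hc0, hc2]
  have hvσ : ∀ φ, M.vert (M.rot φ) = M.vert φ := fun φ =>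
    (((M.sameCycle_rot_iff hc1 hc2 φ (M.rot φ)).1 ⟨1, by simp⟩).1).symm
  have hsc := M.sameCycle_rot_iff hc1 hc2
  let a := M.matchInd hm
  let a' := M.matchInd hm'
  have ha1 : ∀ φ, a φ = 1 ↔ hm.dartAt (M.vert φ) = M.dart φ := M.matchInd_eq_one_iff hm
  have ha1' : ∀ φ, a' φ = 1 ↔ hm'.dartAt (M.vert φ) = M.dart φ := M.matchInd_eq_one_iff hm'
  -- `k` marks the flags at the chosen lifts, those with `c = β`. Lifted matching edges join chosen
  -- lifts, as both colours alternate along them. The sum `x` cancels the edges common to both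
  -- matchings.
  let k : Φ → ZMod 2 := fun φ => β (M.vert φ) + c φ + 1
  let x : Φ → ZMod 2 := fun φ => k φ * (a φ + a' φ)
  have hkσ : ∀ φ, k (M.rot φ) = k φ := fun φ => by simp only [k, hvσ, hcσ]
  have hkα : ∀ φ, a φ = 1 ∨ a' φ = 1 → k (M.flip φ) = k φ := by
    intro φ hφ
    have : β (M.vert (M.flip φ)) = β (M.vert φ) + 1 := by
      rcases hφ with hφ | hφ
      · rw [M.vert_flip_of_matchInd hm hφ, hβ]
      · rw [M.vert_flip_of_matchInd hm' hφ, hβ']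
    simp only [k, this, hcα]
    generalize β (M.vert φ) = u, c φ = w
    revert u w; decide
  have haα : ∀ φ, a (M.flip φ) = a φ := M.matchInd_flip hm
  have haα' : ∀ φ, a' (M.flip φ) = a' φ := M.matchInd_flip hm'
  have hxα : ∀ φ, x (M.flip φ) = x φ := by
    intro φ
    simp only [x, haα, haα']
    rcases ZMod.two_eq_zero_or_one (a φ) with h1 | h1
    · rcases ZMod.two_eq_zero_or_one (a' φ) with h2 | h2
      · rw [h1, h2]; simp
      · rw [hkα φ (Or.inr h2)]
    · rw [hkα φ (Or.inl h1)]
  have hxsum : ∀ φ, cycleSum M.rot x φ = 0 := by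
    intro φ
    simp only [x]
    rw [cycleSum_mul_left hkσ, cycleSum_add, M.cycleSum_matchInd hc1 hc2 hm,
      M.cycleSum_matchInd hc1 hc2 hm', ZMod.two_add_self, mul_zero]
  obtain ⟨s, hs, hxs⟩ := exists_face_function M.rot M.flip M.flip_flip M.flip_ne
    (M.cover_connected hproj) (M.card_cycles hproj.2) x hxα hxsum
  -- the flags on which `x` is supported
  have hx1 : ∀ φ, x φ = 1 ↔ k φ = 1 ∧ ((a φ = 1 ∧ a' φ = 0) ∨ (a φ = 0 ∧ a' φ = 1)) := by
    intro φ
    simp only [x]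
    generalize k φ = u, a φ = v, a' φ = w
    revert u v w; decide
  -- The partner of a boundary dart belongs to the other matching at the same vertex of the cover.
  let other : Φ → D := fun φ => if a φ = 1 then hm'.dartAt (M.vert φ) else hm.dartAt (M.vert φ)
  choose fl hfl1 hfl2 using fun φ => M.exists_flag hc2 (other φ) (c φ)
  have hflv : ∀ φ, M.vert (fl φ) = M.vert φ := by
    intro φ
    rw [vert, hfl1]
    simp only [other]
    split_ifs
    · exact hm'.src_dartAt _
    · exact hm.src_dartAt _
  have hfl_a : ∀ φ, x φ = 1 → a φ = 1 → a (fl φ) = 0 ∧ a' (fl φ) = 1 := by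
    intro φ hx h1
    have hd : M.dart (fl φ) = hm'.dartAt (M.vert φ) := by rw [hfl1]; simp only [other, if_pos h1]
    have h2 : a' (fl φ) = 1 := by rw [ha1', hflv, hd]
    refine ⟨(ZMod.two_eq_zero_or_one _).resolve_right fun h3 => ?_, h2⟩
    rw [ha1, hflv, hd, (ha1 φ).1 h1] at h3
    have h4 : a' φ = 1 := by rw [ha1', h3]
    rcases ((hx1 φ).1 hx).2 with h5 | h5
    · rw [h4] at h5; exact one_ne_zero h5.2
    · rw [h1] at h5; exact one_ne_zero h5.1
  have hfl_a' : ∀ φ, x φ = 1 → a φ = 0 → a (fl φ) = 1 ∧ a' (fl φ) = 0 := by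
    intro φ hx h1
    have hd : M.dart (fl φ) = hm.dartAt (M.vert φ) := by
      rw [hfl1]; simp only [other, h1, if_neg (zero_ne_one (α := ZMod 2))]
    have h2 : a (fl φ) = 1 := by rw [ha1, hflv, hd]
    refine ⟨h2, (ZMod.two_eq_zero_or_one _).resolve_right fun h3 => ?_⟩
    have h4 : a' φ = 1 := by
      rcases ((hx1 φ).1 hx).2 with h5 | h5
      · rw [h1] at h5; exact absurd h5.1 zero_ne_one
      · exact h5.2
    rw [ha1', hflv, hd, (ha1' φ).1 h4] at h3
    have h5 := (ha1 φ).2 h3.symm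
    rw [h1] at h5
    exact zero_ne_one h5
  have hflk : ∀ φ, k (fl φ) = k φ := fun φ => by simp only [k, hflv, hfl2]
  have hflx : ∀ φ, x φ = 1 → x (fl φ) = 1 := by
    intro φ hx
    rw [hx1, hflk]
    refine ⟨((hx1 φ).1 hx).1, ?_⟩
    rcases ((hx1 φ).1 hx).2 with h5 | h5
    · exact Or.inr (hfl_a φ hx h5.1)
    · exact Or.inl (hfl_a' φ hx h5.1)
  have hflfl : ∀ φ, x φ = 1 → fl (fl φ) = φ := by
    intro φ hx
    refine M.eq_of_dart_eq hc2 ?_ (by rw [hfl2, hfl2])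
    rw [hfl1]
    rcases ((hx1 φ).1 hx).2 with h5 | h5
    · have := hfl_a φ hx h5.1
      simp only [other, this.1, if_neg (zero_ne_one (α := ZMod 2)), hflv]
      exact (ha1 φ).1 h5.1
    · have := hfl_a' φ hx h5.1
      simp only [other, this.1, if_true, hflv]
      exact (ha1' φ).1 h5.2
  let δf : Φ → Φ := fun φ => if x φ = 1 then fl φ else φ
  have hδδ : ∀ φ, δf (δf φ) = φ := by
    intro φ
    by_cases hx : x φ = 1
    · simp only [δf, if_pos hx, if_pos (hflx φ hx), hflfl φ hx]
    · simp only [δf, if_neg hx]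
  let δ : Equiv.Perm Φ := ⟨δf, δf, hδδ, hδδ⟩
  have hδ1 : ∀ φ, x φ = 1 → δ φ = fl φ := fun φ hx => if_pos hx
  have hδ0 : ∀ φ, x φ = 0 → δ φ = φ := fun φ hx => if_neg (by rw [hx]; exact zero_ne_one)
  have hδx : ∀ φ, x (δ φ) = x φ := by
    intro φ
    rcases ZMod.two_eq_zero_or_one (x φ) with hx | hx
    · rw [hδ0 φ hx]
    · rw [hδ1 φ hx, hflx φ hx, hx]
  have hδv : ∀ φ, M.vert (δ φ) = M.vert φ := by
    intro φ
    rcases ZMod.two_eq_zero_or_one (x φ) with hx | hx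
    · rw [hδ0 φ hx]
    · rw [hδ1 φ hx, hflv]
  have hδc : ∀ φ, c (δ φ) = c φ := by
    intro φ
    rcases ZMod.two_eq_zero_or_one (x φ) with hx | hx
    · rw [hδ0 φ hx]
    · rw [hδ1 φ hx, hfl2]
  have huniq : ∀ φ ψ, x φ = 1 → x ψ = 1 → M.rot.SameCycle φ ψ → ψ = φ ∨ ψ = δ φ := by
    intro φ ψ hφ hψ hφψ
    rw [hsc] at hφψ
    by_cases hd : a φ = a ψ
    · left
      refine M.eq_of_dart_eq hc2 ?_ hφψ.2.symm
      rcases ((hx1 φ).1 hφ).2 with h5 | h5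
      · rw [← (ha1 ψ).1 (by rw [← hd]; exact h5.1), ← (ha1 φ).1 h5.1, hφψ.1]
      · rcases ((hx1 ψ).1 hψ).2 with h6 | h6
        · rw [h5.1, h6.1] at hd; exact absurd hd zero_ne_one
        · rw [← (ha1' ψ).1 h6.2, ← (ha1' φ).1 h5.2, hφψ.1]
    · right
      rw [hδ1 φ hφ]
      refine M.eq_of_dart_eq hc2 ?_ (by rw [hfl2, hφψ.2])
      rw [hfl1]
      rcases ((hx1 φ).1 hφ).2 with h5 | h5
      · rcases ((hx1 ψ).1 hψ).2 with h6 | h6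
        · rw [h5.1, h6.1] at hd; exact absurd rfl hd
        · simp only [other, h5.1, if_true]
          rw [← (ha1' ψ).1 h6.2, hφψ.1]
      · rcases ((hx1 ψ).1 hψ).2 with h6 | h6
        · simp only [other, h5.1, if_neg (zero_ne_one (α := ZMod 2))]
          rw [← (ha1 ψ).1 h6.1, hφψ.1]
        · rw [h5.1, h6.1] at hd; exact absurd rfl hd
  -- the vertices at which the two matchings differ
  let y : Φ → ZMod 2 := fun φ =>
    k φ * (if hm.dartAt (M.vert φ) = hm'.dartAt (M.vert φ) then 0 else 1)
  have hyσ : ∀ φ, y (M.rot φ) = y φ := fun φ => by simp only [y, hkσ, hvσ]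
  have hy0 : ∀ φ, y φ = 0 → x φ = 0 := by
    intro φ hy
    refine (ZMod.two_eq_zero_or_one _).resolve_right fun hx => ?_
    rw [hx1] at hx
    simp only [y, hx.1, one_mul] at hy
    by_cases hd : hm.dartAt (M.vert φ) = hm'.dartAt (M.vert φ)
    · have : a φ = 1 ↔ a' φ = 1 := by rw [ha1, ha1', hd]
      rcases hx.2 with h5 | h5
      · rw [h5.1, h5.2] at this; exact zero_ne_one (this.1 rfl)
      · rw [h5.1, h5.2] at this; exact zero_ne_one (this.2 rfl)
    · rw [if_neg hd] at hy; exact one_ne_zero hy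
  have hdiff : ∀ v i, hm.dartAt v ≠ hm'.dartAt v → β v + i + 1 = 1 →
      ∃ φ, M.vert φ = v ∧ c φ = i ∧ x φ = 1 := by
    intro v i hd hk
    obtain ⟨φ, hφ, hcφ⟩ := M.exists_flag hc2 (hm.dartAt v) i
    have hv : M.vert φ = v := by rw [vert, hφ, hm.src_dartAt]
    refine ⟨φ, hv, hcφ, ?_⟩
    rw [hx1]
    refine ⟨by simp only [k, hv, hcφ]; exact hk, Or.inl ⟨by rw [ha1, hv, hφ], ?_⟩⟩
    refine (ZMod.two_eq_zero_or_one _).resolve_right fun h1 => hd ?_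
    rw [ha1', hv, hφ] at h1
    exact h1.symm
  have hy1 : ∀ φ, y φ = 1 → ∃ ψ, M.rot.SameCycle φ ψ ∧ x ψ = 1 := by
    intro φ hy
    by_cases hd : hm.dartAt (M.vert φ) = hm'.dartAt (M.vert φ)
    · simp [y, if_pos hd] at hy
    · simp only [y, if_neg hd, mul_one] at hy
      obtain ⟨ψ, hψ1, hψ2, hψ3⟩ := hdiff _ (c φ) hd hy
      exact ⟨ψ, (hsc φ ψ).2 ⟨hψ1.symm, hψ2.symm⟩, hψ3⟩
  have hry : ∀ φ, a φ = 1 → y (M.flip φ) = y φ := by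
    intro φ hφ
    have hiff : hm.dartAt (M.vert (M.flip φ)) = hm'.dartAt (M.vert (M.flip φ)) ↔
        hm.dartAt (M.vert φ) = hm'.dartAt (M.vert φ) := by
      rw [(ha1 φ).1 hφ, (ha1 (M.flip φ)).1 (by rw [haα, hφ]), eq_comm (a := M.dart (M.flip φ)),
        eq_comm (a := M.dart φ), ← ha1', ← ha1', haα']
    simp only [y, hkα φ (Or.inl hφ), hiff]
  have hind : ∀ φ, o.ind (M.dart (M.flip φ)) = o.ind (M.dart φ) + 1 := fun φ => by
    rw [dart_flip, o.ind_rev]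
  have hsσ := face_function_rot M.flip_flip hs hxs
  have hsδ := face_function_partner hsσ huniq
  have hsα : ∀ φ, s (M.flip φ) = s φ + x φ := fun φ => by
    rw [hxs, ← add_assoc, ZMod.two_add_self, zero_add]
  -- two steps of the walk along the boundary
  have hstep : ∀ φ, s φ = 1 → x φ = 1 → s ((δ * M.flip) φ) = 1 ∧ x ((δ * M.flip) φ) = 1 ∧
      c ((δ * M.flip) φ) = c φ + 1 ∧
      (a φ = 1 → a ((δ * M.flip) φ) = 0 ∧ M.vert ((δ * M.flip) φ) = hm.mate (M.vert φ)) ∧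
      (a φ = 0 → a ((δ * M.flip) φ) = 1 ∧ M.vert ((δ * M.flip) φ) = hm'.mate (M.vert φ)) := by
    intro φ hsφ hxφ
    have hx' : x (M.flip φ) = 1 := by rw [hxα, hxφ]
    simp only [Equiv.Perm.mul_apply]
    refine ⟨?_, by rw [hδx, hx'], by rw [hδc, hcα], fun h1 => ⟨?_, ?_⟩, fun h1 => ⟨?_, ?_⟩⟩
    · rw [hsδ _ hx', hsα, hsφ, hxφ]; decide
    · rw [hδ1 _ hx']; exact (hfl_a _ hx' (by rw [haα, h1])).1
    · rw [hδv, M.vert_flip_of_matchInd hm h1]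
    · rw [hδ1 _ hx']; exact (hfl_a' _ hx' (by rw [haα, h1])).1
    · have h2 : a' φ = 1 := by
        rcases ((hx1 φ).1 hxφ).2 with h5 | h5
        · rw [h1] at h5; exact absurd h5.1 zero_ne_one
        · exact h5.2
      rw [hδv, M.vert_flip_of_matchInd hm' h2]
  have hstep2 : ∀ φ, (s φ * x φ = 1 ∧ c φ = 1) →
      (s ((δ * M.flip * (δ * M.flip)) φ) * x ((δ * M.flip * (δ * M.flip)) φ) = 1 ∧
        c ((δ * M.flip * (δ * M.flip)) φ) = 1) ∧
      (a φ = 1 → a ((δ * M.flip * (δ * M.flip)) φ) = 1 ∧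
        M.vert ((δ * M.flip * (δ * M.flip)) φ) = hm'.mate (hm.mate (M.vert φ))) ∧
      (a φ = 0 → a ((δ * M.flip * (δ * M.flip)) φ) = 0 ∧
        M.vert ((δ * M.flip * (δ * M.flip)) φ) = hm.mate (hm'.mate (M.vert φ))) := by
    rintro φ ⟨h1, h2⟩
    have hsφ : s φ = 1 := by
      revert h1; generalize s φ = u, x φ = v; revert u v; decide
    have hxφ : x φ = 1 := by
      revert h1; generalize s φ = u, x φ = v; revert u v; decide
    obtain ⟨p1, p2, p3, p4, p5⟩ := hstep φ hsφ hxφ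
    obtain ⟨q1, q2, q3, q4, q5⟩ := hstep _ p1 p2
    rw [Equiv.Perm.mul_apply (δ * M.flip) (δ * M.flip)]
    refine ⟨⟨by rw [q1, q2, one_mul], by rw [q3, p3, h2]; decide⟩, fun h3 => ?_, fun h3 => ?_⟩
    · obtain ⟨r1, r2⟩ := q5 (p4 h3).1
      exact ⟨r1, by rw [r2, (p4 h3).2]⟩
    · obtain ⟨r1, r2⟩ := q4 (p5 h3).1
      exact ⟨r1, by rw [r2, (p5 h3).2]⟩
  have hδcyc : ∀ φ, M.rot.SameCycle φ (δ φ) := fun φ =>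
    (hsc _ _).2 ⟨(hδv φ).symm, (hδc φ).symm⟩
  have hsx : ∀ φ, s ((δ * M.flip) φ) * x ((δ * M.flip) φ) = s φ * x φ := by
    intro φ
    rw [Equiv.Perm.mul_apply, hδx, hxα]
    rcases ZMod.two_eq_zero_or_one (x φ) with hx | hx
    · rw [hx, mul_zero, mul_zero]
    · rw [hsδ _ (by rw [hxα, hx]), hsα, hx, add_assoc, ZMod.two_add_self, add_zero]
  have hcκ : ∀ φ, c ((δ * M.flip) φ) = c φ + 1 := fun φ => by
    rw [Equiv.Perm.mul_apply, hδc, hcα]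
  have h2 : ∀ φ, (s ((δ * M.flip * (δ * M.flip)) φ) * x ((δ * M.flip * (δ * M.flip)) φ) = 1
      ∧ c ((δ * M.flip * (δ * M.flip)) φ) = 1) ↔ (s φ * x φ = 1 ∧ c φ = 1) := by
    intro φ
    rw [Equiv.Perm.mul_apply (δ * M.flip) (δ * M.flip), hsx, hsx, hcκ, hcκ, add_assoc,
      ZMod.two_add_self, add_zero]
  have hwalk := sign_boundary_walk M.flip_flip hδ0 hδδ hδx hδcyc huniq hcσ hcα hs hxs hind
    (fun φ => by rw [rot_mul_flip]; exact M.cycleSum_next_of_isFlat ho φ)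
    (M.cycleSum_matchInd hc1 hc2 hm) haα hyσ hy0 hy1 hry h2
  -- Only flags of colour 0 count. There `k = 1 + β`, and each matching has exactly one such flag at
  -- every vertex.
  have hsum : ∑ φ, (1 + c φ) * (x φ * o.ind (M.dart φ))
      = ∑ v, (1 + β v) * (hm.tail o v + hm'.tail o v) := by
    simp only [mul_add (1 + β _), Finset.sum_add_distrib]
    rw [← M.sum_matchInd hc2 hm 0, ← M.sum_matchInd hc2 hm' 0, ← Finset.sum_add_distrib]
    refine Finset.sum_congr rfl fun φ _ => ?_
    simp only [x, k]
    rcases ZMod.two_eq_zero_or_one (c φ) with hc | hc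
    · rw [if_pos hc, if_pos hc, hc]
      simp only [a, a']
      ring
    · rw [hc, if_neg one_ne_zero, if_neg one_ne_zero, ZMod.two_add_self, zero_mul, add_zero]
  rw [← hsum, ← hwalk]
  -- comparison of the boundary walk with the permutation of the vertices
  set ρ := restr (hm'.mate * hm.mate) (fun v => β v = 1) h with hρ
  have hρ1 : ∀ v, β v = 1 → ρ v = hm'.mate (hm.mate v) := fun v hv =>
    restr_of (p := fun v => β v = 1) hv
  have hρ0 : ∀ v, β v ≠ 1 → ρ v = v := fun v hv => restr_of_not (p := fun v => β v = 1) hv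
  have hρ1' : ∀ v, β v = 1 → ρ⁻¹ v = hm.mate (hm'.mate v) := by
    intro v hv
    rw [Equiv.Perm.inv_eq_iff_eq, hρ1, hm.mate_mate, hm'.mate_mate]
    rw [hβ, hβ', hv]; decide
  have hP : ∀ φ, (s φ * x φ = 1 ∧ c φ = 1) → s φ = 1 ∧ x φ = 1 ∧ β (M.vert φ) = 1 := by
    rintro φ ⟨h1, hc⟩
    have hsφ : s φ = 1 := by
      revert h1; generalize s φ = u, x φ = v; revert u v; decide
    have hxφ : x φ = 1 := by
      revert h1; generalize s φ = u, x φ = v; revert u v; decide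
    refine ⟨hsφ, hxφ, ?_⟩
    have := ((hx1 φ).1 hxφ).1
    simp only [k, hc] at this
    revert this; generalize β (M.vert φ) = u; revert u; decide
  have hPuniq : ∀ φ ψ, (s φ * x φ = 1 ∧ c φ = 1) → (s ψ * x ψ = 1 ∧ c ψ = 1) →
      M.vert φ = M.vert ψ → φ = ψ := by
    intro φ ψ hφ hψ hv
    rcases huniq φ ψ (hP φ hφ).2.1 (hP ψ hψ).2.1 ((hsc _ _).2 ⟨hv, by rw [hφ.2, hψ.2]⟩) with h | h
    · exact h.symm
    · have := hsδ φ (hP φ hφ).2.1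
      rw [← h, (hP φ hφ).1, (hP ψ hψ).1] at this
      exact absurd this (by decide)
  -- The face set fixes the direction in which each circuit is walked. From a vertex of colour 1 the
  -- first step follows `m`, as `ρ` does, or `m'`, as `ρ⁻¹` does. `b` marks the circuits of the
  -- first kind; inverting `ρ` elsewhere, at no cost in sign, makes it follow the walk everywhere.
  let b : V → Prop := fun v => ∃ φ, (s φ * x φ = 1 ∧ c φ = 1) ∧ M.vert φ = v ∧ a φ = 1
  have hb : ∀ v, b v → b (ρ v) := by
    rintro v ⟨φ, hφ, rfl, h1⟩
    obtain ⟨p1, p2, -⟩ := hstep2 φ hφ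
    exact ⟨_, p1, by rw [(p2 h1).2, hρ1 _ (hP φ hφ).2.2], (p2 h1).1⟩
  have hb' : ∀ v, b (ρ v) → b v := by
    intro v hv
    have hcyc : ρ.SameCycle (ρ v) v := Equiv.Perm.sameCycle_apply_left.2 (Equiv.Perm.SameCycle.refl _ _)
    obtain ⟨n, hn⟩ := hcyc.exists_nat_pow_eq
    rw [← hn]
    clear hn
    induction n with
    | zero => exact hv
    | succ n ih => rw [pow_succ', Equiv.Perm.mul_apply]; exact hb _ ih
  have hbinv : ∀ v, ¬ b (ρ⁻¹ v) ↔ ¬ b v := by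
    intro v
    have h1 := hb (ρ⁻¹ v)
    have h2 := hb' (ρ⁻¹ v)
    rw [show ρ (ρ⁻¹ v) = v by simp] at h1 h2
    exact not_congr ⟨h1, h2⟩
  rw [← sign_mul_restr_inv_sq ρ (fun v => ¬ b v) hbinv]
  set τ := restr ρ⁻¹ (fun v => ¬ b v) hbinv
  have hτ0 : ∀ v, b v → τ v = v := fun v hv =>
    restr_of_not (p := fun v => ¬ b v) (not_not.2 hv)
  have hτ1 : ∀ v, ¬ b v → τ v = ρ⁻¹ v := fun v hv => restr_of (p := fun v => ¬ b v) hv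
  have hg1 : ∀ v, b v → (ρ * (τ * τ)) v = ρ v := fun v hv => by
    rw [Equiv.Perm.mul_apply, Equiv.Perm.mul_apply, hτ0 v hv, hτ0 v hv]
  have hg0 : ∀ v, ¬ b v → (ρ * (τ * τ)) v = ρ⁻¹ v := fun v hv => by
    rw [Equiv.Perm.mul_apply, Equiv.Perm.mul_apply, hτ1 v hv, hτ1 _ ((hbinv v).2 hv)]
    simp
  have hK : ∀ φ, restr (δ * M.flip * (δ * M.flip)) (fun φ => s φ * x φ = 1 ∧ c φ = 1) h2 φ ≠ φ →
      s φ * x φ = 1 ∧ c φ = 1 := by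
    intro φ hφ
    by_contra h'
    exact hφ (restr_of_not (p := fun φ => s φ * x φ = 1 ∧ c φ = 1) h')
  have hKv : ∀ φ, (s φ * x φ = 1 ∧ c φ = 1) →
      M.vert (restr (δ * M.flip * (δ * M.flip)) (fun φ => s φ * x φ = 1 ∧ c φ = 1) h2 φ)
        = (ρ * (τ * τ)) (M.vert φ) := by
    intro φ hφ
    rw [restr_of (p := fun φ => s φ * x φ = 1 ∧ c φ = 1) hφ]
    obtain ⟨-, p2, p3⟩ := hstep2 φ hφ
    rcases ZMod.two_eq_zero_or_one (a φ) with h0 | h1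
    · rw [(p3 h0).2, hg0, hρ1' _ (hP φ hφ).2.2]
      rintro ⟨ψ, hψ, hv, h1⟩
      rw [← hPuniq φ ψ hφ hψ hv.symm, h0] at h1
      exact zero_ne_one h1
    · rw [(p2 h1).2, hg1 _ ⟨φ, hφ, rfl, h1⟩, hρ1 _ (hP φ hφ).2.2]
  symm
  -- Only moved points are compared: a circuit of two parallel edges consists of fixed points on
  -- both sides.
  refine Equiv.Perm.sign_bij (fun φ _ => M.vert φ) (fun φ hφ _ => hKv φ (hK φ hφ))
    (fun φ ψ hφ hψ hv => hPuniq φ ψ (hK φ hφ) (hK ψ hψ) hv) ?_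
  intro v hv
  have hβv : β v = 1 := by
    by_contra h'
    have e : ρ v = v := hρ0 v h'
    by_cases hbv : b v
    · exact hv (by rw [hg1 v hbv, e])
    · exact hv (by rw [hg0 v hbv, Equiv.Perm.inv_eq_iff_eq, e])
  have hd : hm.dartAt v ≠ hm'.dartAt v := by
    intro h'
    have hmm : hm.mate v = hm'.mate v := by rw [hm.mate_apply, hm'.mate_apply, h']
    by_cases hbv : b v
    · exact hv (by rw [hg1 v hbv, hρ1 v hβv, hmm, hm'.mate_mate])
    · exact hv (by rw [hg0 v hbv, hρ1' v hβv, ← hmm, hm.mate_mate])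
  -- Of the two boundary darts at the lift of `v`, one has `s = 1`.
  obtain ⟨φ, hφv, hφc, hφx⟩ := hdiff v 1 hd (by rw [hβv]; decide)
  obtain ⟨ψ, hψ, hψv⟩ : ∃ ψ, (s ψ * x ψ = 1 ∧ c ψ = 1) ∧ M.vert ψ = v := by
    rcases ZMod.two_eq_zero_or_one (s φ) with h0 | h1
    · refine ⟨δ φ, ⟨?_, by rw [hδc, hφc]⟩, by rw [hδv, hφv]⟩
      rw [hsδ φ hφx, h0, hδx, hφx]; decide
    · exact ⟨φ, ⟨by rw [h1, hφx, one_mul], hφc⟩, hφv⟩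
  refine ⟨ψ, fun h' => hv ?_, hψv⟩
  rw [← hψv, ← hKv ψ hψ, h']

end CellEmbedding

/-! ### Listings of the vertices along pairings -/

theorem evenPos_injective {k : ℕ} : Function.Injective (evenPos (k := k)) := by
  intro i j h
  have := congrArg Fin.val h
  simp only [evenPos] at this
  exact Fin.ext (by omega)

theorem oddPos_injective {k : ℕ} : Function.Injective (oddPos (k := k)) := by
  intro i j h
  have := congrArg Fin.val h
  simp only [oddPos] at this
  exact Fin.ext (by omega)

theorem evenPos_ne_oddPos {k : ℕ} (i j : Fin k) : evenPos i ≠ oddPos j := by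
  intro h
  have := congrArg Fin.val h
  simp only [evenPos, oddPos] at this
  omega

theorem eq_evenPos_or_oddPos {k : ℕ} (j : Fin (2 * k)) : ∃ i, j = evenPos i ∨ j = oddPos i := by
  refine ⟨⟨j.1 / 2, by omega⟩, ?_⟩
  rcases Nat.even_or_odd' j.1 with ⟨i, h | h⟩
  · left; exact Fin.ext (by simp only [evenPos]; omega)
  · right; exact Fin.ext (by simp only [oddPos]; omega)

section listing

variable {V : Type*} {k : ℕ}

/-- `ℓ` lists the pairs of the involution `μ`, each pair starting with its tail. -/
def IsListing (μ : V → V) (T : V → ZMod 2) (ℓ : Fin (2 * k) ≃ V) : Prop :=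
  ∀ i, μ (ℓ (evenPos i)) = ℓ (oddPos i) ∧ T (ℓ (evenPos i)) = 1

namespace IsListing

variable {μ μ' : Equiv.Perm V} {T T' : V → ZMod 2} {ℓ ℓ' : Fin (2 * k) ≃ V}

theorem tail_odd (h : IsListing μ T ℓ) (hT : ∀ v, T (μ v) = T v + 1) (i : Fin k) :
    T (ℓ (oddPos i)) = 0 := by
  rw [← (h i).1, hT, (h i).2]; rfl

theorem apply_odd (h : IsListing μ T ℓ) (hμ : ∀ v, μ (μ v) = v) (i : Fin k) :
    μ (ℓ (oddPos i)) = ℓ (evenPos i) := by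
  rw [← (h i).1, hμ]

theorem intertwines (h : IsListing μ T ℓ) (h' : IsListing μ' T' ℓ') (hμ : ∀ v, μ (μ v) = v)
    (hμ' : ∀ v, μ' (μ' v) = v) (v : V) :
    (ℓ.symm.trans ℓ') (μ v) = μ' ((ℓ.symm.trans ℓ') v) := by
  obtain ⟨j, rfl⟩ := ℓ.surjective v
  obtain ⟨i, rfl | rfl⟩ := eq_evenPos_or_oddPos j
  · rw [(h i).1]; simp [(h' i).1]
  · rw [h.apply_odd hμ]; simp [h'.apply_odd hμ']

theorem tail_comp (h : IsListing μ T ℓ) (h' : IsListing μ' T' ℓ') (hT : ∀ v, T (μ v) = T v + 1)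
    (hT' : ∀ v, T' (μ' v) = T' v + 1) (v : V) : T' ((ℓ.symm.trans ℓ') v) = T v := by
  obtain ⟨j, rfl⟩ := ℓ.surjective v
  obtain ⟨i, rfl | rfl⟩ := eq_evenPos_or_oddPos j
  · simp [(h i).2, (h' i).2]
  · simp [h.tail_odd hT, h'.tail_odd hT']

end IsListing

variable [Fintype V] [DecidableEq V]

theorem sign_trans_symm (ℓ ℓ' ord : Fin (2 * k) ≃ V) :
    Equiv.Perm.sign (ℓ'.trans ord.symm)
      = Equiv.Perm.sign (ℓ.symm.trans ℓ') * Equiv.Perm.sign (ℓ.trans ord.symm) := by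
  rw [← Equiv.Perm.sign_symm_trans_trans (ℓ.symm.trans ℓ') ord.symm, ← Equiv.Perm.sign_mul]
  congr 1
  ext j
  simp

omit [DecidableEq V] in
theorem card_tails {μ : Equiv.Perm V} {T : V → ZMod 2} (hT : ∀ v, T (μ v) = T v + 1)
    (ord : Fin (2 * k) ≃ V) : (Finset.univ.filter fun v => T v = 1).card = k := by
  have h1 : (Finset.univ.filter fun v => T v = 1).card
      = (Finset.univ.filter fun v => ¬ T v = 1).card := by
    refine Finset.card_bij (fun v _ => μ v) ?_ (fun _ _ _ _ h => μ.injective h) ?_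
    · intro v hv
      simp only [Finset.mem_filter, Finset.mem_univ, true_and] at hv ⊢
      rw [hT, hv]; decide
    · intro v hv
      simp only [Finset.mem_filter, Finset.mem_univ, true_and] at hv
      refine ⟨μ.symm v, ?_, by simp⟩
      simp only [Finset.mem_filter, Finset.mem_univ, true_and]
      have := hT (μ.symm v)
      rw [Equiv.apply_symm_apply] at this
      rw [this] at hv
      revert hv; generalize T (μ.symm v) = u; revert u; decide
  have h2 := Finset.card_filter_add_card_filter_not (s := (Finset.univ : Finset V))
    (fun v => T v = 1)
  have h3 := Fintype.card_congr ord
  rw [Fintype.card_fin] at h3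
  rw [Finset.card_univ] at h2
  omega

omit [DecidableEq V] in
theorem exists_listing_of_enumeration {μ : Equiv.Perm V} {T : V → ZMod 2}
    (hT : ∀ v, T (μ v) = T v + 1) (ord : Fin (2 * k) ≃ V) (a : Fin k → V)
    (ha : Function.Injective a) (haT : ∀ i, T (a i) = 1) :
    ∃ ℓ : Fin (2 * k) ≃ V, IsListing μ T ℓ ∧ ∀ i, ℓ (evenPos i) = a i := by
  let f : Fin (2 * k) → V := fun j =>
    if Even j.1 then a ⟨j.1 / 2, by omega⟩ else μ (a ⟨j.1 / 2, by omega⟩)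
  have hf1 : ∀ i, f (evenPos i) = a i := by
    intro i
    have : (⟨2 * i.1 / 2, by omega⟩ : Fin k) = i := Fin.ext (by simp)
    simp [f, evenPos]
  have hf2 : ∀ i, f (oddPos i) = μ (a i) := by
    intro i
    have : (⟨(2 * i.1 + 1) / 2, by omega⟩ : Fin k) = i := Fin.ext (by simp; omega)
    simp only [f, oddPos, this]
    rw [if_neg]
    rw [Nat.not_even_iff_odd]; exact ⟨i, rfl⟩
  have hne : ∀ i j, a i ≠ μ (a j) := by
    intro i j h
    have := hT (a j)
    rw [← h, haT, haT] at this
    exact absurd this (by decide)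
  have hinj : Function.Injective f := by
    intro j j' h
    obtain ⟨i, rfl | rfl⟩ := eq_evenPos_or_oddPos j <;>
      obtain ⟨i', rfl | rfl⟩ := eq_evenPos_or_oddPos j'
    · rw [hf1, hf1] at h; rw [ha h]
    · rw [hf1, hf2] at h; exact absurd h (hne _ _)
    · rw [hf1, hf2] at h; exact absurd h.symm (hne _ _)
    · rw [hf2, hf2] at h; rw [ha (μ.injective h)]
  have hbij := (Fintype.bijective_iff_injective_and_card f).2 ⟨hinj, Fintype.card_congr ord⟩
  refine ⟨Equiv.ofBijective f hbij, fun i => ?_, hf1⟩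
  simp only [Equiv.ofBijective_apply, hf1, hf2]
  exact ⟨trivial, haT i⟩

omit [DecidableEq V] in
theorem exists_listing {μ : Equiv.Perm V} {T : V → ZMod 2} (hT : ∀ v, T (μ v) = T v + 1)
    (ord : Fin (2 * k) ≃ V) : ∃ ℓ : Fin (2 * k) ≃ V, IsListing μ T ℓ := by
  have e := (Finset.univ.filter fun v => T v = 1).equivFinOfCardEq (card_tails hT ord)
  obtain ⟨ℓ, hℓ, -⟩ := exists_listing_of_enumeration hT ord (fun i => (e.symm i : V))
    (fun i j h => e.symm.injective (Subtype.ext h))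
    (fun i => (Finset.mem_filter.1 (e.symm i).2).2)
  exact ⟨ℓ, hℓ⟩

end listing

/-! ### The terms of the Pfaffian. -/

namespace Multigraph

variable {V D : Type*} {Z : Multigraph V D} {o : Z.Orientation}

theorem IsPerfectMatching.lists_iff {m : Set D} (hm : Z.IsPerfectMatching m) {k : ℕ}
    (ℓ : Fin (2 * k) ≃ V) : Z.Lists o m ℓ ↔ IsListing hm.mate (hm.tail o) ℓ := by
  refine forall_congr' fun i => ?_
  constructor
  · rintro ⟨d, ⟨hdm, hdo⟩, h1, h2⟩
    have hd := hm.dartAt_src hdm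
    rw [h1] at hd
    refine ⟨by rw [hm.mate_apply, hd, h2], ?_⟩
    rw [tail, hd, o.ind_eq_one_iff]; exact hdo
  · rintro ⟨h1, h2⟩
    exact ⟨_, ⟨hm.dartAt_mem _, (o.ind_eq_one_iff _).1 h2⟩, hm.src_dartAt _, h1⟩

/-- All terms of the Pfaffian agree if every two listings along perfect matchings are related by an
even permutation. -/
theorem isPfaffianOrientation_of_sign [Finite V]
    (h : ∀ [Fintype V] [DecidableEq V] (m m' : Set D) (hm : Z.IsPerfectMatching m)
      (hm' : Z.IsPerfectMatching m') (π : Equiv.Perm V), (∀ v, π (hm.mate v) = hm'.mate (π v)) →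
      (∀ v, hm'.tail o (π v) = hm.tail o v) → Equiv.Perm.sign π = 1) :
    Z.IsPfaffianOrientation o := by
  classical
  have := Fintype.ofFinite V
  intro k ord
  have key : ∀ (m m' : Set D) (hm : Z.IsPerfectMatching m) (hm' : Z.IsPerfectMatching m')
      (ℓ ℓ' : Fin (2 * k) ≃ V), IsListing hm.mate (hm.tail o) ℓ →
      IsListing hm'.mate (hm'.tail o) ℓ' →
      Equiv.Perm.sign (ℓ'.trans ord.symm) = Equiv.Perm.sign (ℓ.trans ord.symm) := by
    intro m m' hm hm' ℓ ℓ' hℓ hℓ'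
    rw [sign_trans_symm ℓ ℓ' ord, h m m' hm hm' (ℓ.symm.trans ℓ')
      (hℓ.intertwines hℓ' hm.mate_mate hm'.mate_mate)
      (hℓ.tail_comp hℓ' (hm.tail_mate o) (hm'.tail_mate o)), one_mul]
  by_cases hex : ∃ m, Z.IsPerfectMatching m
  · obtain ⟨m₀, hm₀⟩ := hex
    obtain ⟨ℓ₀, hℓ₀⟩ := exists_listing (hm₀.tail_mate o) ord
    refine ⟨Equiv.Perm.sign (ℓ₀.trans ord.symm), fun m hm => ⟨?_, fun ℓ hℓ => ?_⟩⟩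
    · obtain ⟨ℓ, hℓ⟩ := exists_listing (hm.tail_mate o) ord
      exact ⟨ℓ, (hm.lists_iff ℓ).2 hℓ⟩
    · exact key m₀ m hm₀ hm ℓ₀ ℓ hℓ₀ ((hm.lists_iff ℓ).1 hℓ)
  · exact ⟨1, fun m hm => absurd ⟨m, hm⟩ hex⟩

/-! ### The expansion of the Pfaffian -/

section expansion

variable [Fintype D] [DecidableEq V]

open Classical in
-- Summing over darts gives each edge one signed summand. A self-loop contributes both of its darts,
-- which cancel.
theorem adjMatrix_apply (v w : V) :
    Z.adjMatrix o v w
      = ∑ d ∈ Finset.univ.filter (fun d => Z.src d = v ∧ Z.tgt d = w),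
          ((zsign (1 + o.ind d) : ℤˣ) : ℤ) := by
  have h1 : ∀ d, ((zsign (1 + o.ind d) : ℤˣ) : ℤ)
      = (if d ∈ o.darts then 1 else 0) - (if Z.rev d ∈ o.darts then 1 else 0) := by
    intro d
    by_cases h : d ∈ o.darts
    · have h' := (o.mem_iff d).1 h
      rw [if_pos h, if_neg h', (o.ind_eq_one_iff d).2 h, ZMod.two_add_self]; rfl
    · have h' : Z.rev d ∈ o.darts := by by_contra h'; exact h ((o.mem_iff d).2 h')
      have h0 : o.ind d = 0 :=
        (ZMod.two_eq_zero_or_one _).resolve_right fun h1 => h ((o.ind_eq_one_iff d).1 h1)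
      rw [if_neg h, if_pos h', h0]; rfl
  simp only [h1, Finset.sum_sub_distrib]
  rw [← Finset.sum_filter, ← Finset.sum_filter, Finset.sum_const, Finset.sum_const,
    Finset.filter_filter, Finset.filter_filter, adjMatrix, Matrix.of_apply]
  simp only [nsmul_eq_mul, mul_one]
  congr 2
  · rw [Set.ncard_eq_toFinset_card']
    congr 1
    ext d
    simp only [Set.mem_toFinset, Finset.mem_filter, Finset.mem_univ, true_and, Set.mem_ofPred_eq]
    tauto
  · rw [Set.ncard_eq_toFinset_card']
    refine Finset.card_bij (fun d _ => Z.rev d) ?_ (fun _ _ _ _ h => Z.rev.injective h) ?_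
    · intro d hd
      simp only [Set.mem_toFinset, Finset.mem_filter, Finset.mem_univ, true_and, Set.mem_ofPred_eq]
        at hd ⊢
      rw [Z.rev_rev, src_rev, tgt_rev]
      exact ⟨⟨hd.2.2, hd.2.1⟩, hd.1⟩
    · intro d hd
      simp only [Set.mem_toFinset, Finset.mem_filter, Finset.mem_univ, true_and, Set.mem_ofPred_eq]
        at hd ⊢
      refine ⟨Z.rev d, ?_, Z.rev_rev d⟩
      rw [src_rev, tgt_rev]
      exact ⟨hd.2, hd.1.2, hd.1.1⟩

open Classical in
/-- The summands of the expanded Pfaffian: a normalized permutation, and a dart for each of its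
pairs. -/
noncomputable def pfIndex (Z : Multigraph V D) {k : ℕ} (ord : Fin (2 * k) ≃ V) :
    Finset (Σ _ : Equiv.Perm (Fin (2 * k)), Fin k → D) :=
  (Finset.univ.filter (fun σ : Equiv.Perm (Fin (2 * k)) =>
      (∀ i : Fin k, σ (evenPos i) < σ (oddPos i)) ∧
        ∀ i j : Fin k, i < j → σ (evenPos i) < σ (evenPos j))).sigma fun σ =>
    Fintype.piFinset fun i => Finset.univ.filter fun d =>
      Z.src d = ord (σ (evenPos i)) ∧ Z.tgt d = ord (σ (oddPos i))

theorem mem_pfIndex {k : ℕ} {ord : Fin (2 * k) ≃ V}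
    {p : Σ _ : Equiv.Perm (Fin (2 * k)), Fin k → D} :
    p ∈ Z.pfIndex ord ↔ ((∀ i : Fin k, p.1 (evenPos i) < p.1 (oddPos i)) ∧
        ∀ i j : Fin k, i < j → p.1 (evenPos i) < p.1 (evenPos j)) ∧
      ∀ i, Z.src (p.2 i) = ord (p.1 (evenPos i)) ∧ Z.tgt (p.2 i) = ord (p.1 (oddPos i)) := by
  simp [pfIndex, Fintype.mem_piFinset]

theorem pf_eq_sum {k : ℕ} (ord : Fin (2 * k) ≃ V) :
    Z.pf o ord = ∑ p ∈ Z.pfIndex ord,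
      ((Equiv.Perm.sign p.1 * zsign (∑ i, (1 + o.ind (p.2 i))) : ℤˣ) : ℤ) := by
  classical
  rw [pf, pfaffian, pfIndex, Finset.sum_sigma]
  refine Finset.sum_congr rfl fun σ _ => ?_
  simp only [Matrix.submatrix_apply, adjMatrix_apply]
  rw [Finset.prod_univ_sum, Finset.mul_sum]
  refine Finset.sum_congr ?_ fun f _ => ?_
  · congr
  · rw [zsign_sum]
    simp

/-- The perfect matching of a summand of the expanded Pfaffian. -/
def pfMatching (Z : Multigraph V D) {k : ℕ} (f : Fin k → D) : Set D :=
  {d | ∃ i, d = f i ∨ d = Z.rev (f i)}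

theorem isPerfectMatching_pfMatching {k : ℕ} {ord : Fin (2 * k) ≃ V}
    {p : Σ _ : Equiv.Perm (Fin (2 * k)), Fin k → D} (hp : p ∈ Z.pfIndex ord) :
    Z.IsPerfectMatching (Z.pfMatching p.2) := by
  rw [mem_pfIndex] at hp
  have hp2 := hp.2
  constructor
  · rintro d ⟨i, rfl | rfl⟩
    · exact ⟨i, Or.inr rfl⟩
    · exact ⟨i, Or.inl (Z.rev_rev _)⟩
  · intro v
    obtain ⟨j, rfl⟩ := (p.1.trans ord).surjective v
    simp only [Equiv.trans_apply]
    obtain ⟨i, rfl | rfl⟩ := eq_evenPos_or_oddPos j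
    · refine ⟨p.2 i, ⟨⟨i, Or.inl rfl⟩, (hp2 i).1⟩, ?_⟩
      rintro d ⟨⟨i', rfl | rfl⟩, hd⟩
      · rw [(hp2 i').1] at hd
        rw [evenPos_injective (p.1.injective (ord.injective hd))]
      · rw [src_rev, (hp2 i').2] at hd
        exact absurd (p.1.injective (ord.injective hd)).symm (evenPos_ne_oddPos _ _)
    · refine ⟨Z.rev (p.2 i), ⟨⟨i, Or.inr rfl⟩, (hp2 i).2⟩, ?_⟩
      rintro d ⟨⟨i', rfl | rfl⟩, hd⟩
      · rw [(hp2 i').1] at hd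
        exact absurd (p.1.injective (ord.injective hd)) (evenPos_ne_oddPos _ _)
      · rw [src_rev, (hp2 i').2] at hd
        rw [oddPos_injective (p.1.injective (ord.injective hd))]

variable {k : ℕ} {ord : Fin (2 * k) ≃ V} {m : Set D} (hm : Z.IsPerfectMatching m)

/-- The indicator of the lower ends of the edges of a matching. -/
noncomputable def IsPerfectMatching.lower (ord : Fin (2 * k) ≃ V) (v : V) : ZMod 2 :=
  if ord.symm v < ord.symm (hm.mate v) then 1 else 0

omit [Fintype D] [DecidableEq V] in
theorem IsPerfectMatching.lower_eq_one_iff (v : V) :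
    hm.lower ord v = 1 ↔ ord.symm v < ord.symm (hm.mate v) := by
  by_cases h : ord.symm v < ord.symm (hm.mate v) <;> simp [lower, h]

omit [Fintype D] [DecidableEq V] in
theorem IsPerfectMatching.lower_mate (v : V) :
    hm.lower ord (hm.mate v) = hm.lower ord v + 1 := by
  have hne : ord.symm v ≠ ord.symm (hm.mate v) := fun h =>
    hm.mate_ne v (ord.symm.injective h).symm
  unfold lower
  rw [hm.mate_mate]
  rcases lt_or_gt_of_ne hne with h | h
  · rw [if_pos h, if_neg (not_lt_of_gt h)]; rfl
  · rw [if_neg (not_lt_of_gt h), if_pos h]; rfl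

theorem dartAt_of_mem_pfIndex {p : Σ _ : Equiv.Perm (Fin (2 * k)), Fin k → D}
    (hp : p ∈ Z.pfIndex ord) (hpm : Z.pfMatching p.2 = m) (i : Fin k) :
    hm.dartAt (ord (p.1 (evenPos i))) = p.2 i := by
  have h1 : p.2 i ∈ m := by rw [← hpm]; exact ⟨i, Or.inl rfl⟩
  rw [← ((mem_pfIndex.1 hp).2 i).1, hm.dartAt_src h1]

theorem isListing_of_mem_pfIndex {p : Σ _ : Equiv.Perm (Fin (2 * k)), Fin k → D}
    (hp : p ∈ Z.pfIndex ord) (hpm : Z.pfMatching p.2 = m) :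
    IsListing hm.mate (hm.lower ord) (p.1.trans ord) := by
  intro i
  have h1 : hm.mate (ord (p.1 (evenPos i))) = ord (p.1 (oddPos i)) := by
    rw [hm.mate_apply, dartAt_of_mem_pfIndex hm hp hpm, ((mem_pfIndex.1 hp).2 i).2]
  refine ⟨h1, ?_⟩
  rw [hm.lower_eq_one_iff, Equiv.trans_apply, h1]
  simpa using (mem_pfIndex.1 hp).1.1 i

include hm in
-- The listings by tails and by lower ends differ by exchanging the ends of the edges that point
-- downwards. These are also the edges that contribute a factor `-1` to the product of matrix
-- entries.
theorem term_of_mem_pfIndex [Fintype V] {s : ℤˣ} (hs : Z.HasTerm o ord m s)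
    {p : Σ _ : Equiv.Perm (Fin (2 * k)), Fin k → D} (hp : p ∈ Z.pfIndex ord)
    (hpm : Z.pfMatching p.2 = m) :
    Equiv.Perm.sign p.1 * zsign (∑ i, (1 + o.ind (p.2 i))) = s := by
  obtain ⟨⟨ℓ, hℓ⟩, hall⟩ := hs
  have hs := hall ℓ hℓ
  rw [hm.lists_iff] at hℓ
  have hlist := isListing_of_mem_pfIndex hm hp hpm
  have h1 := sign_trans_symm ℓ (p.1.trans ord) ord
  have h2 : (p.1.trans ord).trans ord.symm = p.1 := by ext; simp
  rw [h2, hs, sign_pairing_self hm.mate_mate (hm.tail_mate o) hm.lower_mate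
    (hℓ.intertwines hlist hm.mate_mate hm.mate_mate)
    (hℓ.tail_comp hlist (hm.tail_mate o) hm.lower_mate)] at h1
  have h3 : ∑ v, (1 + hm.lower ord v) * hm.tail o v
      = ∑ v, hm.lower ord v * (1 + hm.tail o v) := by
    rw [← Equiv.sum_comp hm.mate]
    refine Finset.sum_congr rfl fun v _ => ?_
    rw [hm.lower_mate, hm.tail_mate]
    generalize hm.lower ord v = x, hm.tail o v = y
    revert x y; decide
  have h4 : ∑ i, (1 + o.ind (p.2 i)) = ∑ v, hm.lower ord v * (1 + hm.tail o v) := by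
    refine Finset.sum_of_injOn (fun i => ord (p.1 (evenPos i)))
      (fun i _ j _ h => evenPos_injective (p.1.injective (ord.injective h)))
      (fun _ _ => Finset.mem_univ _) ?_ ?_
    · intro v _ hv
      obtain ⟨j, rfl⟩ := (p.1.trans ord).surjective v
      obtain ⟨i, rfl | rfl⟩ := eq_evenPos_or_oddPos j
      · exact absurd ⟨i, by simp, rfl⟩ hv
      · rw [hlist.tail_odd hm.lower_mate, zero_mul]
    · intro i _
      have := (hlist i).2
      rw [Equiv.trans_apply] at this
      rw [this, one_mul, IsPerfectMatching.tail, dartAt_of_mem_pfIndex hm hp hpm]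
  rw [h1, h3, h4, mul_assoc, mul_comm s, ← mul_assoc, zsign_mul_self, one_mul]

/-- The matching determines the set of lower ends, normalization their increasing order, and the
mates and darts follow. -/
theorem pfIndex_injective {p q : Σ _ : Equiv.Perm (Fin (2 * k)), Fin k → D}
    (hp : p ∈ Z.pfIndex ord) (hq : q ∈ Z.pfIndex ord)
    (hpq : Z.pfMatching p.2 = Z.pfMatching q.2) : p = q := by
  have hm := isPerfectMatching_pfMatching hq
  have hlp := isListing_of_mem_pfIndex hm hp hpq
  have hlq := isListing_of_mem_pfIndex hm hq rfl
  have hrange : ∀ r : Σ _ : Equiv.Perm (Fin (2 * k)), Fin k → D,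
      IsListing hm.mate (hm.lower ord) (r.1.trans ord) →
      Set.range (fun i => r.1 (evenPos i)) = {j | hm.lower ord (ord j) = 1} := by
    intro r hr
    ext j
    simp only [Set.mem_range, Set.mem_ofPred_eq]
    constructor
    · rintro ⟨i, rfl⟩; exact (hr i).2
    · intro hj
      obtain ⟨j, rfl⟩ := r.1.surjective j
      obtain ⟨i, rfl | rfl⟩ := eq_evenPos_or_oddPos j
      · exact ⟨i, rfl⟩
      · have := hr.tail_odd hm.lower_mate i
        rw [Equiv.trans_apply, hj] at this
        exact absurd this one_ne_zero
  have hmp : StrictMono fun i => p.1 (evenPos i) := fun i j h => (mem_pfIndex.1 hp).1.2 i j h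
  have hmq : StrictMono fun i => q.1 (evenPos i) := fun i j h => (mem_pfIndex.1 hq).1.2 i j h
  have heven := (hmp.range_inj hmq).1 ((hrange p hlp).trans (hrange q hlq).symm)
  have heven' : ∀ i, p.1 (evenPos i) = q.1 (evenPos i) := congrFun heven
  have hσ : p.1 = q.1 := by
    ext j
    congr 1
    obtain ⟨i, rfl | rfl⟩ := eq_evenPos_or_oddPos j
    · exact heven' i
    · have h1 := (hlp i).1
      have h2 := (hlq i).1
      simp only [Equiv.trans_apply] at h1 h2
      rw [heven', h2] at h1
      exact (ord.injective h1).symm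
  have hf : p.2 = q.2 := by
    ext i
    rw [← dartAt_of_mem_pfIndex hm hp hpq, ← dartAt_of_mem_pfIndex hm hq rfl, heven']
  exact Sigma.ext hσ (heq_of_eq hf)

theorem exists_mem_pfIndex [Fintype V] (ord : Fin (2 * k) ≃ V) (hm : Z.IsPerfectMatching m) :
    ∃ p ∈ Z.pfIndex ord, Z.pfMatching p.2 = m := by
  classical
  let S : Finset (Fin (2 * k)) := Finset.univ.filter fun j => hm.lower ord (ord j) = 1
  have hS : S.card = k := by
    refine (Finset.card_bij (fun j _ => ord j) (fun j hj => ?_)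
      (fun _ _ _ _ h => ord.injective h) ?_).trans
      (card_tails (T := hm.lower ord) (μ := hm.mate) hm.lower_mate ord)
    · simpa [S] using hj
    · intro v hv
      exact ⟨ord.symm v, by simpa [S] using hv, by simp⟩
  let a := S.orderEmbOfFin hS
  have ha : ∀ i, hm.lower ord (ord (a i)) = 1 := fun i =>
    (Finset.mem_filter.1 (S.orderEmbOfFin_mem hS i)).2
  obtain ⟨ℓ, hℓ, hℓa⟩ := exists_listing_of_enumeration (μ := hm.mate) (T := hm.lower ord)
    hm.lower_mate ord (fun i => ord (a i)) (fun i j h => a.injective (ord.injective h)) ha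
  refine ⟨⟨ℓ.trans ord.symm, fun i => hm.dartAt (ord (a i))⟩, ?_, ?_⟩
  · rw [mem_pfIndex]
    simp only [Equiv.trans_apply, hℓa, Equiv.symm_apply_apply, Equiv.apply_symm_apply]
    refine ⟨⟨fun i => ?_, fun i j h => a.strictMono h⟩, fun i => ⟨hm.src_dartAt _, ?_⟩⟩
    · have := ha i
      rw [hm.lower_eq_one_iff, Equiv.symm_apply_apply, ← hℓa, (hℓ i).1] at this
      exact this
    · rw [← hm.mate_apply, ← hℓa, (hℓ i).1]
  · ext d
    constructor
    · rintro ⟨i, rfl | rfl⟩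
      · exact hm.dartAt_mem _
      · exact hm.1 _ (hm.dartAt_mem _)
    · intro hd
      obtain ⟨j, hj⟩ := ℓ.surjective (Z.src d)
      obtain ⟨i, rfl | rfl⟩ := eq_evenPos_or_oddPos j
      · refine ⟨i, Or.inl ?_⟩
        change d = hm.dartAt (ord (a i))
        rw [← hℓa, hj, hm.dartAt_src hd]
      · refine ⟨i, Or.inr ?_⟩
        change d = Z.rev (hm.dartAt (ord (a i)))
        rw [← hℓa, ← hℓ.apply_odd hm.mate_mate, hj, hm.dartAt_mate, Z.rev_rev, hm.dartAt_src hd]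

end expansion

theorem abs_pf_eq [Finite V] [Finite D] (ho : Z.IsPfaffianOrientation o) {k : ℕ}
    (ord : Fin (2 * k) ≃ V) : |Z.pf o ord| = (Z.numPerfectMatchings : ℤ) := by
  classical
  have := Fintype.ofFinite V
  have := Fintype.ofFinite D
  obtain ⟨s, hs⟩ := ho k ord
  have hcard : (Z.pfIndex ord).card = Z.numPerfectMatchings := by
    rw [numPerfectMatchings, Set.ncard_eq_toFinset_card']
    refine Finset.card_bij (fun p _ => Z.pfMatching p.2) (fun p hp => ?_)
      (fun p hp q hq h => pfIndex_injective hp hq h) ?_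
    · simpa using isPerfectMatching_pfMatching hp
    · intro m hm
      obtain ⟨p, hp, hpm⟩ := exists_mem_pfIndex (m := m) ord (by simpa using hm)
      exact ⟨p, hp, hpm⟩
  rw [pf_eq_sum, Finset.sum_congr rfl fun p hp => by
    rw [term_of_mem_pfIndex (isPerfectMatching_pfMatching hp)
      (hs _ (isPerfectMatching_pfMatching hp)) hp rfl], Finset.sum_const, hcard, nsmul_eq_mul,
    abs_mul, Int.isUnit_iff_abs_eq.1 s.isUnit, mul_one, Nat.abs_cast]

end Multigraph

/-! ### Flat orientations of projective graphs -/

theorem card_eq_two_mul_card_filter {X : Type*} [DecidableEq X] (f : Equiv.Perm X) (S : Finset X)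
    (hS : ∀ a, f a ∈ S ↔ a ∈ S) (b : X → ZMod 2) (hb : ∀ a, b (f a) = b a + 1) :
    S.card = 2 * (S.filter fun a => b a = 1).card := by
  have h : (S.filter fun a => b a = 1).card = (S.filter fun a => ¬ b a = 1).card := by
    refine Finset.card_bij (fun a _ => f a) ?_ (fun _ _ _ _ h => f.injective h) ?_
    · intro a ha
      rw [Finset.mem_filter] at ha ⊢
      rw [hS, hb, ha.2]
      exact ⟨ha.1, by decide⟩
    · intro a ha
      rw [Finset.mem_filter] at ha
      refine ⟨f.symm a, ?_, f.apply_symm_apply a⟩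
      have h1 := hb (f.symm a)
      rw [f.apply_symm_apply] at h1
      rw [Finset.mem_filter, ← hS, f.apply_symm_apply]
      refine ⟨ha.1, ?_⟩
      have h2 := ha.2
      rw [h1] at h2
      revert h2
      generalize b (f.symm a) = x
      revert x; decide
  rw [← Finset.card_filter_add_card_filter_not (s := S) (fun a => b a = 1), ← h, two_mul]

theorem cycleSum_comp_self {X : Type*} [Fintype X] (f : Equiv.Perm X) (g : X → ZMod 2) (a : X) :
    cycleSum f (fun b => g (f b)) a = cycleSum f g a := by
  classical
  refine Finset.sum_bij (fun b _ => f b) (fun b hb => ?_) (fun _ _ _ _ h => f.injective h)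
    (fun b hb => ?_) (fun _ _ => rfl)
  · simpa using hb
  · refine ⟨f.symm b, ?_, f.apply_symm_apply b⟩
    simpa [← Equiv.Perm.inv_def] using hb

namespace Multigraph

theorem exists_orientation {V D : Type*} (Z : Multigraph V D) : Nonempty Z.Orientation := by
  obtain ⟨b, hb⟩ := exists_flip_of_involution Z.rev Z.rev_rev Z.rev_ne
  refine ⟨⟨{d | b d = 1}, fun d => ?_⟩⟩
  change b d = 1 ↔ ¬ b (Z.rev d) = 1
  rw [hb]
  generalize b d = x
  revert x; decide

end Multigraph

namespace CellEmbedding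

variable {V D Φ : Type*} {Z : Multigraph V D} (M : CellEmbedding Z Φ)

/-- A function of the flags that depends only on the dart and changes under reversal is an
orientation. -/
theorem exists_orientation_of_flags (o : Φ → ZMod 2) (h2 : ∀ φ, o (M.τ₂ φ) = o φ)
    (hα : ∀ φ, o (M.flip φ) = o φ + 1) :
    ∃ o' : Z.Orientation, ∀ φ, o'.ind (M.dart φ) = o φ := by
  have hdesc : ∀ φ ψ, M.dart φ = M.dart ψ → o φ = o ψ := fun φ ψ h => by
    rcases (M.dart_eq_iff φ ψ).1 h with rfl | rfl
    · rfl
    · rw [h2]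
  have hmem : ∀ φ, (∃ ψ, M.dart ψ = M.dart φ ∧ o ψ = 1) ↔ o φ = 1 := fun φ =>
    ⟨fun ⟨ψ, h, h'⟩ => hdesc ψ φ h ▸ h', fun h => ⟨φ, rfl, h⟩⟩
  have hiff : ∀ d, d ∈ {d | ∃ ψ, M.dart ψ = d ∧ o ψ = 1} ↔
      Z.rev d ∉ {d | ∃ ψ, M.dart ψ = d ∧ o ψ = 1} := fun d => by
    obtain ⟨φ, rfl⟩ := M.dart_surjective d
    rw [← M.dart_flip]
    refine (hmem φ).trans (Iff.trans ?_ (not_congr (hmem (M.flip φ))).symm)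
    rw [hα]
    generalize o φ = x
    revert x; decide
  refine ⟨⟨_, hiff⟩, fun φ => ?_⟩
  have h := (Multigraph.Orientation.ind_eq_one_iff ⟨_, hiff⟩ (M.dart φ)).trans (hmem φ)
  revert h
  generalize Multigraph.Orientation.ind _ (M.dart φ) = x, o φ = y
  revert x y; decide

variable [Fintype Φ]

/-- The coboundary of a function of the vertices of the double cover has no face sums. -/
theorem cycleSum_next_coboundary {g : Φ → ZMod 2} (hg : ∀ φ, g (M.rot φ) = g φ) (φ : Φ) :
    cycleSum M.next (fun ψ => g ψ + g (M.flip ψ)) φ = 0 := by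
  rw [cycleSum_add]
  have : (fun ψ => g (M.flip ψ)) = fun ψ => g (M.next ψ) :=
    funext fun ψ => by rw [← M.rot_flip, hg]
  rw [this, cycleSum_comp_self, ZMod.two_add_self]

variable {c p : Φ → ZMod 2} (hc0 : ∀ φ, c (M.τ₀ φ) = c φ) (hc1 : ∀ φ, c (M.τ₁ φ) = c φ + 1)
  (hc2 : ∀ φ, c (M.τ₂ φ) = c φ + 1)
  (hp0 : ∀ φ, p (M.τ₀ φ) = p φ + 1) (hp1 : ∀ φ, p (M.τ₁ φ) = p φ + 1)

include hp0 hp1 in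
theorem sameCycle_next_iff (φ ψ : Φ) :
    M.next.SameCycle φ ψ ↔ M.face φ = M.face ψ ∧ p φ = p ψ :=
  sameCycle_mul_iff M.τ₁ M.τ₀ M.τ₁_τ₁ M.τ₀_τ₀ M.face M.face_eq_iff p hp1 hp0 φ ψ

include hp0 hp1 in
-- `τ₀` carries the walk around a face to the walk in the opposite direction.
theorem cycleSum_next_comp_τ₀ (g : Φ → ZMod 2) (φ : Φ) :
    cycleSum M.next (fun ψ => g (M.τ₀ ψ)) φ = cycleSum M.next g (M.τ₀ φ) := by
  classical
  have h : ∀ φ ψ, M.next.SameCycle φ ψ ↔ M.next.SameCycle (M.τ₀ φ) (M.τ₀ ψ) := fun φ ψ => by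
    have hf := proj_apply_right M.τ₁ M.τ₀ M.face M.face_eq_iff
    rw [M.sameCycle_next_iff hp0 hp1, M.sameCycle_next_iff hp0 hp1, hf, hf, hp0, hp0,
      add_left_inj]
  refine Finset.sum_bij (fun ψ _ => M.τ₀ ψ) (fun ψ hψ => ?_)
    (fun _ _ _ _ h => M.τ₀.injective h) (fun ψ hψ => ?_) (fun _ _ => rfl)
  · simpa [← h] using hψ
  · refine ⟨M.τ₀ ψ, ?_, M.τ₀_τ₀ ψ⟩
    simpa [h φ, M.τ₀_τ₀] using hψ

include hc0 hc2 hp0 in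
/-- The boundary of a choice of directions for the faces crosses every edge twice. -/
theorem sum_mul_eq_zero_of_edge_function {e : Φ → ZMod 2} (h0 : ∀ φ, e (M.τ₀ φ) = e φ)
    (h2 : ∀ φ, e (M.τ₂ φ) = e φ) : ∑ φ, p φ * e φ = 0 := by
  have h3 : ∑ φ, c φ * (p φ * e φ) = ∑ φ, (1 + c φ) * (p (M.τ₂ φ) * e φ) := by
    rw [← Equiv.sum_comp M.τ₂]
    exact Finset.sum_congr rfl fun φ _ => by rw [hc2, h2, add_comm (c φ)]
  have h4 : ∑ φ, p φ * e φ = ∑ φ, (1 + c φ) * ((p φ + p (M.τ₂ φ)) * e φ) := by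
    simp only [add_mul (p _), mul_add (1 + c _), Finset.sum_add_distrib]
    rw [← h3, ← Finset.sum_add_distrib]
    refine Finset.sum_congr rfl fun φ _ => ?_
    rw [add_mul, one_mul, add_assoc, ZMod.two_add_self, add_zero]
  rw [h4]
  refine sum_eq_zero_of_involution M.τ₀ M.τ₀_τ₀ M.τ₀_ne _ fun φ => ?_
  rw [hc0, h0, hp0, ← M.τ₀_τ₂, hp0]
  generalize c φ = x, p φ = y, p (M.τ₂ φ) = w, e φ = u
  revert x y w u; decide

include hc0 hc2 hp0 in
-- Of the four flags of an edge, `c = 1` selects a pair exchanged by `τ₀`, and `p = 1` one flag of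
-- that pair.
theorem sum_mul_eq_card_edge : ∑ φ, p φ * c φ = (Nat.card Z.Edge : ZMod 2) := by
  classical
  have h1 := card_eq_two_mul_card_filter M.τ₂ Finset.univ (fun _ => by simp) c hc2
  have h2 := card_eq_two_mul_card_filter M.τ₀ (Finset.univ.filter fun φ => c φ = 1)
    (fun φ => by simp [hc0]) p hp0
  have h3 := M.card_flag
  have h4 := Z.card_dart
  rw [Nat.card_eq_fintype_card] at h3
  rw [Finset.card_univ] at h1
  have h5 : (Finset.filter (fun φ => p φ = 1) (Finset.univ.filter fun φ => c φ = 1)).card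
      = Nat.card Z.Edge := by omega
  rw [← h5, Finset.filter_filter, Finset.cast_card, Finset.sum_filter]
  refine Finset.sum_congr rfl fun φ _ => ?_
  generalize c φ = x, p φ = y
  revert x y; decide

variable {z e : Φ → ZMod 2}

omit [Fintype Φ] in
include hc0 hc2 in
/-- Adding the coboundary of `z * c` shifts the asymmetry of `e` by the coboundary of `z`. -/
theorem add_coboundary_τ₂ (hz : ∀ φ, z (M.τ₂ φ) = z φ) (φ : Φ) :
    e (M.τ₂ φ) + (z (M.τ₂ φ) * c (M.τ₂ φ) + z (M.flip (M.τ₂ φ)) * c (M.flip (M.τ₂ φ)))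
      = e φ + (z φ * c φ + z (M.flip φ) * c (M.flip φ))
        + (e φ + e (M.τ₂ φ) + (z φ + z (M.flip φ))) := by
  have h1 : M.flip (M.τ₂ φ) = M.τ₂ (M.flip φ) := by
    rw [flip_apply, flip_apply, M.τ₀_τ₂]
  have h2 : c (M.flip φ) = c φ + 1 := by rw [flip_apply, hc0, hc2]
  rw [h1, hz, hz, hc2, hc2, h2]
  generalize c φ = x, z φ = y, z (M.flip φ) = w, e φ = u, e (M.τ₂ φ) = v
  revert x y w u v; decide

include hc0 hc1 hc2 in
/-- An even number of vertices suffices for the existence of a flat orientation. -/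
theorem exists_isFlat [Nonempty Φ] (hproj : M.IsProjectivePlane) (hloc : M.LocallyBipartite)
    (hV : Even (Nat.card V)) : ∃ o : Z.Orientation, M.IsFlat o := by
  classical
  have hcσ : ∀ φ, c (M.rot φ) = c φ := fun φ => by
    rw [rot_apply, hc1, hc2, add_assoc, ZMod.two_add_self, add_zero]
  have hcα : ∀ φ, c (M.flip φ) = c φ + 1 := fun φ => by rw [flip_apply, hc0, hc2]
  obtain ⟨p, hp1, hp0⟩ := exists_common_flip M.τ₁ M.τ₀ M.τ₁_τ₁ M.τ₀_τ₀ M.τ₁_ne M.τ₀_ne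
  have hpnext : ∀ φ, p (M.next φ) = p φ := fun φ => by
    rw [next_apply, hp1, hp0, add_assoc, ZMod.two_add_self, add_zero]
  -- A face has two lifts, one for each direction `p` of the walk. `h` and `h'` pick one flag from
  -- each, so `h + h'` has all face sums one.
  obtain ⟨h, hh, hph, hhs⟩ := exists_transversal M.τ₁ M.τ₀ M.τ₁_τ₁ M.τ₀_τ₀ M.face
    M.face_eq_iff M.face_surjective p hp1 hp0
  obtain ⟨h', hh', hph', hhs'⟩ := exists_transversal M.τ₁ M.τ₀ M.τ₁_τ₁ M.τ₀_τ₀ M.face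
    M.face_eq_iff M.face_surjective (fun φ => p φ + 1) (fun φ => by rw [hp1])
    (fun φ => by rw [hp0])
  have hsumh : ∀ φ, cycleSum M.next (fun ψ => h ψ + h' ψ) φ = 1 := by
    intro φ
    have e1 := cycleSum_mul_left (f := M.next) (s := p) (o := h) hpnext φ
    have e2 := cycleSum_mul_left (f := M.next) (s := fun φ => p φ + 1) (o := h')
      (fun φ => by rw [hpnext]) φ
    simp only [hph, hph'] at e1 e2
    rw [cycleSum_add]
    rcases ZMod.two_eq_zero_or_one (p φ) with h0 | h1
    · rw [e1, h0, zero_mul, zero_add]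
      exact hh' φ (by rw [h0, zero_add])
    · rw [e2, h1, show (1 + 1 : ZMod 2) = 0 from rfl, zero_mul, add_zero]
      exact hh φ h1
  have hsumt : ∀ φ, cycleSum M.next (fun ψ => h ψ + h' ψ + c ψ) φ
      = 1 + cycleSum M.next c φ := fun φ => by rw [cycleSum_add, hsumh]
  -- Writing an orientation as `e + c` makes `e` a function of the edges of the cover, and flatness
  -- prescribes its face sums. Their total is even because faces lift in pairs and `τ₀` preserves
  -- `c`.
  obtain ⟨e, heα, het⟩ := exists_edge_function M.rot M.flip M.flip_flip M.flip_ne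
    (M.cover_connected hproj) (fun φ => h φ + h' φ + c φ) (by
      rw [Finset.sum_add_distrib, Finset.sum_add_distrib, hhs, hhs', ZMod.two_add_self, zero_add]
      exact sum_eq_zero_of_involution M.τ₀ M.τ₀_τ₀ M.τ₀_ne c hc0)
  rw [rot_mul_flip] at het
  simp only [hsumt] at het
  have heτ : ∀ φ, e (M.τ₂ φ) = e (M.τ₀ φ) := fun φ => by
    rw [← heα (M.τ₂ φ), flip_apply, M.τ₂_τ₂]
  -- `e + c` descends to `Z` when `e + e ∘ τ₂ = 1`. The defect has no face sums, so it is the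
  -- coboundary of some `z`, and `z + z ∘ τ₂` is constant.
  obtain ⟨z, hzσ, hez⟩ := exists_vertex_function M.rot M.flip M.flip_flip M.flip_ne
    (M.cover_connected hproj) (M.card_cycles hproj.2) (fun φ => e φ + e (M.τ₀ φ) + 1)
    (fun φ => by
      have : e (M.τ₀ (M.flip φ)) = e (M.τ₀ φ) := by
        rw [flip_apply, M.τ₀_τ₀, heτ]
      rw [heα, this])
    (fun φ => by
      rw [rot_mul_flip, cycleSum_add, cycleSum_add, M.cycleSum_next_comp_τ₀ hp0 hp1, het, het,
        ← M.cycleSum_next_comp_τ₀ hp0 hp1]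
      simp only [hc0]
      rw [ZMod.two_add_self, zero_add, cycleSum, Finset.sum_const, nsmul_eq_mul, mul_one,
        ZMod.natCast_eq_zero_iff_even]
      have := hloc φ
      rw [sides, Set.ncard_eq_toFinset_card'] at this
      convert this using 2
      ext; simp)
  simp only [← heτ] at hez
  have hflip2 : ∀ φ, M.flip (M.τ₂ φ) = M.τ₂ (M.flip φ) := fun φ => by
    rw [flip_apply, flip_apply, M.τ₀_τ₂]
  have hz2 : ∀ φ ψ, z φ + z (M.τ₂ φ) = z ψ + z (M.τ₂ ψ) :=
    M.cover_connected hproj (fun φ => z φ + z (M.τ₂ φ))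
      (fun φ => by
        have : z (M.τ₂ (M.rot φ)) = z (M.τ₂ φ) := by
          rw [← hzσ (M.τ₂ (M.rot φ)), rot_apply, M.τ₂_τ₂, rot_apply, M.τ₁_τ₁]
        rw [hzσ, this])
      (fun φ => by
        have e1 := hez φ
        have e2 := hez (M.τ₂ φ)
        rw [M.τ₂_τ₂, hflip2] at e2
        revert e1 e2
        generalize z φ = x, z (M.τ₂ φ) = y, z (M.flip φ) = w, z (M.τ₂ (M.flip φ)) = u,
          e φ = a, e (M.τ₂ φ) = b
        revert x y w u a b; decide)
  obtain ⟨φ₀⟩ := ‹Nonempty Φ›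
  rcases ZMod.two_eq_zero_or_one (z φ₀ + z (M.τ₂ φ₀)) with h0 | h1
  -- For invariant `z`, the function `z * c` changes by `z` under `τ₂`, so adding its coboundary to
  -- `e` removes the defect without changing face sums.
  · have hz : ∀ φ, z (M.τ₂ φ) = z φ := fun φ =>
      ZMod.two_add_eq_zero_iff.1 ((hz2 φ φ₀).trans h0)
    obtain ⟨o, ho⟩ := M.exists_orientation_of_flags
      (fun φ => e φ + (z φ * c φ + z (M.flip φ) * c (M.flip φ)) + c φ)
      (fun φ => by
        rw [M.add_coboundary_τ₂ hc0 hc2 hz, hc2, ← hez]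
        generalize z φ = a, z (M.flip φ) = b, c (M.flip φ) = x, e φ = y, e (M.τ₂ φ) = w, c φ = u
        revert a b x y w u; decide)
      (fun φ => by
        rw [heα, M.flip_flip, hcα, add_comm (z (M.flip φ) * _)]
        ring)
    refine ⟨o, M.isFlat_of_cycleSum_next fun φ => ?_⟩
    simp only [ho]
    rw [cycleSum_add, cycleSum_add, het, M.cycleSum_next_coboundary (g := fun φ => z φ * c φ)
      (fun φ => by rw [hzσ, hcσ]), add_zero, add_assoc, ZMod.two_add_self, add_zero]
  -- Now `z + c` is invariant instead, and the same correction gives a function `g` of the edges of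
  -- `Z` with the prescribed face sums. Summed over one direction of every face, `g` gives 0, since
  -- every edge is met twice, while the prescribed sums give `F + E`. Hence `V` is odd by `V + F = E
  -- + 1`.
  · exfalso
    have hz : ∀ φ, z (M.τ₂ φ) + c (M.τ₂ φ) = z φ + c φ := fun φ => by
      have := (hz2 φ φ₀).trans h1
      rw [hc2]
      revert this
      generalize z φ = x, z (M.τ₂ φ) = y, c φ = w
      revert x y w; decide
    have hcob := M.add_coboundary_τ₂ (e := e) (z := fun φ => z φ + c φ) hc0 hc2 hz
    let g : Φ → ZMod 2 := fun φ => e φ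
      + ((z φ + c φ) * c φ + (z (M.flip φ) + c (M.flip φ)) * c (M.flip φ))
    have hg2 : ∀ φ, g (M.τ₂ φ) = g φ := fun φ => by
      refine (hcob φ).trans ?_
      have e1 := hez φ
      simp only [g, hcα]
      revert e1
      generalize e φ = y, e (M.τ₂ φ) = w, c φ = u, z φ = a, z (M.flip φ) = b
      revert y w u a b; decide
    have hgα : ∀ φ, g (M.flip φ) = g φ := fun φ => by
      simp only [g]
      rw [heα, M.flip_flip, add_comm ((z (M.flip φ) + c (M.flip φ)) * _)]
    have hg0 : ∀ φ, g (M.τ₀ φ) = g φ := fun φ => by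
      rw [← hg2 φ, ← hgα (M.τ₂ φ), flip_apply, M.τ₂_τ₂]
    have hgsum : ∀ φ, cycleSum M.next g φ = 1 + cycleSum M.next c φ := fun φ => by
      rw [← het]
      simp only [g]
      rw [cycleSum_add, M.cycleSum_next_coboundary (g := fun φ => (z φ + c φ) * c φ)
        (fun φ => by rw [hzσ, hcσ]), add_zero]
    have hs1 : ∑ φ, p φ * (g φ + (h φ + h' φ + c φ)) = 0 :=
      sum_eq_zero_of_cycleSum (f := M.next) fun φ => by
        rw [cycleSum_mul_left hpnext, cycleSum_add, hgsum, hsumt, ZMod.two_add_self, mul_zero]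
    have hph0 : ∀ φ, p φ * h' φ = 0 := fun φ => by
      have := hph' φ
      revert this
      generalize p φ = x, h' φ = y
      revert x y; decide
    simp only [mul_add, Finset.sum_add_distrib, hph, hph0, hhs,
      M.sum_mul_eq_zero_of_edge_function hc0 hc2 hp0 hg0 hg2, zero_add, add_zero,
      M.sum_mul_eq_card_edge hc0 hc2 hp0] at hs1
    have hχ := congrArg (Nat.cast : ℕ → ZMod 2) (M.card_vert_add_card_face hproj.2)
    push_cast at hχ
    rw [ZMod.two_add_eq_zero_iff.1 hs1, (ZMod.natCast_eq_zero_iff_even).2 hV, zero_add] at hχ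
    simp at hχ

omit [Fintype Φ] in
theorem isPfaffianOrientation_of_isFlat [Finite V] [Finite D] [Nonempty Φ]
    (hproj : M.IsProjectivePlane) (hloc : M.LocallyBipartite) (hglob : ¬ Z.IsBipartite)
    {o : Z.Orientation} (ho : M.IsFlat o) : Z.IsPfaffianOrientation o := by
  have := M.finite_flag
  have := Fintype.ofFinite Φ
  obtain ⟨c, hc0, hc1, hc2⟩ := M.exists_cover_colouring hproj hloc hglob
  refine Multigraph.isPfaffianOrientation_of_sign fun m m' hm hm' π hπ hπT => ?_
  obtain ⟨β, hβ, hβ'⟩ := exists_common_flip hm.mate hm'.mate hm.mate_mate hm'.mate_mate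
    hm.mate_ne hm'.mate_ne
  have h : ∀ v, β ((hm'.mate * hm.mate) v) = 1 ↔ β v = 1 := fun v => by
    rw [Equiv.Perm.mul_apply, hβ', hβ, add_assoc, ZMod.two_add_self, add_zero]
  rw [sign_pairing hm.mate_mate hm'.mate_mate hβ hβ' (hm.tail_mate o) (hm'.tail_mate o) hπ hπT h,
    M.sign_matchings hc0 hc1 hc2 hproj ho hm hm' hβ hβ' h, zsign_mul_self]

end CellEmbedding

theorem mainTheorem2 {V D Φ : Type*} [Finite V] [Finite D] (Z : Multigraph V D)
    (M : CellEmbedding Z Φ) (hconn : Z.Connected) (hproj : M.IsProjectivePlane)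
    (hloc : M.LocallyBipartite) (hglob : ¬ Z.IsBipartite) :
    Z.IsPfaffian ∧
    (Even (Nat.card V) → ∃ o : Z.Orientation, M.IsFlat o) ∧
    ∀ o : Z.Orientation, M.IsFlat o →
      Z.IsPfaffianOrientation o ∧
      ∀ (k : ℕ) (ord : Fin (2 * k) ≃ V), |Z.pf o ord| = (Z.numPerfectMatchings : ℤ) := by
  have := M.finite_flag
  have := Fintype.ofFinite Φ
  obtain ⟨v⟩ := hconn.1
  obtain ⟨φ, -⟩ := M.vert_surjective v
  have : Nonempty Φ := ⟨φ⟩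
  have hflat : Even (Nat.card V) → ∃ o : Z.Orientation, M.IsFlat o := fun hV => by
    obtain ⟨c, hc0, hc1, hc2⟩ := M.exists_cover_colouring hproj hloc hglob
    exact M.exists_isFlat hc0 hc1 hc2 hproj hloc hV
  have hpf : ∀ o : Z.Orientation, M.IsFlat o → Z.IsPfaffianOrientation o := fun o ho =>
    M.isPfaffianOrientation_of_isFlat hproj hloc hglob ho
  refine ⟨?_, hflat, fun o ho => ⟨hpf o ho, fun k ord => Multigraph.abs_pf_eq (hpf o ho) ord⟩⟩
  by_cases hV : Even (Nat.card V)
  · obtain ⟨o, ho⟩ := hflat hV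
    exact ⟨o, hpf o ho⟩
  -- With an odd number of vertices there is no ordering `ord` by `Fin (2 * k)`, so any orientation
  -- serves.
  · obtain ⟨o⟩ := Z.exists_orientation
    refine ⟨o, fun k ord => absurd ?_ hV⟩
    rw [← Nat.card_congr ord, Nat.card_eq_fintype_card, Fintype.card_fin]
    exact even_two_mul k
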